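/- Let $N\ge 3$ be an integer, $\alpha\in(0,N)$, $p,q>1$ and $\gamma\in\mathbb R$. Let $$I_\alpha(x)=\frac{A_\alpha}{|x|^{N-\alpha}},\qquad A_\alpha=\frac{\Gamma\left(\frac{N-\alpha}{2}\right)}{\Gamma\left(\frac{\alpha}{2}\right)\pi^{N/2}2^{\alpha}},$$ be the Riesz kernel on $\mathbb R^N$, let $K(x)=(1+|x|^2)^{-\gamma/2}$, and consider the system $$\begin{cases}-\Delta u+u+K(x)\,\phi\,|u|^{q-2}u=(I_\alpha*|u|^p)\,|u|^{p-2}u & \text{in }\mathbb R^N,\\ -\Delta\phi=K(x)\,|u|^q & \text{in }\mathbb R^N,\end{cases}\tag{S}$$ for real-valued $u,\phi$, understood in the weak sense (tested against $C_c^\infty(\mathbb R^N)$, all terms being well defined and locally integrable). Assume that one of the following holds: 1. $0\le\gamma<\frac{N+2}{2}$, $\;p\ge\frac{N+\alpha}{N-2}\;$ and $\;\frac{N+\alpha}{p}\le\frac{N+2-2\gamma}{q}$; 2. $\gamma\le 0$, $\;p\le\frac{N+\alpha}{N}\;$ and $\;\frac{N+\alpha}{p}\ge\frac{N+2-2\gamma}{q}$.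 Then the only weak solution $(u,\phi)$ of (S) such that $$u\in H^1(\mathbb R^N)\cap L^{\frac{2Np}{N+\alpha}}(\mathbb R^N),\quad \phi\in H^1(\mathbb R^N),\quad K|u|^q\in L^{\frac{2N}{N+2}}(\mathbb R^N),\quad \nabla u\in H^1_{loc}(\mathbb R^N)\cap L^{\frac{2Np}{N+\alpha}}_{loc}(\mathbb R^N)$$ (where $\nabla u$ is the weak gradient of $u$, and membership in $H^1_{loc}$ is meant for each of its components) is the trivial one, $u=\phi=0$ almost everywhere. -/

import Mathlib

open MeasureTheory
open scoped ContDiff Gradient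

noncomputable section

namespace ChoquardPoisson

/-- The Euclidean space `ℝ^N`. -/
abbrev Space (N : ℕ) : Type := EuclideanSpace ℝ (Fin N)

/-- Test functions: the space `C_c^∞(ℝ^N)`. -/
structure IsTest {N : ℕ} (ψ : Space N → ℝ) : Prop where
  smooth : ContDiff ℝ ∞ ψ
  compact : HasCompactSupport ψ

/-- `G` is the weak (distributional) gradient of `u` on `ℝ^N`. The last field is the vector identity
`∫ u ∇ψ = - ∫ ψ G`, that is, `∫ u ∂ᵢψ = - ∫ Gᵢ ψ` for every coordinate `i`. -/
structure HasWeakGradient {N : ℕ} (u : Space N → ℝ) (G : Space N → Space N) : Prop where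
  locInt : LocallyIntegrable u
  locInt_grad : LocallyIntegrable G
  integral_eq : ∀ ψ : Space N → ℝ, IsTest ψ → ∫ x, u x • ∇ ψ x = -∫ x, ψ x • G x

/-- `f ∈ L^r_loc(ℝ^N)`: `f` is in `L^r(S)` for every compact set `S`. -/
def MemLpLoc {N : ℕ} {F : Type*} [NormedAddCommGroup F] (f : Space N → F) (r : ENNReal) : Prop :=
  ∀ S : Set (Space N), IsCompact S → MemLp f r (volume.restrict S)

/-- `u ∈ H^1(ℝ^N)`. -/
def MemH1 {N : ℕ} (u : Space N → ℝ) : Prop :=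
  MemLp u 2 ∧ ∃ G : Space N → Space N, HasWeakGradient u G ∧ MemLp G 2

/-- `u ∈ H^1_loc(ℝ^N)`. -/
def MemH1Loc {N : ℕ} (u : Space N → ℝ) : Prop :=
  MemLpLoc u 2 ∧ ∃ G : Space N → Space N, HasWeakGradient u G ∧ MemLpLoc G 2

/-- The Riesz kernel `I_α(x) = A_α / |x|^(N-α)`,
`A_α = Γ((N-α)/2) / (Γ(α/2) π^(N/2) 2^α)`. -/
def rieszKernel (N : ℕ) (α : ℝ) (x : Space N) : ℝ :=
  Real.Gamma (((N : ℝ) - α) / 2) / (Real.Gamma (α / 2) * Real.pi ^ ((N : ℝ) / 2) * 2 ^ α)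
    / ‖x‖ ^ ((N : ℝ) - α)

/-- The convolution `I_α * f`. -/
def rieszPotential {N : ℕ} (α : ℝ) (f : Space N → ℝ) (x : Space N) : ℝ :=
  ∫ y, rieszKernel N α (x - y) * f y

/-- The coefficient `K(x) = (1 + |x|²)^(-γ/2)`. -/
def weight {N : ℕ} (γ : ℝ) (x : Space N) : ℝ :=
  (1 + ‖x‖ ^ 2) ^ (-γ / 2)

/-- `(u, φ)` is a weak solution on `ℝ^N` of the system
`-Δu + u + K φ |u|^(q-2) u = (I_α * |u|^p) |u|^(p-2) u`, `-Δφ = K |u|^q`.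
All terms are required to make sense: `u`, `φ` have weak gradients, the integral that defines
`I_α * |u|^p` converges almost everywhere, and the nonlinear terms are in `L^1_loc`. -/
structure IsWeakSolution {N : ℕ} (α p q : ℝ) (K u φ : Space N → ℝ) : Prop where
  conv_exists : ∀ᵐ x : Space N, Integrable fun y => rieszKernel N α (x - y) * |u y| ^ p
  locInt_choquard : LocallyIntegrable fun x =>
    rieszPotential α (fun y => |u y| ^ p) x * |u x| ^ (p - 2) * u x
  locInt_coupling : LocallyIntegrable fun x => K x * φ x * |u x| ^ (q - 2) * u x
  locInt_source : LocallyIntegrable fun x => K x * |u x| ^ q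
  first_eq : ∃ G : Space N → Space N, HasWeakGradient u G ∧ ∀ ψ : Space N → ℝ, IsTest ψ →
    (∫ x, inner ℝ (G x) (∇ ψ x)) + (∫ x, u x * ψ x)
        + (∫ x, K x * φ x * |u x| ^ (q - 2) * u x * ψ x)
      = ∫ x, rieszPotential α (fun y => |u y| ^ p) x * |u x| ^ (p - 2) * u x * ψ x
  second_eq : ∃ H : Space N → Space N, HasWeakGradient φ H ∧ ∀ ψ : Space N → ℝ, IsTest ψ →
    ∫ x, inner ℝ (H x) (∇ ψ x) = ∫ x, K x * |u x| ^ q * ψ x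

/-- The regularity class:
`u ∈ H^1 ∩ L^(2Np/(N+α))`, `φ ∈ H^1`, `K |u|^q ∈ L^(2N/(N+2))`, and
`∇u ∈ H^1_loc ∩ L^(2Np/(N+α))_loc`, where `∇u` is the weak gradient of `u`. -/
structure IsRegular {N : ℕ} (α p q : ℝ) (K u φ : Space N → ℝ) : Prop where
  u_H1 : MemH1 u
  u_Lp : MemLp u (ENNReal.ofReal (2 * N * p / (N + α)))
  phi_H1 : MemH1 φ
  source_Lp : MemLp (fun x => K x * |u x| ^ q) (ENNReal.ofReal (2 * N / (N + 2)))
  grad_u : ∃ G : Space N → Space N, HasWeakGradient u G ∧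
    (∀ i : Fin N, MemH1Loc fun x => G x i) ∧
    MemLpLoc G (ENNReal.ofReal (2 * N * p / (N + α)))

end ChoquardPoisson

end

/-! The proof is a Pohozaev argument. Put S = K|u|^q, A = ∫|∇u|², B = ∫u², C = ∫φS, and let E be the
integral of φS|x|²/(1+|x|²). Testing the first equation with u and with x·∇u, and eliminating the
Choquard energy between the two results, gives (2 - N + (N+α)/p) A + ((N+α)/p - N) B + ((N+α)/p -
(N+2)/q) C + (2γ/q) E = 0, with 0 ≤ E ≤ C. This is `pohozaev_identity`. In case 1 every contribution
is nonpositive once E is compared with C, and the coefficient of B is at most -2, so B = 0. In case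
2 every contribution is nonnegative and the coefficient of A is at least 2, so ∇u = 0, which forces
u = 0 because u is square integrable.

The work lies in justifying the test function x·∇u, cut off at infinity. Both nonlocal terms are
quadratic forms in the kernel |x-y|^(-μ): with density |u|^p and μ = N-α for the Choquard term, and
with density S and μ = N-2 for the coupling, since φ is a positive multiple of the Newton potential
of S (`exists_eq_newton_potential`). The dilation identity `tendsto_integral_kern_dilation` handles
both. It is proved for the smooth kernel (|z|²+ε²)^(-μ/2) and symmetrised in x and y, so that the
singularity of the differentiated kernel is absorbed by the Lipschitz bound on the vector field;
then ε tends to 0 and the cutoff to 1. The double integrals converge by the diagonal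
Hardy-Littlewood-Sobolev inequality `integrable_kern_mul`. The local terms are treated by the
Rellich identity `integral_laplacian_mul_euler`, available since ∇u is in H¹_loc.

The delicate point is that S needs a weak gradient, that is, |u|^(q-1)|∇u| must be locally
integrable, which the regularity class does not supply. It comes from the equation: multiplied by
|∇u|, every term other than the coupling is locally integrable, so Kφ|u|^(q-1)|∇u| is too; and φ,
the potential of a nonzero nonnegative density, is bounded below on compact sets, so it can be
divided out (`locallyIntegrable_rpow_mul_norm`). -/

noncomputable section

namespace ChoquardPoisson

open Filter Topology Metric Set Function ContinuousLinearMap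
open scoped Convolution

variable {N : ℕ}

/-! ### Test functions -/

namespace IsTest

variable {ψ η : Space N → ℝ}

lemma continuous (h : IsTest ψ) : Continuous ψ := h.smooth.continuous

lemma differentiable (h : IsTest ψ) : Differentiable ℝ ψ :=
  h.smooth.differentiable (by simp)

lemma mul_left (h : IsTest ψ) {g : Space N → ℝ} (hg : ContDiff ℝ ∞ g) :
    IsTest fun x => g x * ψ x :=
  ⟨hg.mul h.smooth, h.compact.mul_left⟩

lemma mul_right (h : IsTest ψ) {g : Space N → ℝ} (hg : ContDiff ℝ ∞ g) :
    IsTest fun x => ψ x * g x :=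
  ⟨h.smooth.mul hg, h.compact.mul_right⟩

lemma fderiv_apply (h : IsTest ψ) (v : Space N) : IsTest fun x => fderiv ℝ ψ x v :=
  ⟨(h.smooth.fderiv_right (m := ∞) (by simp)).clm_apply contDiff_const, h.compact.fderiv_apply ℝ v⟩

lemma continuous_fderiv (h : IsTest ψ) : Continuous (fderiv ℝ ψ) :=
  h.smooth.continuous_fderiv (by simp)

lemma comp_sub_left (h : IsTest ψ) (a : Space N) : IsTest fun x => ψ (a - x) :=
  ⟨h.smooth.comp (contDiff_const.sub contDiff_id),
    h.compact.comp_homeomorph (Homeomorph.subLeft a)⟩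

lemma integrable_mul (h : IsTest ψ) {f : Space N → ℝ} (hf : LocallyIntegrable f) :
    Integrable fun x => f x * ψ x := by
  simpa [mul_comm] using
    hf.integrable_smul_left_of_hasCompactSupport h.continuous h.compact

lemma integrable (h : IsTest ψ) : Integrable ψ :=
  h.continuous.integrable_of_hasCompactSupport h.compact

lemma memLp (h : IsTest ψ) (r : ENNReal) : MemLp ψ r :=
  h.continuous.memLp_of_hasCompactSupport h.compact

lemma exists_bound (h : IsTest ψ) : ∃ C, 0 ≤ C ∧ ∀ x, |ψ x| ≤ C := by
  obtain ⟨C, hC⟩ := h.compact.exists_bound_of_continuous h.continuous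
  exact ⟨C, (norm_nonneg _).trans (hC 0), hC⟩

end IsTest

/-! ### Mollification -/

/-- A sequence of bump functions whose supports shrink to the origin. -/
def mollifier (N n : ℕ) : ContDiffBump (0 : Space N) where
  -- The ratio `rOut / rIn` is 2 for every n; almost everywhere convergence of the mollifications
  -- requires it to stay bounded.
  rIn := 1 / (2 * ((n : ℝ) + 1))
  rOut := 1 / ((n : ℝ) + 1)
  rIn_pos := by positivity
  rIn_lt_rOut := by
    apply one_div_lt_one_div_of_lt <;> nlinarith [(n.cast_nonneg : (0 : ℝ) ≤ n)]

lemma mollifier_rOut (n : ℕ) : (mollifier N n).rOut = 1 / ((n : ℝ) + 1) := rfl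

lemma mollifier_rOut_le (n : ℕ) : (mollifier N n).rOut ≤ 1 := by
  rw [mollifier_rOut, div_le_one (by positivity)]
  linarith [(n.cast_nonneg : (0 : ℝ) ≤ n)]

lemma tendsto_mollifier_rOut : Tendsto (fun n => (mollifier N n).rOut) atTop (𝓝 0) :=
  tendsto_one_div_add_atTop_nhds_zero_nat

/-- The mollification of `f` at scale `1 / (n + 1)`. -/
def mollify (n : ℕ) (f : Space N → ℝ) : Space N → ℝ :=
  ((mollifier N n).normed volume ⋆[lsmul ℝ ℝ, volume] f : Space N → ℝ)

lemma isTest_normed (φ : ContDiffBump (0 : Space N)) : IsTest (φ.normed volume) :=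
  ⟨φ.contDiff_normed, φ.hasCompactSupport_normed⟩

lemma mollify_apply (n : ℕ) (f : Space N → ℝ) (x : Space N) :
    mollify n f x = ∫ t, f t * (mollifier N n).normed volume (x - t) := by
  rw [mollify, convolution_eq_swap]
  simp [mul_comm]

lemma contDiff_mollify (n : ℕ) {f : Space N → ℝ} (hf : LocallyIntegrable f) :
    ContDiff ℝ ∞ (mollify n f) :=
  (isTest_normed _).compact.contDiff_convolution_left _ (isTest_normed _).smooth hf

lemma ae_tendsto_mollify {f : Space N → ℝ} (hf : LocallyIntegrable f) :
    ∀ᵐ x, Tendsto (fun n => mollify n f x) atTop (𝓝 (f x)) := by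
  refine ContDiffBump.ae_convolution_tendsto_right_of_locallyIntegrable (K := 2)
    tendsto_mollifier_rOut (Eventually.of_forall fun n => ?_) hf
  change 1 / ((n : ℝ) + 1) ≤ 2 * (1 / (2 * ((n : ℝ) + 1)))
  apply le_of_eq
  field_simp

lemma mollify_sub (n : ℕ) {f g : Space N → ℝ} (hf : LocallyIntegrable f)
    (hg : LocallyIntegrable g) (x : Space N) :
    mollify n (fun y => f y - g y) x = mollify n f x - mollify n g x := by
  simp only [mollify_apply]
  rw [← integral_sub (((isTest_normed _).comp_sub_left x).integrable_mul hf)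
    (((isTest_normed _).comp_sub_left x).integrable_mul hg)]
  simp [sub_mul]

lemma integrable_mollify (n : ℕ) {f : Space N → ℝ} (hf : Integrable f) :
    Integrable (mollify n f) :=
  (isTest_normed _).integrable.integrable_convolution _ hf

/-- Pointwise, the mollification of f is dominated by that of |f|, and convolution with a
probability density preserves the integral. -/
lemma integral_abs_mollify_le (n : ℕ) {f : Space N → ℝ} (hf : Integrable f) :
    ∫ x, |mollify n f x| ≤ ∫ x, |f x| := by
  have h1 : ∫ x, mollify n (fun y => |f y|) x = ∫ x, |f x| := by
    unfold mollify
    rw [integral_convolution (lsmul ℝ ℝ) (isTest_normed _).integrable hf.abs,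
      ContDiffBump.integral_normed]
    simp
  rw [← h1]
  refine integral_mono (integrable_mollify n hf).abs (integrable_mollify n hf.abs) fun x => ?_
  simp only [mollify_apply]
  refine abs_integral_le_integral_abs.trans_eq (integral_congr_ae (Eventually.of_forall fun t => ?_))
  simp only [abs_mul, abs_of_nonneg (ContDiffBump.nonneg_normed _ _)]

/-- Dominated convergence: the mollifications converge pointwise, are bounded by sup |g|, and vanish
outside one fixed ball because all radii are at most 1. -/
lemma tendsto_integral_mollify_sub_of_continuous {g : Space N → ℝ} (hg : Continuous g)
    (hc : HasCompactSupport g) :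
    Tendsto (fun n => ∫ x, |mollify n g x - g x|) atTop (𝓝 0) := by
  obtain ⟨M, hM⟩ := hc.exists_bound_of_continuous hg
  have hM0 : 0 ≤ M := (norm_nonneg _).trans (hM 0)
  obtain ⟨R, hR⟩ := hc.isCompact.isBounded.subset_closedBall (0 : Space N)
  have hz : ∀ x, x ∉ closedBall (0 : Space N) (R + 1) →
      ∀ t, dist t x ≤ 1 → g t = 0 := by
    intro x hx t ht
    by_contra hne
    have := hR (subset_tsupport g hne)
    simp only [mem_closedBall] at this hx
    linarith [dist_triangle x t 0, dist_comm x t]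
  have hbd : ∀ n x, |mollify n g x| ≤ M := by
    intro n x
    rw [mollify_apply]
    have h1 : Integrable fun t => (mollifier N n).normed volume (x - t) :=
      ((isTest_normed _).comp_sub_left x).integrable
    have : ∫ t, (mollifier N n).normed volume (x - t) = 1 := by
      rw [integral_sub_left_eq_self, ContDiffBump.integral_normed]
    calc |∫ t, g t * (mollifier N n).normed volume (x - t)|
        ≤ ∫ t, |g t * (mollifier N n).normed volume (x - t)| := abs_integral_le_integral_abs
      _ ≤ ∫ t, M * (mollifier N n).normed volume (x - t) := by
          refine integral_mono_of_nonneg (Eventually.of_forall fun t => abs_nonneg _)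
            (h1.const_mul M) (Eventually.of_forall fun t => ?_)
          simp only [abs_mul, abs_of_nonneg (ContDiffBump.nonneg_normed _ _)]
          exact mul_le_mul_of_nonneg_right (hM t) (ContDiffBump.nonneg_normed _ _)
      _ = M := by rw [integral_const_mul, this, mul_one]
  have hzero : ∀ n x, x ∉ closedBall (0 : Space N) (R + 1) → mollify n g x = 0 := by
    intro n x hx
    rw [mollify_apply]
    refine integral_eq_zero_of_ae (Eventually.of_forall fun t => ?_)
    by_cases ht : dist t x ≤ 1
    · simp [hz x hx t ht]
    · have : x - t ∉ support ((mollifier N n).normed volume) := by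
        rw [ContDiffBump.support_normed_eq]
        simp only [mem_ball, dist_zero_right, not_lt]
        rw [← dist_eq_norm, dist_comm]
        exact (mollifier_rOut_le n).trans (not_le.1 ht).le
      simp [notMem_support.1 this]
  have h0 : (0 : ℝ) = ∫ _x : Space N, (0 : ℝ) := by simp
  rw [h0]
  refine tendsto_integral_of_dominated_convergence
    ((closedBall (0 : Space N) (R + 1)).indicator fun _ => 2 * M) (fun n => ?_) ?_
    (fun n => Eventually.of_forall fun x => ?_) (Eventually.of_forall fun x => ?_)
  · exact (((contDiff_mollify n hg.locallyIntegrable).continuous.sub hg).abs).aestronglyMeasurable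
  · rw [integrable_indicator_iff measurableSet_closedBall]
    exact integrableOn_const measure_closedBall_lt_top.ne
  · by_cases hx : x ∈ closedBall (0 : Space N) (R + 1)
    · rw [indicator_of_mem hx]
      have := hM x
      have h2 := hbd n x
      simp only [Real.norm_eq_abs, abs_abs] at *
      calc |mollify n g x - g x| ≤ |mollify n g x| + |g x| := abs_sub _ _
        _ ≤ _ := by linarith
    · rw [indicator_of_notMem hx, hzero n x hx, hz x hx x (by simp)]
      simp
  · have := ContDiffBump.convolution_tendsto_right_of_continuous (μ := volume)
      (tendsto_mollifier_rOut (N := N)) hg x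
    have h3 := (this.sub_const (g x)).abs
    rw [sub_self, abs_zero] at h3
    exact h3

/-- Density of compactly supported continuous functions in L¹, together with the contraction
property `integral_abs_mollify_le`. -/
lemma tendsto_integral_mollify_sub {f : Space N → ℝ} (hf : Integrable f) :
    Tendsto (fun n => ∫ x, |mollify n f x - f x|) atTop (𝓝 0) := by
  rw [Metric.tendsto_atTop]
  intro ε hε
  obtain ⟨g, hgc, hfg, hg, hgi⟩ := hf.exists_hasCompactSupport_integral_sub_le (ε := ε / 3)
    (by positivity)
  obtain ⟨n₀, hn₀⟩ := Metric.tendsto_atTop.1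
    (tendsto_integral_mollify_sub_of_continuous hg hgc) (ε / 3) (by positivity)
  refine ⟨n₀, fun n hn => ?_⟩
  have h1 := hn₀ n hn
  rw [Real.dist_0_eq_abs, abs_of_nonneg (integral_nonneg fun _ => abs_nonneg _)] at h1 ⊢
  have h2 := integral_abs_mollify_le n (hf.sub hgi)
  simp only [Real.norm_eq_abs, Pi.sub_apply] at hfg h2
  have i1 : Integrable fun x => |mollify n (fun y => f y - g y) x| :=
    (integrable_mollify n (hf.sub hgi)).abs
  have i2 : Integrable fun x => |mollify n g x - g x| :=
    ((integrable_mollify n hgi).sub hgi).abs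
  have i3 : Integrable fun x => |f x - g x| := (hf.sub hgi).abs
  calc ∫ x, |mollify n f x - f x|
      ≤ ∫ x, (|mollify n (fun y => f y - g y) x| + |mollify n g x - g x| + |f x - g x|) := by
        refine integral_mono ((integrable_mollify n hf).sub hf).abs ((i1.add i2).add i3)
          fun x => ?_
        simp only
        rw [mollify_sub n hf.locallyIntegrable hgi.locallyIntegrable]
        have : mollify n f x - f x = (mollify n f x - mollify n g x) + (mollify n g x - g x)
            + (g x - f x) := by ring
        rw [this, abs_sub_comm (f x) (g x)]
        exact abs_add_three _ _ _
    _ = (∫ x, |mollify n (fun y => f y - g y) x|) + (∫ x, |mollify n g x - g x|)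
        + ∫ x, |f x - g x| := by
        have i12 : Integrable fun x => |mollify n (fun y => f y - g y) x| + |mollify n g x - g x| :=
          i1.add i2
        rw [integral_add i12 i3, integral_add i1 i2]
    _ < ε := by
        have : ∫ x, |mollify n (fun y => f y - g y) x| ≤ ∫ x, |f x - g x| := h2
        linarith

lemma mollify_congr_of_ball (n : ℕ) {f g : Space N → ℝ} {x : Space N}
    (h : ∀ t ∈ ball x 1, f t = g t) : mollify n f x = mollify n g x := by
  simp only [mollify_apply]
  refine integral_congr_ae (Eventually.of_forall fun t => ?_)
  by_cases ht : t ∈ ball x 1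
  · simp [h t ht]
  · have : x - t ∉ support ((mollifier N n).normed volume) := by
      rw [ContDiffBump.support_normed_eq]
      simp only [mem_ball, dist_zero_right, not_lt] at ht ⊢
      rw [← dist_eq_norm, dist_comm]
      exact (mollifier_rOut_le n).trans ht
    simp [notMem_support.1 this]

/-- Mollification at x only sees the unit ball around x, so f can be replaced by its restriction to
a ball of radius one larger than needed, which is integrable. -/
lemma tendsto_setIntegral_mollify_sub {f : Space N → ℝ} (hf : LocallyIntegrable f)
    {S : Set (Space N)} (hS : IsCompact S) :
    Tendsto (fun n => ∫ x in S, |mollify n f x - f x|) atTop (𝓝 0) := by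
  obtain ⟨R, hR⟩ := hS.isBounded.subset_closedBall (0 : Space N)
  set F : Space N → ℝ := (closedBall (0 : Space N) (R + 1)).indicator f with hF
  have hFi : Integrable F := by
    rw [hF, integrable_indicator_iff measurableSet_closedBall]
    exact hf.integrableOn_isCompact (isCompact_closedBall _ _)
  have key := tendsto_integral_mollify_sub hFi
  refine squeeze_zero (fun n => integral_nonneg fun _ => abs_nonneg _) (fun n => ?_) key
  have hEq : EqOn (fun x => |mollify n f x - f x|) (fun x => |mollify n F x - F x|) S := by
    intro x hx
    have hx' := hR hx
    rw [mem_closedBall] at hx'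
    have hloc : ∀ t ∈ ball x 1, F t = f t := by
      intro t ht
      rw [hF, indicator_of_mem]
      rw [mem_closedBall]
      rw [mem_ball] at ht
      linarith [dist_triangle t x 0]
    simp only
    rw [mollify_congr_of_ball n hloc, hloc x (by simp)]
  rw [setIntegral_congr_fun hS.measurableSet hEq]
  exact setIntegral_le_integral ((integrable_mollify n hFi).sub hFi).abs
    (Eventually.of_forall fun _ => abs_nonneg _)

end ChoquardPoisson

namespace ChoquardPoisson

open Filter Topology Metric Set Function ContinuousLinearMap
open scoped Convolution

variable {N : ℕ}

/-! ### Weak directional derivatives -/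

/-- `g` is the weak derivative of `f` in the direction `v`. -/
structure WeakDeriv (v : Space N) (f g : Space N → ℝ) : Prop where
  locInt : LocallyIntegrable f
  locInt_deriv : LocallyIntegrable g
  integral_eq : ∀ ψ : Space N → ℝ, IsTest ψ →
    ∫ x, f x * fderiv ℝ ψ x v = -∫ x, g x * ψ x

lemma inner_gradient {ψ : Space N → ℝ} (x v : Space N) :
    inner ℝ v (∇ ψ x) = fderiv ℝ ψ x v := by
  rw [real_inner_comm]
  exact InnerProductSpace.toDual_symm_apply

lemma IsTest.continuous_gradient {ψ : Space N → ℝ} (h : IsTest ψ) : Continuous (∇ ψ) :=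
  (InnerProductSpace.toDual ℝ (Space N)).symm.continuous.comp h.continuous_fderiv

lemma IsTest.compact_gradient {ψ : Space N → ℝ} (h : IsTest ψ) : HasCompactSupport (∇ ψ) :=
  (h.compact.fderiv ℝ).comp_left (g := (InnerProductSpace.toDual ℝ (Space N)).symm) (by simp)

lemma LocallyIntegrable.continuous_mul {f η : Space N → ℝ} (hf : LocallyIntegrable f)
    (hη : Continuous η) : LocallyIntegrable fun x => η x * f x := by
  rw [locallyIntegrable_iff] at hf ⊢
  exact fun S hS => (hf S hS).continuousOn_mul hη.continuousOn hS

lemma LocallyIntegrable.inner_const {G : Space N → Space N} (hG : LocallyIntegrable G)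
    (v : Space N) : LocallyIntegrable fun x => inner ℝ (G x) v := by
  rw [locallyIntegrable_iff] at hG ⊢
  exact fun S hS => (hG S hS).inner_const v

lemma HasWeakGradient.weakDeriv {u : Space N → ℝ} {G : Space N → Space N}
    (h : HasWeakGradient u G) (v : Space N) : WeakDeriv v u fun x => inner ℝ (G x) v := by
  refine ⟨h.locInt, LocallyIntegrable.inner_const h.locInt_grad v, fun ψ hψ => ?_⟩
  have h1 : Integrable fun x => u x • ∇ ψ x :=
    h.locInt.integrable_smul_right_of_hasCompactSupport hψ.continuous_gradient hψ.compact_gradient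
  have h2 : Integrable fun x => ψ x • G x :=
    h.locInt_grad.integrable_smul_left_of_hasCompactSupport hψ.continuous hψ.compact
  have e := congrArg (fun w => inner ℝ v w) (h.integral_eq ψ hψ)
  simp only [inner_neg_right] at e
  rw [← integral_inner h1, ← integral_inner h2] at e
  simp only [inner_smul_right, inner_gradient] at e
  rw [e]
  congr 1
  refine integral_congr_ae (Eventually.of_forall fun x => ?_)
  simp only [real_inner_comm v]
  ring

namespace WeakDeriv

variable {v : Space N} {f g f' g' : Space N → ℝ}

lemma ae_unique (h : WeakDeriv v f g) (h' : WeakDeriv v f g') : g =ᵐ[volume] g' := by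
  refine ae_eq_of_integral_contDiff_smul_eq h.locInt_deriv h'.locInt_deriv fun ψ hψ hc => ?_
  have e1 := h.integral_eq ψ ⟨hψ, hc⟩
  have e2 := h'.integral_eq ψ ⟨hψ, hc⟩
  simp only [smul_eq_mul, mul_comm (ψ _)]
  linarith

lemma congr_right (h : WeakDeriv v f g) (e : g =ᵐ[volume] g') : WeakDeriv v f g' := by
  refine ⟨h.locInt, h.locInt_deriv.congr e, fun ψ hψ => ?_⟩
  rw [h.integral_eq ψ hψ]
  congr 1
  refine integral_congr_ae ?_
  filter_upwards [e] with x hx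
  rw [hx]

lemma add (h : WeakDeriv v f f') (k : WeakDeriv v g g') :
    WeakDeriv v (fun x => f x + g x) fun x => f' x + g' x := by
  refine ⟨h.locInt.add k.locInt, h.locInt_deriv.add k.locInt_deriv, fun ψ hψ => ?_⟩
  simp only [add_mul]
  rw [integral_add ((hψ.fderiv_apply v).integrable_mul h.locInt)
    ((hψ.fderiv_apply v).integrable_mul k.locInt), integral_add
    (hψ.integrable_mul h.locInt_deriv) (hψ.integrable_mul k.locInt_deriv),
    h.integral_eq ψ hψ, k.integral_eq ψ hψ]
  ring

lemma const_mul (h : WeakDeriv v f f') (c : ℝ) :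
    WeakDeriv v (fun x => c * f x) fun x => c * f' x := by
  refine ⟨h.locInt.smul c, h.locInt_deriv.smul c, fun ψ hψ => ?_⟩
  simp only [mul_assoc]
  rw [integral_const_mul, integral_const_mul, h.integral_eq ψ hψ]
  ring

lemma sub (h : WeakDeriv v f f') (k : WeakDeriv v g g') :
    WeakDeriv v (fun x => f x - g x) fun x => f' x - g' x := by
  simpa [sub_eq_add_neg] using h.add (k.const_mul (-1))

/-- The weak Leibniz rule with one smooth factor. -/
lemma mul_smooth (h : WeakDeriv v f f') {η : Space N → ℝ} (hη : ContDiff ℝ ∞ η) :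
    WeakDeriv v (fun x => η x * f x) fun x => η x * f' x + fderiv ℝ η x v * f x := by
  have hd : Continuous fun x => fderiv ℝ η x v :=
    (hη.continuous_fderiv (by simp)).clm_apply continuous_const
  have i1 : LocallyIntegrable fun x => η x * f x := LocallyIntegrable.continuous_mul h.locInt hη.continuous
  have i2 : LocallyIntegrable fun x => η x * f' x :=
    LocallyIntegrable.continuous_mul h.locInt_deriv hη.continuous
  have i3 : LocallyIntegrable fun x => fderiv ℝ η x v * f x := LocallyIntegrable.continuous_mul h.locInt hd
  refine ⟨i1, i2.add i3, fun ψ hψ => ?_⟩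
  have e := h.integral_eq _ (hψ.mul_left hη)
  have hη' : Differentiable ℝ η := hη.differentiable (by simp)
  have e1 : ∀ x, f x * fderiv ℝ (fun x => η x * ψ x) x v
      = η x * f x * fderiv ℝ ψ x v + fderiv ℝ η x v * f x * ψ x := by
    intro x
    rw [fderiv_fun_mul (hη' x) (hψ.differentiable x)]
    simp
    ring
  simp only [e1] at e
  rw [integral_add ((hψ.fderiv_apply v).integrable_mul i1) (hψ.integrable_mul i3)] at e
  simp only [add_mul]
  rw [integral_add (hψ.integrable_mul i2) (hψ.integrable_mul i3)]
  have e2 : ∫ x, η x * f' x * ψ x = ∫ x, f' x * (η x * ψ x) :=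
    integral_congr_ae (Eventually.of_forall fun x => by ring)
  rw [e2]
  linarith

/-- Mollification commutes with the weak derivative. -/
lemma fderiv_mollify (h : WeakDeriv v f f') (n : ℕ) (x : Space N) :
    fderiv ℝ (mollify n f) x v = mollify n f' x := by
  set ρ := (mollifier N n).normed volume with hρ
  have hT : IsTest ρ := isTest_normed _
  have hd := hT.compact.hasFDerivAt_convolution_left (lsmul ℝ ℝ)
    (hT.smooth.of_le (by simp)) h.locInt x
  have hfd : fderiv ℝ (mollify n f) x = _ := hd.fderiv
  rw [hfd]
  have hex : ConvolutionExistsAt (fderiv ℝ ρ) f x ((lsmul ℝ ℝ).precompL (Space N)) volume :=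
    (hT.compact.fderiv ℝ).convolutionExists_left _ hT.continuous_fderiv h.locInt x
  -- The weak derivative is tested with t ↦ ρ(x - t); the sign from its inner derivative cancels the
  -- sign in the definition of `WeakDeriv`.
  have e := h.integral_eq _ (hT.comp_sub_left x)
  rw [mollify_apply, ← neg_eq_iff_eq_neg.2 e, ← integral_neg, convolution_eq_swap,
    ContinuousLinearMap.integral_apply]
  · refine integral_congr_ae (Eventually.of_forall fun t => ?_)
    have : fderiv ℝ (fun t => ρ (x - t)) t = -fderiv ℝ ρ (x - t) := by
      have hc := ((hT.differentiable (x - t)).hasFDerivAt).comp t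
        ((hasFDerivAt_id t).const_sub x)
      rw [show (fun t => ρ (x - t)) = ρ ∘ fun t => x - t from rfl]
      rw [HasFDerivAt.fderiv (f := ρ ∘ fun t => x - t) hc]
      ext w
      simp
    simp only [this]
    simp [precompL_apply]
    ring
  · exact hex.integrable_swap

end WeakDeriv

end ChoquardPoisson

/-! ### Limit passages and the chain rule for weak derivatives. -/

namespace ChoquardPoisson

open Filter Topology Metric Set Function ContinuousLinearMap

variable {N : ℕ}

lemma tendsto_integral_mul_test {F : ℕ → Space N → ℝ} {η : Space N → ℝ}
    (hη : Continuous η) (hc : HasCompactSupport η)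
    (hF : ∀ n, LocallyIntegrable (F n))
    (h : Tendsto (fun n => ∫ x in tsupport η, |F n x|) atTop (𝓝 0)) :
    Tendsto (fun n => ∫ x, F n x * η x) atTop (𝓝 0) := by
  obtain ⟨C, hC⟩ := hc.exists_bound_of_continuous hη
  refine squeeze_zero_norm (a := fun n => C * ∫ x in tsupport η, |F n x|) (fun n => ?_)
    (by simpa using h.const_mul C)
  have e : ∫ x, F n x * η x = ∫ x in tsupport η, F n x * η x := by
    refine (setIntegral_eq_integral_of_forall_compl_eq_zero fun x hx => ?_).symm
    rw [image_eq_zero_of_notMem_tsupport hx, mul_zero]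
  rw [e, ← integral_const_mul]
  refine norm_integral_le_of_norm_le
    (((hF n).integrableOn_isCompact hc.isCompact).abs.const_mul C)
    (Eventually.of_forall fun x => ?_)
  rw [norm_mul, mul_comm, Real.norm_eq_abs (F n x)]
  exact mul_le_mul_of_nonneg_right (hC x) (abs_nonneg _)

lemma abs_sub_le_of_deriv_bound {h h' : ℝ → ℝ} {L : ℝ} (hd : ∀ t, HasDerivAt h (h' t) t)
    (hL : ∀ t, |h' t| ≤ L) (s t : ℝ) : |h s - h t| ≤ L * |s - t| := by
  have := Convex.norm_image_sub_le_of_norm_hasDerivWithin_le (f := h) (f' := h') (s := Set.univ)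
    (C := L) (fun x _ => (hd x).hasDerivWithinAt) (fun x _ => hL x) convex_univ
    (mem_univ t) (mem_univ s)
  simpa using this

namespace WeakDeriv

variable {v : Space N} {f g f' g' : Space N → ℝ}

/-- The chain rule for a `C¹` function with bounded derivative. -/
lemma comp_of_bounded_deriv (hf : WeakDeriv v f f') {h h' : ℝ → ℝ} {L : ℝ}
    (hd : ∀ t, HasDerivAt h (h' t) t) (hc : Continuous h') (hL : ∀ t, |h' t| ≤ L) :
    WeakDeriv v (fun x => h (f x)) fun x => h' (f x) * f' x := by
  have hhc : Continuous h := continuous_iff_continuousAt.2 fun t => (hd t).continuousAt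
  have hmf : AEStronglyMeasurable f := hf.locInt.aestronglyMeasurable
  have i1 : LocallyIntegrable fun x => h (f x) := by
    rw [locallyIntegrable_iff]
    intro S hS
    have hi := hf.locInt.integrableOn_isCompact hS
    have hfin : volume S ≠ ⊤ := hS.measure_lt_top.ne
    refine Integrable.mono' (g := fun x => |h 0| + L * |f x|)
      ((integrableOn_const hfin).add (hi.abs.const_mul L))
      (hhc.comp_aestronglyMeasurable hmf).restrict (Eventually.of_forall fun x => ?_)
    have := abs_sub_le_of_deriv_bound hd hL (f x) 0
    rw [sub_zero] at this
    have h2 := abs_sub_abs_le_abs_sub (h (f x)) (h 0)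
    rw [Real.norm_eq_abs]
    linarith
  have i2 : LocallyIntegrable fun x => h' (f x) * f' x := by
    rw [locallyIntegrable_iff]
    intro S hS
    refine Integrable.mono' (g := fun x => L * |f' x|)
      ((hf.locInt_deriv.integrableOn_isCompact hS).abs.const_mul L)
      ((hc.comp_aestronglyMeasurable hmf).mul
        hf.locInt_deriv.aestronglyMeasurable).restrict (Eventually.of_forall fun x => ?_)
    rw [Real.norm_eq_abs, abs_mul]
    exact mul_le_mul_of_nonneg_right (hL _) (abs_nonneg _)
  refine ⟨i1, i2, fun ψ hψ => ?_⟩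
  -- For the mollified function the chain rule and integration by parts are classical; the identity
  -- is then passed to the limit.
  set fn : ℕ → Space N → ℝ := fun n => mollify n f with hfn
  set gn : ℕ → Space N → ℝ := fun n => mollify n f' with hgn
  have cfn : ∀ n, ContDiff ℝ ∞ (fn n) := fun n => contDiff_mollify n hf.locInt
  have cgn : ∀ n, ContDiff ℝ ∞ (gn n) := fun n => contDiff_mollify n hf.locInt_deriv
  have hfd : ∀ n x, HasFDerivAt (fun y => h (fn n y)) (h' (fn n x) • fderiv ℝ (fn n) x) x :=
    fun n x => (hd _).comp_hasFDerivAt x ((cfn n).differentiable (by simp) x).hasFDerivAt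
  have chn : ∀ n, Continuous fun x => h (fn n x) := fun n => hhc.comp (cfn n).continuous
  have chn' : ∀ n, Continuous fun x => h' (fn n x) := fun n => hc.comp (cfn n).continuous
  have hψv : IsTest fun x => fderiv ℝ ψ x v := hψ.fderiv_apply v
  have parts : ∀ n, ∫ x, h (fn n x) * fderiv ℝ ψ x v
      = -∫ x, h' (fn n x) * gn n x * ψ x := by
    intro n
    have e : ∀ x, fderiv ℝ (fun y => h (fn n y)) x v = h' (fn n x) * gn n x := by
      intro x
      rw [(hfd n x).fderiv]
      simp only [FunLike.coe_smul, Pi.smul_apply, smul_eq_mul]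
      rw [hfn, hgn]
      simp only
      rw [hf.fderiv_mollify n x]
    have := integral_mul_fderiv_eq_neg_fderiv_mul_of_integrable (μ := volume)
      (f := fun y => h (fn n y)) (g := ψ) (v := v)
      (by
        simp only [e]
        exact hψ.integrable_mul ((chn' n).mul (cgn n).continuous).locallyIntegrable)
      (hψv.integrable_mul (chn n).locallyIntegrable)
      (hψ.integrable_mul (chn n).locallyIntegrable)
      (fun x _ => (hfd n x).differentiableAt) (fun x _ => hψ.differentiable x)
    simpa only [e] using this
  have lim1 : Tendsto (fun n => ∫ x, h (fn n x) * fderiv ℝ ψ x v) atTop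
      (𝓝 (∫ x, h (f x) * fderiv ℝ ψ x v)) := by
    rw [← tendsto_sub_nhds_zero_iff]
    have e : ∀ n, (∫ x, h (fn n x) * fderiv ℝ ψ x v) - ∫ x, h (f x) * fderiv ℝ ψ x v
        = ∫ x, (h (fn n x) - h (f x)) * fderiv ℝ ψ x v := by
      intro n
      rw [← integral_sub (hψv.integrable_mul (chn n).locallyIntegrable) (hψv.integrable_mul i1)]
      simp [sub_mul]
    simp only [e]
    refine tendsto_integral_mul_test hψv.continuous hψv.compact
      (fun n => (chn n).locallyIntegrable.sub i1) ?_
    refine squeeze_zero (fun n => integral_nonneg fun _ => abs_nonneg _) (fun n => ?_)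
      (by simpa using (tendsto_setIntegral_mollify_sub hf.locInt hψv.compact.isCompact).const_mul L)
    rw [← integral_const_mul]
    refine integral_mono_of_nonneg (Eventually.of_forall fun _ => abs_nonneg _) ?_
      (Eventually.of_forall fun x => abs_sub_le_of_deriv_bound hd hL _ _)
    exact (((cfn n).continuous.locallyIntegrable.sub hf.locInt).integrableOn_isCompact
      hψv.compact.isCompact).abs.const_mul L
  have lim2 : Tendsto (fun n => ∫ x, h' (fn n x) * gn n x * ψ x) atTop
      (𝓝 (∫ x, h' (f x) * f' x * ψ x)) := by
    have a1 : ∀ n, LocallyIntegrable fun x => h' (fn n x) * (gn n x - f' x) := fun n =>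
      LocallyIntegrable.continuous_mul
        ((cgn n).continuous.locallyIntegrable.sub hf.locInt_deriv) (chn' n)
    have a2 : ∀ n, LocallyIntegrable fun x => h' (fn n x) * f' x := fun n =>
      LocallyIntegrable.continuous_mul hf.locInt_deriv (chn' n)
    -- The split separates two modes of convergence: `gn - f'` tends to zero in L¹_loc while `h'`
    -- stays bounded, and `h' (fn n x)` converges almost everywhere against the fixed integrable
    -- function `f' * ψ`.
    have e : ∀ n, ∫ x, h' (fn n x) * gn n x * ψ x
        = (∫ x, h' (fn n x) * (gn n x - f' x) * ψ x) + ∫ x, h' (fn n x) * f' x * ψ x := by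
      intro n
      rw [← integral_add (hψ.integrable_mul (a1 n)) (hψ.integrable_mul (a2 n))]
      refine integral_congr_ae (Eventually.of_forall fun x => ?_)
      simp only
      ring
    simp only [e]
    rw [← zero_add (∫ x, h' (f x) * f' x * ψ x)]
    refine Tendsto.add ?_ ?_
    · refine tendsto_integral_mul_test hψ.continuous hψ.compact a1 ?_
      refine squeeze_zero (fun n => integral_nonneg fun _ => abs_nonneg _) (fun n => ?_)
        (by simpa using
          (tendsto_setIntegral_mollify_sub hf.locInt_deriv hψ.compact.isCompact).const_mul L)
      rw [← integral_const_mul]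
      refine integral_mono_of_nonneg (Eventually.of_forall fun _ => abs_nonneg _) ?_
        (Eventually.of_forall fun x => ?_)
      · exact (((cgn n).continuous.locallyIntegrable.sub hf.locInt_deriv).integrableOn_isCompact
          hψ.compact.isCompact).abs.const_mul L
      · simp only [abs_mul]
        exact mul_le_mul_of_nonneg_right (hL _) (abs_nonneg _)
    · refine tendsto_integral_of_dominated_convergence (fun x => L * |f' x * ψ x|)
        (fun n => (hψ.integrable_mul (a2 n)).aestronglyMeasurable)
        ((hψ.integrable_mul hf.locInt_deriv).abs.const_mul L)
        (fun n => Eventually.of_forall fun x => ?_) ?_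
      · rw [mul_assoc, norm_mul]
        exact mul_le_mul_of_nonneg_right (hL _) (abs_nonneg _)
      · filter_upwards [ae_tendsto_mollify hf.locInt] with x hx
        exact (((hc.tendsto _).comp hx).mul_const _).mul_const _
  refine tendsto_nhds_unique lim1 ?_
  simp only [parts]
  exact lim2.neg

end WeakDeriv

/-! ### Smooth truncation -/

/-- The truncation `t ↦ (n + 1) arctan (t / (n + 1))`. -/
def trunc (n : ℕ) (t : ℝ) : ℝ := ((n : ℝ) + 1) * Real.arctan (t / ((n : ℝ) + 1))

/-- The derivative of `trunc n`. -/
def truncDeriv (n : ℕ) (t : ℝ) : ℝ := (1 + (t / ((n : ℝ) + 1)) ^ 2)⁻¹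

lemma hasDerivAt_trunc (n : ℕ) (t : ℝ) : HasDerivAt (trunc n) (truncDeriv n t) t := by
  have hn : ((n : ℝ) + 1) ≠ 0 := by positivity
  have h1 : HasDerivAt (fun t : ℝ => t / ((n : ℝ) + 1)) (1 / ((n : ℝ) + 1)) t :=
    (hasDerivAt_id t).div_const _
  have := ((Real.hasDerivAt_arctan' (t / ((n : ℝ) + 1))).comp t h1).const_mul ((n : ℝ) + 1)
  convert! this using 1
  unfold truncDeriv
  field_simp

lemma continuous_truncDeriv (n : ℕ) : Continuous (truncDeriv n) := by
  unfold truncDeriv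
  refine Continuous.inv₀ (by fun_prop) fun t => by positivity

lemma abs_truncDeriv_le (n : ℕ) (t : ℝ) : |truncDeriv n t| ≤ 1 := by
  unfold truncDeriv
  rw [abs_of_nonneg (by positivity)]
  exact inv_le_one_of_one_le₀ (by nlinarith [sq_nonneg (t / ((n : ℝ) + 1))])

lemma abs_trunc_le (n : ℕ) (t : ℝ) : |trunc n t| ≤ |t| := by
  have := abs_sub_le_of_deriv_bound (hasDerivAt_trunc n) (abs_truncDeriv_le n) t 0
  simpa [trunc] using this

lemma abs_trunc_le' (n : ℕ) (t : ℝ) : |trunc n t| ≤ ((n : ℝ) + 1) * (Real.pi / 2) := by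
  unfold trunc
  rw [abs_mul, abs_of_nonneg (by positivity : (0 : ℝ) ≤ (n : ℝ) + 1)]
  refine mul_le_mul_of_nonneg_left ?_ (by positivity)
  rw [abs_le]
  exact ⟨(Real.neg_pi_div_two_lt_arctan _).le, (Real.arctan_lt_pi_div_two _).le⟩

lemma tendsto_div_add_one (t : ℝ) : Tendsto (fun n : ℕ => t / ((n : ℝ) + 1)) atTop (𝓝 0) := by
  have h := (tendsto_one_div_add_atTop_nhds_zero_nat (𝕜 := ℝ)).const_mul t
  rw [mul_zero] at h
  exact h.congr fun n => by rw [mul_one_div]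

lemma tendsto_trunc (t : ℝ) : Tendsto (fun n => trunc n t) atTop (𝓝 t) := by
  -- The limit is the difference quotient of arctan at 0, where its derivative equals 1, along the
  -- step t/(n+1).
  have h := (Real.hasDerivAt_arctan' 0).hasFDerivAt.lim t (c := fun n : ℕ => (n : ℝ) + 1)
    (l := atTop) (by
      have : Tendsto (fun n : ℕ => (n : ℝ) + 1) atTop atTop :=
        tendsto_atTop_add_const_right _ _ tendsto_natCast_atTop_atTop
      exact tendsto_norm_atTop_atTop.comp this)
  simp only [Real.arctan_zero, sub_zero, zero_add, smul_eq_mul] at h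
  convert! h using 2
  · unfold trunc
    rw [div_eq_inv_mul]
  · simp

lemma tendsto_truncDeriv (t : ℝ) : Tendsto (fun n => truncDeriv n t) atTop (𝓝 1) := by
  have h := (((tendsto_div_add_one t).pow 2).const_add 1).inv₀ (by norm_num)
  simpa [truncDeriv] using h

namespace WeakDeriv

variable {v : Space N} {f g f' g' : Space N → ℝ}

/-- The chain rule for a `C¹` function `h` such that `|h|` and `|h'|` are monotone in `|t|`. -/
lemma comp_of_monotone (hf : WeakDeriv v f f') {h h' : ℝ → ℝ}
    (hd : ∀ t, HasDerivAt h (h' t) t) (hc : Continuous h')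
    (hm : ∀ s t, |s| ≤ |t| → |h s| ≤ |h t|) (hm' : ∀ s t, |s| ≤ |t| → |h' s| ≤ |h' t|)
    (i1 : LocallyIntegrable fun x => h (f x))
    (i2 : LocallyIntegrable fun x => h' (f x) * f' x) :
    WeakDeriv v (fun x => h (f x)) fun x => h' (f x) * f' x := by
  have hhc : Continuous h := continuous_iff_continuousAt.2 fun t => (hd t).continuousAt
  refine ⟨i1, i2, fun ψ hψ => ?_⟩
  have hψv : IsTest fun x => fderiv ℝ ψ x v := hψ.fderiv_apply v
  -- Since `trunc n` is bounded, the derivative of h composed with it is bounded and the previous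
  -- chain rule applies. As `trunc n` does not increase absolute values, monotonicity makes the
  -- limiting integrands themselves the dominating functions.
  have hW : ∀ n : ℕ, WeakDeriv v (fun x => h (trunc n (f x)))
      fun x => h' (trunc n (f x)) * truncDeriv n (f x) * f' x := by
    intro n
    refine hf.comp_of_bounded_deriv (h := fun t => h (trunc n t))
      (h' := fun t => h' (trunc n t) * truncDeriv n t)
      (L := |h' (((n : ℝ) + 1) * (Real.pi / 2))|)
      (fun t => (hd _).comp t (hasDerivAt_trunc n t)) ?_ fun t => ?_
    · have : Continuous (trunc n) :=
        continuous_iff_continuousAt.2 fun t => (hasDerivAt_trunc n t).continuousAt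
      exact (hc.comp this).mul (continuous_truncDeriv n)
    · rw [abs_mul]
      refine (mul_le_of_le_one_right (abs_nonneg _) (abs_truncDeriv_le n t)).trans (hm' _ _ ?_)
      exact (abs_trunc_le' n t).trans (le_abs_self _)
  have lim1 : Tendsto (fun n => ∫ x, h (trunc n (f x)) * fderiv ℝ ψ x v) atTop
      (𝓝 (∫ x, h (f x) * fderiv ℝ ψ x v)) := by
    refine tendsto_integral_of_dominated_convergence (fun x => |h (f x) * fderiv ℝ ψ x v|)
      (fun n => (hψv.integrable_mul (hW n).locInt).aestronglyMeasurable)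
      (hψv.integrable_mul i1).abs (fun n => Eventually.of_forall fun x => ?_)
      (Eventually.of_forall fun x => ?_)
    · rw [Real.norm_eq_abs, abs_mul, abs_mul]
      exact mul_le_mul_of_nonneg_right (hm _ _ (abs_trunc_le _ _)) (abs_nonneg _)
    · exact ((hhc.tendsto _).comp (tendsto_trunc _)).mul_const _
  have lim2 : Tendsto (fun n => ∫ x, h' (trunc n (f x)) * truncDeriv n (f x) * f' x * ψ x) atTop
      (𝓝 (∫ x, h' (f x) * f' x * ψ x)) := by
    refine tendsto_integral_of_dominated_convergence (fun x => |h' (f x) * f' x * ψ x|)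
      (fun n => (hψ.integrable_mul (hW n).locInt_deriv).aestronglyMeasurable)
      (hψ.integrable_mul i2).abs (fun n => Eventually.of_forall fun x => ?_)
      (Eventually.of_forall fun x => ?_)
    · rw [Real.norm_eq_abs]
      simp only [abs_mul]
      gcongr
      exact (mul_le_of_le_one_right (abs_nonneg _) (abs_truncDeriv_le n _)).trans
        (hm' _ _ (abs_trunc_le _ _))
    · have := ((hc.tendsto _).comp (tendsto_trunc (f x))).mul (tendsto_truncDeriv (f x))
      rw [mul_one] at this
      exact (this.mul_const _).mul_const _
  refine tendsto_nhds_unique lim1 ?_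
  simp only [fun n => (hW n).integral_eq ψ hψ]
  exact lim2.neg

/-- The weak derivative of `|f|^r`. -/
lemma abs_rpow (hf : WeakDeriv v f f') {r : ℝ} (hr : 1 < r)
    (i1 : LocallyIntegrable fun x => |f x| ^ r)
    (i2 : LocallyIntegrable fun x => r * |f x| ^ (r - 2) * f x * f' x) :
    WeakDeriv v (fun x => |f x| ^ r) fun x => r * |f x| ^ (r - 2) * f x * f' x := by
  have habs : ∀ t : ℝ, |r * |t| ^ (r - 2) * t| = r * |t| ^ (r - 1) := by
    intro t
    rw [abs_mul, abs_mul, abs_of_pos (by linarith : 0 < r),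
      abs_of_nonneg (Real.rpow_nonneg (abs_nonneg _) _)]
    rcases eq_or_ne t 0 with rfl | ht
    · simp [Real.zero_rpow (by linarith : r - 1 ≠ 0)]
    · rw [mul_assoc, ← Real.rpow_add_one (abs_ne_zero.2 ht)]
      congr 2
      ring
  refine hf.comp_of_monotone (h := fun t => |t| ^ r) (h' := fun t => r * |t| ^ (r - 2) * t)
    (fun t => hasDerivAt_abs_rpow t hr) ?_ ?_ ?_ i1 i2
  · have h0 : ∀ t : ℝ, r * |t| ^ (r - 2) * t = r * (|t| ^ (r - 2) * t) := fun t => by ring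
    rw [continuous_iff_continuousAt]
    intro t
    -- For r < 2 the factor |t|^(r-2) blows up at the origin; continuity there is read off from the
    -- modulus r|t|^(r-1) of the whole product.
    rcases eq_or_ne t 0 with rfl | ht
    · rw [ContinuousAt]
      rw [mul_zero]
      refine squeeze_zero_norm (a := fun t : ℝ => r * |t| ^ (r - 1)) (fun t => (habs t).le) ?_
      have : Continuous fun t : ℝ => r * |t| ^ (r - 1) :=
        continuous_const.mul (continuous_abs.rpow_const fun _ => Or.inr (by linarith))
      have h2 := this.tendsto 0
      simpa [Real.zero_rpow (by linarith : r - 1 ≠ 0)] using h2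
    · exact (continuousAt_const.mul (continuous_abs.continuousAt.rpow_const
        (Or.inl (abs_ne_zero.2 ht)))).mul continuousAt_id
  · intro s t hst
    simp only [abs_of_nonneg (Real.rpow_nonneg (abs_nonneg _) _)]
    exact Real.rpow_le_rpow (abs_nonneg _) hst (by linarith)
  · intro s t hst
    simp only [habs]
    exact mul_le_mul_of_nonneg_left (Real.rpow_le_rpow (abs_nonneg _) hst (by linarith))
      (by linarith)

end WeakDeriv

/-! ### Local square integrability and the product rule. -/

lemma MemLpLoc.locallyIntegrable_mul {f g : Space N → ℝ} (hf : MemLpLoc f 2) (hg : MemLpLoc g 2) :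
    LocallyIntegrable fun x => f x * g x := by
  rw [locallyIntegrable_iff]
  exact fun S hS => (hf S hS).integrable_mul (hg S hS)

lemma MemLpLoc.add {f g : Space N → ℝ} {r : ENNReal} (hf : MemLpLoc f r) (hg : MemLpLoc g r) :
    MemLpLoc (fun x => f x + g x) r := fun S hS => (hf S hS).add (hg S hS)

lemma MemLpLoc.sub {f g : Space N → ℝ} {r : ENNReal} (hf : MemLpLoc f r) (hg : MemLpLoc g r) :
    MemLpLoc (fun x => f x - g x) r := fun S hS => (hf S hS).sub (hg S hS)

namespace WeakDeriv

variable {v : Space N} {f g f' g' : Space N → ℝ}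

lemma sq (hf : WeakDeriv v f f') (h : MemLpLoc f 2) (h' : MemLpLoc f' 2) :
    WeakDeriv v (fun x => f x ^ 2) fun x => 2 * f x * f' x := by
  have i1 := h.locallyIntegrable_mul h
  have i2 := (h.locallyIntegrable_mul h').smul (2 : ℝ)
  refine hf.comp_of_monotone (h := fun t => t ^ 2) (h' := fun t => 2 * t)
    (fun t => by simpa using hasDerivAt_pow 2 t) (by fun_prop) ?_ ?_ ?_ ?_
  · intro s t hst
    simp only [abs_pow]
    gcongr
  · intro s t hst
    simp only [abs_mul]
    gcongr
  · simpa only [pow_two] using i1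
  · simp only [mul_assoc]
    exact i2

/-- The weak Leibniz rule for functions that are locally in `H¹`. -/
lemma mul (hf : WeakDeriv v f f') (hg : WeakDeriv v g g') (h1 : MemLpLoc f 2)
    (h2 : MemLpLoc f' 2) (h3 : MemLpLoc g 2) (h4 : MemLpLoc g' 2) :
    WeakDeriv v (fun x => f x * g x) fun x => f x * g' x + f' x * g x := by
  have a := (hf.add hg).sq (h1.add h3) (h2.add h4)
  have b := (hf.sub hg).sq (h1.sub h3) (h2.sub h4)
  -- Polarisation: fg = ((f+g)² - (f-g)²)/4.
  have := (a.sub b).const_mul (1 / 4)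
  convert! this using 2 <;> ring

end WeakDeriv

end ChoquardPoisson

namespace ChoquardPoisson

open Filter Topology Metric Set Function
open scoped Pointwise

variable {N : ℕ}

/-! ### Regularised Riesz kernels -/

/-- The kernel `(|z|² + ε²)^(-μ/2)`. -/
def kern (μ ε : ℝ) (z : Space N) : ℝ := (‖z‖ ^ 2 + ε ^ 2) ^ (-μ / 2)

lemma kern_nonneg (μ ε : ℝ) (z : Space N) : 0 ≤ kern μ ε z := by
  unfold kern; positivity

lemma kern_pos (μ : ℝ) {ε : ℝ} (hε : 0 < ε) (z : Space N) : 0 < kern μ ε z := by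
  unfold kern; positivity

lemma kern_neg (μ ε : ℝ) (z : Space N) : kern μ ε (-z) = kern μ ε z := by simp [kern]

lemma kern_sub_comm (μ ε : ℝ) (x y : Space N) : kern μ ε (x - y) = kern μ ε (y - x) := by
  rw [← kern_neg, neg_sub]

lemma kern_zero (μ : ℝ) (z : Space N) : kern μ 0 z = ‖z‖ ^ (-μ) := by
  unfold kern
  rw [zero_pow two_ne_zero, add_zero, ← Real.rpow_natCast, ← Real.rpow_mul (norm_nonneg _)]
  congr 1
  push_cast
  ring

lemma measurable_kern (μ ε : ℝ) : Measurable (kern μ ε : Space N → ℝ) := by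
  unfold kern
  exact ((measurable_norm.pow_const 2).add_const _).pow_const _

lemma kern_le_kern_zero {μ : ℝ} (hμ : 0 ≤ μ) (ε : ℝ) {z : Space N} (hz : z ≠ 0) :
    kern μ ε z ≤ kern μ 0 z := by
  unfold kern
  have : 0 < ‖z‖ := norm_pos_iff.2 hz
  refine Real.rpow_le_rpow_of_nonpos (by positivity) (by nlinarith [sq_nonneg ε]) (by linarith)

lemma weight_eq_kern (γ : ℝ) : (weight γ : Space N → ℝ) = kern γ 1 := by
  ext x
  simp [weight, kern, add_comm]

lemma kern_smul (μ : ℝ) {R : ℝ} (hR : 0 < R) (z : Space N) :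
    kern μ 0 (R • z) = R ^ (-μ) * kern μ 0 z := by
  rw [kern_zero, kern_zero, norm_smul, Real.norm_of_nonneg hR.le,
    Real.mul_rpow hR.le (norm_nonneg _)]

/-! ### The diagonal Hardy-Littlewood-Sobolev inequality -/

/-- Translation and homogeneity reduce everything to the unit ball, where |x|^(-μ) is integrable
because μ < N. -/
lemma lintegral_kern_ball (hN : 1 ≤ N) {μ : ℝ} (hμ : μ < N) :
    ∃ C : ENNReal, C ≠ ⊤ ∧ ∀ ρ : ℝ, 0 < ρ → ∀ y : Space N,
      ∫⁻ x in ball y ρ, ENNReal.ofReal (kern μ 0 (x - y)) ≤ C * ENNReal.ofReal (ρ ^ (N - μ)) := by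
  have hint : ∀ ρ : ℝ, IntegrableOn (kern μ 0 : Space N → ℝ) (ball 0 ρ) := by
    intro ρ
    refine integrableOn_ball_of_norm_le_rpow (C := 1) (α := μ) (by simpa using hN)
      (by simpa using hμ) (Eventually.of_forall fun x => ?_)
      (measurable_kern μ 0).aestronglyMeasurable
    rw [Real.norm_of_nonneg (kern_nonneg _ _ _), kern_zero, one_mul]
  refine ⟨ENNReal.ofReal (∫ x in ball (0 : Space N) 1, kern μ 0 x), ENNReal.ofReal_ne_top,
    fun ρ hρ y => ?_⟩
  have e1 : ∫⁻ x in ball y ρ, ENNReal.ofReal (kern μ 0 (x - y))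
      = ∫⁻ x in ball (0 : Space N) ρ, ENNReal.ofReal (kern μ 0 x) := by
    rw [← lintegral_indicator measurableSet_ball, ← lintegral_indicator measurableSet_ball,
      ← lintegral_sub_right_eq_self ((ball (0 : Space N) ρ).indicator _) y]
    refine lintegral_congr fun x => ?_
    simp only [indicator, mem_ball, dist_eq_norm, sub_zero]
  rw [e1, ← ofReal_integral_eq_lintegral_ofReal (hint ρ)
    (Eventually.of_forall fun x => kern_nonneg _ _ _),
    ← ENNReal.ofReal_mul (setIntegral_nonneg measurableSet_ball fun x _ => kern_nonneg _ _ _)]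
  refine le_of_eq (congrArg _ ?_)
  have h := Measure.setIntegral_comp_smul_of_pos volume (kern μ 0 : Space N → ℝ) (ball 0 1) hρ
  rw [smul_unitBall_of_pos hρ] at h
  simp only [kern_smul μ hρ, integral_const_mul, finrank_euclideanSpace, Fintype.card_fin,
    smul_eq_mul] at h
  have hpos : (0 : ℝ) < ρ ^ N := by positivity
  rw [inv_mul_eq_div, eq_div_iff hpos.ne'] at h
  rw [← h, sub_eq_neg_add, Real.rpow_add hρ, Real.rpow_natCast]
  ring

/-- The exponent 2N is the one that arises when |x|^(-μ) is raised to the Hölder exponent 2N/μ in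
`lintegral_min_mul_kern_le`. The bound follows by scaling, as on balls. -/
lemma lintegral_kern_compl_ball (hN : 1 ≤ N) :
    ∃ C : ENNReal, C ≠ ⊤ ∧ ∀ ρ : ℝ, 0 < ρ → ∀ y : Space N,
      ∫⁻ x in (ball y ρ)ᶜ, ENNReal.ofReal (kern (2 * N) 0 (x - y))
        ≤ C * ENNReal.ofReal (ρ ^ (-(N : ℝ))) := by
  have hN' : (1 : ℝ) ≤ N := by exact_mod_cast hN
  have hint : ∀ ρ : ℝ, 0 < ρ → IntegrableOn (kern (2 * N) 0 : Space N → ℝ) (ball 0 ρ)ᶜ := by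
    intro ρ hρ
    have hi : Integrable fun x : Space N =>
        ((1 + ρ) / ρ) ^ (2 * N : ℝ) * (1 + ‖x‖) ^ (-(2 * N : ℝ)) :=
      (integrable_one_add_norm (by simp; linarith)).const_mul _
    refine hi.integrableOn.mono' (measurable_kern _ 0).aestronglyMeasurable ?_
    refine (ae_restrict_iff' measurableSet_ball.compl).2 (Eventually.of_forall fun x hx => ?_)
    have hx1 : ρ ≤ ‖x‖ := by simpa using hx
    rw [Real.norm_of_nonneg (kern_nonneg _ _ _), kern_zero, Real.rpow_neg (norm_nonneg _),
      Real.rpow_neg (by positivity), ← div_eq_mul_inv, ← Real.div_rpow (by positivity)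
      (by positivity), ← Real.inv_rpow (norm_nonneg _)]
    refine Real.rpow_le_rpow (by positivity) ?_ (by positivity)
    have hx0 : 0 < ‖x‖ := hρ.trans_le hx1
    rw [inv_eq_one_div, div_div, div_le_div_iff₀ hx0 (by positivity)]
    nlinarith
  have hscale : ∀ ρ : ℝ, 0 < ρ → ρ • (ball (0 : Space N) 1)ᶜ = (ball (0 : Space N) ρ)ᶜ := by
    intro ρ hρ
    rw [← smul_unitBall_of_pos hρ]
    exact Set.smul_set_compl (a := Units.mk0 ρ hρ.ne')
  refine ⟨ENNReal.ofReal (∫ x in (ball (0 : Space N) 1)ᶜ, kern (2 * N) 0 x),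
    ENNReal.ofReal_ne_top, fun ρ hρ y => ?_⟩
  have e1 : ∫⁻ x in (ball y ρ)ᶜ, ENNReal.ofReal (kern (2 * N) 0 (x - y))
      = ∫⁻ x in (ball (0 : Space N) ρ)ᶜ, ENNReal.ofReal (kern (2 * N) 0 x) := by
    rw [← lintegral_indicator measurableSet_ball.compl,
      ← lintegral_indicator measurableSet_ball.compl,
      ← lintegral_sub_right_eq_self ((ball (0 : Space N) ρ)ᶜ.indicator _) y]
    refine lintegral_congr fun x => ?_
    simp only [indicator, mem_compl_iff, mem_ball, dist_eq_norm, sub_zero]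
  rw [e1, ← ofReal_integral_eq_lintegral_ofReal (hint ρ hρ)
    (Eventually.of_forall fun x => kern_nonneg _ _ _),
    ← ENNReal.ofReal_mul (setIntegral_nonneg measurableSet_ball.compl
      fun x _ => kern_nonneg _ _ _)]
  refine le_of_eq (congrArg _ ?_)
  have h := Measure.setIntegral_comp_smul_of_pos volume (kern (2 * N) 0 : Space N → ℝ)
    (ball 0 1)ᶜ hρ
  rw [hscale ρ hρ] at h
  simp only [kern_smul _ hρ, integral_const_mul, finrank_euclideanSpace, Fintype.card_fin,
    smul_eq_mul] at h
  have hpos : (0 : ℝ) < ρ ^ N := by positivity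
  rw [inv_mul_eq_div, eq_div_iff hpos.ne'] at h
  rw [← h, show (-(N : ℝ)) = -(2 * N) + N by ring, Real.rpow_add hρ, Real.rpow_natCast]
  ring

/-- Near y the truncated function is bounded by b and the kernel is integrated over a ball; far from
y Hölder's inequality uses the L^s norm of F. The radius is chosen to balance the two bounds. -/
lemma lintegral_min_mul_kern_le (hN : 1 ≤ N) {μ s : ℝ} (hμ₀ : 0 < μ) (hμ : μ < N)
    (hs : s = 2 * N / (2 * N - μ)) {F : Space N → ℝ} (hF : Measurable F) (hF0 : ∀ x, 0 ≤ F x)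
    (hFs : ∫⁻ x, ENNReal.ofReal (F x ^ s) ≠ ⊤) :
    ∃ C : ENNReal, C ≠ ⊤ ∧ ∀ b : ℝ, 0 < b → ∀ y : Space N,
      ∫⁻ x, ENNReal.ofReal (min (F x) b) * ENNReal.ofReal (kern μ 0 (x - y))
        ≤ C * ENNReal.ofReal (b ^ (s - 1)) := by
  obtain ⟨C₁, hC₁, h₁⟩ := lintegral_kern_ball hN hμ
  obtain ⟨C₂, hC₂, h₂⟩ := lintegral_kern_compl_ball hN
  have hN' : (1 : ℝ) ≤ N := by exact_mod_cast hN
  have hden : 0 < 2 * (N : ℝ) - μ := by linarith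
  have hs1 : s - 1 = μ / (2 * N - μ) := by rw [hs]; field_simp; ring
  have hs0 : 1 < s := by
    have : 0 < μ / (2 * N - μ) := by positivity
    linarith
  set t : ℝ := 2 * N / μ with ht
  have hconj : s.HolderConjugate t := by
    rw [Real.holderConjugate_iff]
    refine ⟨hs0, ?_⟩
    rw [hs, ht]
    field_simp
    ring
  set M := ∫⁻ x, ENNReal.ofReal (F x ^ s) with hM
  have hexp : (0 : ℝ) ≤ 1 / t := by rw [ht]; positivity
  refine ⟨C₁ + M ^ (1 / s) * C₂ ^ (1 / t), ?_, fun b hb y => ?_⟩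
  · refine ENNReal.add_ne_top.2 ⟨hC₁, ENNReal.mul_ne_top ?_ ?_⟩
    · exact ENNReal.rpow_ne_top_of_nonneg (by positivity) hFs
    · exact ENNReal.rpow_ne_top_of_nonneg hexp hC₂
  -- The near part is of size b ρ^(N-μ) and the far part of size ρ^(-μ/2); they agree for this ρ,
  -- with common value b^(s-1).
  set ρ : ℝ := b ^ (-2 / (2 * N - μ)) with hρ
  have hρ0 : 0 < ρ := by positivity
  have e1 : b * ρ ^ (N - μ) = b ^ (s - 1) := by
    rw [hρ, ← Real.rpow_mul hb.le, hs1]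
    nth_rewrite 1 [← Real.rpow_one b]
    rw [← Real.rpow_add hb]
    congr 1
    field_simp
    ring
  have e2 : (ρ ^ (-(N : ℝ))) ^ (1 / t) = b ^ (s - 1) := by
    rw [hρ, ← Real.rpow_mul hb.le, ← Real.rpow_mul hb.le, hs1, ht]
    congr 1
    field_simp
  have hmk : Measurable fun x : Space N => ENNReal.ofReal (kern μ 0 (x - y)) :=
    ((measurable_kern μ 0).comp (measurable_id.sub_const y)).ennreal_ofReal
  rw [← lintegral_add_compl _ (measurableSet_ball (x := y) (ε := ρ)), add_mul]
  refine add_le_add ?_ ?_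
  · calc ∫⁻ x in ball y ρ, ENNReal.ofReal (min (F x) b) * ENNReal.ofReal (kern μ 0 (x - y))
        ≤ ∫⁻ x in ball y ρ, ENNReal.ofReal b * ENNReal.ofReal (kern μ 0 (x - y)) := by
          refine lintegral_mono fun x => ?_
          gcongr
          exact min_le_right _ _
      _ = ENNReal.ofReal b * ∫⁻ x in ball y ρ, ENNReal.ofReal (kern μ 0 (x - y)) :=
          lintegral_const_mul _ hmk
      _ ≤ ENNReal.ofReal b * (C₁ * ENNReal.ofReal (ρ ^ (N - μ))) := by
          gcongr
          exact h₁ ρ hρ0 y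
      _ = C₁ * ENNReal.ofReal (b ^ (s - 1)) := by
          rw [← e1, ENNReal.ofReal_mul hb.le]
          ring
  · calc ∫⁻ x in (ball y ρ)ᶜ, ENNReal.ofReal (min (F x) b) * ENNReal.ofReal (kern μ 0 (x - y))
        ≤ (∫⁻ x in (ball y ρ)ᶜ, ENNReal.ofReal (min (F x) b) ^ s) ^ (1 / s)
          * (∫⁻ x in (ball y ρ)ᶜ, ENNReal.ofReal (kern μ 0 (x - y)) ^ t) ^ (1 / t) :=
          ENNReal.lintegral_mul_le_Lp_mul_Lq _ hconj
            ((hF.min measurable_const).ennreal_ofReal.aemeasurable) hmk.aemeasurable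
      _ ≤ M ^ (1 / s) * (C₂ * ENNReal.ofReal (ρ ^ (-(N : ℝ)))) ^ (1 / t) := by
          gcongr ?_ ^ (1 / s) * ?_ ^ (1 / t)
          · refine (setLIntegral_le_lintegral _ _).trans (lintegral_mono fun x => ?_)
            rw [ENNReal.ofReal_rpow_of_nonneg (le_min (hF0 x) hb.le) (by linarith)]
            exact ENNReal.ofReal_le_ofReal
              (Real.rpow_le_rpow (le_min (hF0 x) hb.le) (min_le_left _ _) (by linarith))
          · refine le_trans (le_of_eq (lintegral_congr fun x => ?_)) (h₂ ρ hρ0 y)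
            rw [ENNReal.ofReal_rpow_of_nonneg (kern_nonneg _ _ _) (by rw [ht]; positivity),
              kern_zero, kern_zero, ← Real.rpow_mul (norm_nonneg _)]
            congr 2
            rw [ht]
            field_simp
      _ = M ^ (1 / s) * C₂ ^ (1 / t) * ENNReal.ofReal (b ^ (s - 1)) := by
          rw [ENNReal.mul_rpow_of_nonneg _ _ hexp,
            ENNReal.ofReal_rpow_of_nonneg (by positivity) hexp, e2]
          ring

/-- The product F(x)F(y) is the minimum of the two values times their maximum, hence at most (F(x) +
F(y)) times the minimum. By symmetry it suffices to integrate F(y) min(F(x), F(y)) against the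
kernel. The inner integral is bounded by the previous lemma at height b = F(y), which leaves a
multiple of ∫F^s. -/
lemma lintegral_lintegral_kern_lt_top (hN : 1 ≤ N) {μ s : ℝ} (hμ₀ : 0 < μ) (hμ : μ < N)
    (hs : s = 2 * N / (2 * N - μ)) {F : Space N → ℝ} (hF : Measurable F) (hF0 : ∀ x, 0 ≤ F x)
    (hFs : ∫⁻ x, ENNReal.ofReal (F x ^ s) ≠ ⊤) :
    ∫⁻ y, ∫⁻ x, ENNReal.ofReal (kern μ 0 (x - y) * (F x * F y)) < ⊤ := by
  obtain ⟨C, hC, h⟩ := lintegral_min_mul_kern_le hN hμ₀ hμ hs hF hF0 hFs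
  have hN' : (1 : ℝ) ≤ N := by exact_mod_cast hN
  have hs1 : 0 < s - 1 := by
    have hden : 0 < 2 * (N : ℝ) - μ := by linarith
    have : s - 1 = μ / (2 * N - μ) := by rw [hs]; field_simp; ring
    rw [this]
    positivity
  set P : Space N → Space N → ENNReal := fun x y =>
    ENNReal.ofReal (F y) * (ENNReal.ofReal (min (F x) (F y)) * ENNReal.ofReal (kern μ 0 (x - y)))
    with hP
  have hPm : Measurable (uncurry P) := by
    have hk : Measurable fun z : Space N × Space N => kern μ 0 (z.1 - z.2) :=
      (measurable_kern μ 0).comp (measurable_fst.sub measurable_snd)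
    exact (hF.comp measurable_snd).ennreal_ofReal.mul
      (((hF.comp measurable_fst).min (hF.comp measurable_snd)).ennreal_ofReal.mul
        hk.ennreal_ofReal)
  have hPfin : ∫⁻ y, ∫⁻ x, P x y < ⊤ := by
    calc ∫⁻ y, ∫⁻ x, P x y ≤ ∫⁻ y, C * ENNReal.ofReal (F y ^ s) := by
          refine lintegral_mono fun y => ?_
          rcases (hF0 y).eq_or_lt with h0 | h0
          · simp [hP, ← h0]
          · simp only [hP]
            rw [lintegral_const_mul' _ _ ENNReal.ofReal_ne_top]
            calc _ ≤ ENNReal.ofReal (F y) * (C * ENNReal.ofReal (F y ^ (s - 1))) := by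
                  gcongr
                  exact h _ h0 y
              _ = C * ENNReal.ofReal (F y ^ s) := by
                  rw [mul_left_comm, ← ENNReal.ofReal_mul h0.le,
                    show F y ^ s = F y * F y ^ (s - 1) by
                      rw [← Real.rpow_one_add' h0.le (by linarith)]
                      congr 1
                      ring]
      _ = C * ∫⁻ y, ENNReal.ofReal (F y ^ s) := lintegral_const_mul' _ _ hC
      _ < ⊤ := ENNReal.mul_lt_top hC.lt_top hFs.lt_top
  have hle : ∀ x y, ENNReal.ofReal (kern μ 0 (x - y) * (F x * F y)) ≤ P x y + P y x := by
    intro x y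
    simp only [hP]
    rw [kern_sub_comm μ 0 y x, min_comm (F y) (F x), ← ENNReal.ofReal_mul
      (le_min (hF0 x) (hF0 y)), ← ENNReal.ofReal_mul (hF0 y), ← ENNReal.ofReal_mul (hF0 x),
      ← ENNReal.ofReal_add (by have := kern_nonneg μ 0 (x - y); have := hF0 x; have := hF0 y
                               positivity)
        (by have := kern_nonneg μ 0 (x - y); have := hF0 x; have := hF0 y; positivity)]
    refine ENNReal.ofReal_le_ofReal ?_
    have hk := kern_nonneg μ 0 (x - y)
    have : F x * F y ≤ F y * min (F x) (F y) + F x * min (F x) (F y) := by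
      rcases le_total (F x) (F y) with hxy | hxy
      · rw [min_eq_left hxy]; nlinarith [hF0 x, hF0 y]
      · rw [min_eq_right hxy]; nlinarith [hF0 x, hF0 y]
    calc _ ≤ kern μ 0 (x - y) * (F y * min (F x) (F y) + F x * min (F x) (F y)) :=
          mul_le_mul_of_nonneg_left this hk
      _ = _ := by ring
  calc ∫⁻ y, ∫⁻ x, ENNReal.ofReal (kern μ 0 (x - y) * (F x * F y))
      ≤ ∫⁻ y, ∫⁻ x, (P x y + P y x) := lintegral_mono fun y => lintegral_mono fun x => hle x y
    _ = (∫⁻ y, ∫⁻ x, P x y) + ∫⁻ y, ∫⁻ x, P y x := by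
        rw [← lintegral_add_left (Measurable.lintegral_prod_left hPm)]
        refine lintegral_congr fun y => lintegral_add_left ?_ _
        exact hPm.comp measurable_prodMk_right
    _ = (∫⁻ y, ∫⁻ x, P x y) + ∫⁻ y, ∫⁻ x, P x y := by
        congr 1
        exact lintegral_lintegral_swap hPm.aemeasurable
    _ < ⊤ := ENNReal.add_lt_top.2 ⟨hPfin, hPfin⟩

/-- The Hardy-Littlewood-Sobolev inequality with equal exponents, as an integrability statement. -/
theorem integrable_kern_mul (hN : 1 ≤ N) {μ s : ℝ} (hμ₀ : 0 < μ) (hμ : μ < N)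
    (hs : s = 2 * N / (2 * N - μ)) {f g : Space N → ℝ} (hf : MemLp f (ENNReal.ofReal s))
    (hg : MemLp g (ENNReal.ofReal s)) :
    Integrable (fun z : Space N × Space N => kern μ 0 (z.1 - z.2) * (f z.1 * g z.2))
      (volume.prod volume) := by
  have hN' : (1 : ℝ) ≤ N := by exact_mod_cast hN
  have hs0 : 0 < s := by
    have hden : 0 < 2 * (N : ℝ) - μ := by linarith
    rw [hs]; positivity
  set f₁ := hf.1.mk f
  set g₁ := hg.1.mk g
  have mf : Measurable f₁ := hf.1.stronglyMeasurable_mk.measurable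
  have mg : Measurable g₁ := hg.1.stronglyMeasurable_mk.measurable
  have ef : f =ᵐ[volume] f₁ := hf.1.ae_eq_mk
  have eg : g =ᵐ[volume] g₁ := hg.1.ae_eq_mk
  -- A common majorant of both functions reduces the bilinear form to a quadratic one.
  set F : Space N → ℝ := fun x => |f₁ x| + |g₁ x| with hFdef
  have hF : Measurable F := mf.abs.add mg.abs
  have hF0 : ∀ x, 0 ≤ F x := fun x => by positivity
  have hFp : MemLp F (ENNReal.ofReal s) :=
    ((memLp_congr_ae ef).1 hf).abs.add ((memLp_congr_ae eg).1 hg).abs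
  have hFs : ∫⁻ x, ENNReal.ofReal (F x ^ s) ≠ ⊤ := by
    have := hFp.integrable_norm_rpow (by simpa using hs0) ENNReal.ofReal_ne_top
    rw [ENNReal.toReal_ofReal hs0.le] at this
    have h2 := this.lintegral_lt_top.ne
    simpa only [Real.norm_of_nonneg (hF0 _)] using h2
  have key := lintegral_lintegral_kern_lt_top hN hμ₀ hμ hs hF hF0 hFs
  have hk : Measurable fun z : Space N × Space N => kern μ 0 (z.1 - z.2) :=
    (measurable_kern μ 0).comp (measurable_fst.sub measurable_snd)
  have hm : Measurable fun z : Space N × Space N => kern μ 0 (z.1 - z.2) * (F z.1 * F z.2) :=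
    hk.mul ((hF.comp measurable_fst).mul (hF.comp measurable_snd))
  have hI : Integrable (fun z : Space N × Space N => kern μ 0 (z.1 - z.2) * (F z.1 * F z.2))
      (volume.prod volume) := by
    refine ⟨hm.aestronglyMeasurable, ?_⟩
    rw [hasFiniteIntegral_iff_ofReal (Eventually.of_forall fun z =>
      mul_nonneg (kern_nonneg _ _ _) (mul_nonneg (hF0 _) (hF0 _))),
      lintegral_prod_symm _ hm.ennreal_ofReal.aemeasurable]
    exact key
  have hI2 : Integrable (fun z : Space N × Space N => kern μ 0 (z.1 - z.2) * (f₁ z.1 * g₁ z.2))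
      (volume.prod volume) := by
    refine hI.mono' (hk.mul ((mf.comp measurable_fst).mul
      (mg.comp measurable_snd))).aestronglyMeasurable (Eventually.of_forall fun z => ?_)
    rw [Real.norm_eq_abs, abs_mul, abs_mul, abs_of_nonneg (kern_nonneg _ _ _)]
    refine mul_le_mul_of_nonneg_left ?_ (kern_nonneg _ _ _)
    simp only [hFdef]
    gcongr
    · linarith [abs_nonneg (g₁ z.1)]
    · linarith [abs_nonneg (f₁ z.2)]
  refine hI2.congr ?_
  filter_upwards [Measure.quasiMeasurePreserving_fst.ae ef,
    Measure.quasiMeasurePreserving_snd.ae eg] with z h1 h2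
  rw [h1, h2]

end ChoquardPoisson

namespace ChoquardPoisson

open Filter Topology Metric Set Function

variable {N : ℕ}

/-! ### Calculus of the regularised kernels -/

lemma contDiff_kern (μ : ℝ) {ε : ℝ} (hε : 0 < ε) : ContDiff ℝ ∞ (kern μ ε : Space N → ℝ) := by
  unfold kern
  refine ContDiff.rpow_const_of_ne ((contDiff_norm_sq ℝ).add contDiff_const) fun z => ?_
  positivity

lemma fderiv_kern (μ : ℝ) {ε : ℝ} (hε : 0 < ε) (z v : Space N) :
    fderiv ℝ (kern μ ε) z v = -μ * kern (μ + 2) ε z * inner ℝ z v := by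
  have h1 : HasFDerivAt (fun z : Space N => ‖z‖ ^ 2 + ε ^ 2) ((2 : ℝ) • innerSL ℝ z) z := by
    simpa [two_smul] using (hasStrictFDerivAt_norm_sq z).hasFDerivAt.add_const (ε ^ 2)
  have h2 := h1.rpow_const (p := -μ / 2) (Or.inl (by positivity))
  have h3 : HasFDerivAt (kern μ ε) _ z := h2
  rw [h3.fderiv]
  unfold kern
  simp only [FunLike.coe_smul, Pi.smul_apply, innerSL_apply_apply, smul_eq_mul]
  rw [show -(μ + 2) / 2 = -μ / 2 - 1 by ring]
  ring

lemma kern_add_two_mul {μ ε : ℝ} {z : Space N} (h : 0 < ‖z‖ ^ 2 + ε ^ 2) :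
    kern (μ + 2) ε z * (‖z‖ ^ 2 + ε ^ 2) = kern μ ε z := by
  unfold kern
  rw [← Real.rpow_add_one h.ne']
  congr 1
  ring

lemma kern_add_two_mul_norm_sq_le {μ : ℝ} (ε : ℝ) {z : Space N} (hz : z ≠ 0) :
    kern (μ + 2) ε z * ‖z‖ ^ 2 ≤ kern μ ε z := by
  have : 0 < ‖z‖ := norm_pos_iff.2 hz
  rw [← kern_add_two_mul (μ := μ) (ε := ε) (z := z) (by positivity)]
  exact mul_le_mul_of_nonneg_left (by nlinarith [sq_nonneg ε]) (kern_nonneg _ _ _)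

/-- From ε‖z‖ ≤ ‖z‖² + ε². The factor ε⁻¹ is harmless: the bound serves only for integrability at
fixed ε, the uniform estimate being `abs_kernVar_le`. -/
lemma kern_add_two_mul_norm_le {μ ε : ℝ} (hε : 0 < ε) (z : Space N) :
    kern (μ + 2) ε z * ‖z‖ ≤ ε⁻¹ * kern μ ε z := by
  rw [← kern_add_two_mul (μ := μ) (ε := ε) (z := z) (by positivity), mul_left_comm]
  refine mul_le_mul_of_nonneg_left ?_ (kern_nonneg _ _ _)
  rw [inv_mul_eq_div, le_div_iff₀ hε]
  nlinarith [sq_nonneg (‖z‖ - ε), norm_nonneg z, mul_nonneg (norm_nonneg z) hε.le]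

lemma tendsto_kern {μ : ℝ} {z : Space N} (hz : z ≠ 0) {e : ℕ → ℝ} (he : Tendsto e atTop (𝓝 0)) :
    Tendsto (fun n => kern μ (e n) z) atTop (𝓝 (kern μ 0 z)) := by
  unfold kern
  have : 0 < ‖z‖ := norm_pos_iff.2 hz
  exact ((he.pow 2).const_add _).rpow_const (Or.inl (by positivity))

/-! ### The Euler vector field -/

/-- Integration by parts against the Euler field `x - y`. -/
lemma HasWeakGradient.integral_euler {F : Space N → ℝ} {Γ : Space N → Space N}
    (h : HasWeakGradient F Γ) {η : Space N → ℝ} (hη : IsTest η) (y : Space N) :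
    ∫ x, F x * (N * η x + fderiv ℝ η x (x - y)) = -∫ x, η x * inner ℝ (Γ x) (x - y) := by
  set b := EuclideanSpace.basisFun (Fin N) ℝ with hb
  have hcs : ∀ i, ContDiff ℝ ∞ fun x : Space N => (x - y) i := by
    intro i
    exact ((EuclideanSpace.proj (𝕜 := ℝ) i : Space N →L[ℝ] ℝ).contDiff).comp
      (contDiff_id.sub contDiff_const)
  -- The components of the field η(x)(x - y) serve as test functions, each in its own direction;
  -- summing them produces the divergence Nη + ∇η·(x - y).
  have hT : ∀ i, IsTest fun x : Space N => η x * (x - y) i := fun i => hη.mul_right (hcs i)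
  have hfd : ∀ i x, fderiv ℝ (fun x : Space N => η x * (x - y) i) x (b i)
      = η x + (x - y) i * fderiv ℝ η x (b i) := by
    intro i x
    have h1 : HasFDerivAt (fun x : Space N => (x - y) i)
        (EuclideanSpace.proj i : Space N →L[ℝ] ℝ) x :=
      ((EuclideanSpace.proj (𝕜 := ℝ) i).hasFDerivAt (x := x)).sub_const (y i)
    rw [HasFDerivAt.fderiv (f := fun x : Space N => η x * (x - y) i)
      ((hη.differentiable x).hasFDerivAt.mul h1)]
    simp [hb]
  have hsum : ∀ w : Space N, ∑ i, w i • b i = w := by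
    intro w
    simpa [hb] using b.sum_repr w
  have e := fun i => (h.weakDeriv (b i)).integral_eq _ (hT i)
  have eL : ∫ x, F x * (N * η x + fderiv ℝ η x (x - y))
      = ∑ i, ∫ x, F x * fderiv ℝ (fun x : Space N => η x * (x - y) i) x (b i) := by
    rw [← integral_finsetSum _ fun i _ => ((hT i).fderiv_apply (b i)).integrable_mul h.locInt]
    refine integral_congr_ae (Eventually.of_forall fun x => ?_)
    simp only [hfd]
    rw [← Finset.mul_sum, Finset.sum_add_distrib]
    congr 1
    nth_rewrite 1 [← hsum (x - y)]
    simp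
  have eR : ∫ x, η x * inner ℝ (Γ x) (x - y)
      = ∑ i, ∫ x, inner ℝ (Γ x) (b i) * (η x * (x - y) i) := by
    rw [← integral_finsetSum _ fun i _ =>
      (hT i).integrable_mul (LocallyIntegrable.inner_const h.locInt_grad _)]
    refine integral_congr_ae (Eventually.of_forall fun x => ?_)
    simp only
    nth_rewrite 1 [← hsum (x - y)]
    rw [inner_sum, Finset.mul_sum]
    refine Finset.sum_congr rfl fun i _ => ?_
    rw [inner_smul_right]
    ring
  rw [eL, eR, ← Finset.sum_neg_distrib]
  exact Finset.sum_congr rfl fun i _ => e i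

/-! ### Cutoff functions -/

/-- The cutoff `θ (x / (n + 1))`, where `θ` is a fixed bump function. -/
def cutoff (N n : ℕ) (x : Space N) : ℝ :=
  (⟨1, 2, one_pos, one_lt_two⟩ : ContDiffBump (0 : Space N)) (((n : ℝ) + 1)⁻¹ • x)

lemma isTest_cutoff (n : ℕ) : IsTest (cutoff N n) := by
  have hn : ((n : ℝ) + 1)⁻¹ ≠ 0 := by positivity
  refine ⟨(ContDiffBump.contDiff _).comp (contDiff_const_smul _), ?_⟩
  exact (ContDiffBump.hasCompactSupport _).comp_homeomorph (Homeomorph.smulOfNeZero _ hn)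

lemma cutoff_nonneg (n : ℕ) (x : Space N) : 0 ≤ cutoff N n x := ContDiffBump.nonneg _

lemma cutoff_le_one (n : ℕ) (x : Space N) : cutoff N n x ≤ 1 := ContDiffBump.le_one _

lemma eventually_cutoff_eq (x : Space N) :
    ∀ᶠ n in atTop, cutoff N n =ᶠ[𝓝 x] fun _ => 1 := by
  have h := tendsto_div_add_one (‖x‖ + 1)
  filter_upwards [h.eventually (gt_mem_nhds zero_lt_one)] with n hn
  filter_upwards [ball_mem_nhds x one_pos] with y hy
  refine ContDiffBump.one_of_mem_closedBall _ ?_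
  rw [mem_closedBall, dist_zero_right, norm_smul, Real.norm_of_nonneg (by positivity)]
  rw [mem_ball, dist_eq_norm] at hy
  have h2 : ‖y‖ ≤ ‖x‖ + 1 := by
    have := norm_le_norm_add_norm_sub x y
    linarith [norm_sub_rev x y]
  rw [inv_mul_eq_div]
  exact (div_le_div_of_nonneg_right h2 (by positivity)).trans hn.le

lemma eventually_cutoff_eq_one (x : Space N) : ∀ᶠ n in atTop, cutoff N n x = 1 := by
  filter_upwards [eventually_cutoff_eq x] with n hn using hn.self_of_nhds

lemma eventually_fderiv_cutoff (x : Space N) : ∀ᶠ n in atTop, fderiv ℝ (cutoff N n) x = 0 := by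
  filter_upwards [eventually_cutoff_eq x] with n hn
  rw [hn.fderiv_eq]
  simp

lemma tendsto_cutoff (x : Space N) : Tendsto (fun n => cutoff N n x) atTop (𝓝 1) :=
  tendsto_const_nhds.congr' ((eventually_cutoff_eq_one x).mono fun _ h => h.symm)

lemma tendsto_fderiv_cutoff (x v : Space N) :
    Tendsto (fun n => fderiv ℝ (cutoff N n) x v) atTop (𝓝 0) :=
  tendsto_const_nhds.congr' ((eventually_fderiv_cutoff x).mono fun _ h => by simp [h])

lemma IsTest.exists_lipschitz {θ : Space N → ℝ} (hθ : IsTest θ) :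
    ∃ L : ℝ, 0 ≤ L ∧ ∀ x y, ‖θ x • x - θ y • y‖ ≤ L * ‖x - y‖ := by
  have h1 : ContDiff ℝ ∞ fun x => θ x • x := hθ.smooth.smul contDiff_id
  have h2 : HasCompactSupport fun x => θ x • x := hθ.compact.smul_right
  obtain ⟨L, hL⟩ := ContDiff.lipschitzWith_of_hasCompactSupport h2 h1 (by simp)
  refine ⟨L, L.2, fun x y => ?_⟩
  simpa [dist_eq_norm] using hL.dist_le_mul x y

/-- With Φ(x) = θ(x)x, the cut-off field at scale R is RΦ(x/R), so its Lipschitz constant does not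
depend on R. -/
lemma exists_cutoff_lipschitz (N : ℕ) :
    ∃ L : ℝ, 0 ≤ L ∧ ∀ n (x y : Space N),
      ‖cutoff N n x • x - cutoff N n y • y‖ ≤ L * ‖x - y‖ := by
  set θ : ContDiffBump (0 : Space N) := ⟨1, 2, one_pos, one_lt_two⟩
  obtain ⟨L, hL0, hL⟩ := IsTest.exists_lipschitz (θ := θ) ⟨θ.contDiff, θ.hasCompactSupport⟩
  refine ⟨L, hL0, fun n x y => ?_⟩
  have hn : (0 : ℝ) < (n : ℝ) + 1 := by positivity
  have e : ∀ x : Space N, cutoff N n x • x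
      = ((n : ℝ) + 1) • (θ (((n : ℝ) + 1)⁻¹ • x) • ((n : ℝ) + 1)⁻¹ • x) := by
    intro x
    rw [smul_comm, smul_inv_smul₀ hn.ne']
    rfl
  rw [e, e, ← smul_sub, norm_smul, Real.norm_of_nonneg hn.le]
  calc _ ≤ ((n : ℝ) + 1) * (L * ‖((n : ℝ) + 1)⁻¹ • x - ((n : ℝ) + 1)⁻¹ • y‖) := by
        gcongr
        exact hL _ _
    _ = L * ‖x - y‖ := by
        rw [← smul_sub, norm_smul, Real.norm_of_nonneg (by positivity)]
        field_simp

/-- The gradient at scale R is R⁻¹∇θ(x/R); its product with |x| is a function of x/R alone, hence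
bounded uniformly in R. -/
lemma exists_fderiv_cutoff_bound (N : ℕ) :
    ∃ M : ℝ, 0 ≤ M ∧ ∀ n (x : Space N),
      ‖fderiv ℝ (cutoff N n) x‖ ≤ M ∧ ‖fderiv ℝ (cutoff N n) x‖ * ‖x‖ ≤ M := by
  set θ : ContDiffBump (0 : Space N) := ⟨1, 2, one_pos, one_lt_two⟩
  have hT : IsTest θ := ⟨θ.contDiff, θ.hasCompactSupport⟩
  have hd := hT.continuous_fderiv
  have hdc : HasCompactSupport (fderiv ℝ θ) := hT.compact.fderiv ℝ
  obtain ⟨M₁, hM₁⟩ := hdc.exists_bound_of_continuous hd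
  obtain ⟨M₂, hM₂⟩ := (hdc.smul_left (f := fun x : Space N => ‖x‖)).exists_bound_of_continuous
    (continuous_norm.smul hd)
  have hM1 : 0 ≤ M₁ := (norm_nonneg _).trans (hM₁ 0)
  have hM2 : 0 ≤ M₂ := (norm_nonneg _).trans (hM₂ 0)
  refine ⟨max M₁ M₂, le_max_of_le_left hM1, fun n x => ?_⟩
  have hn : (0 : ℝ) < ((n : ℝ) + 1)⁻¹ := by positivity
  have hn1 : ((n : ℝ) + 1)⁻¹ ≤ 1 := by
    exact inv_le_one_of_one_le₀ (by linarith [(n.cast_nonneg : (0 : ℝ) ≤ n)])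
  have e : fderiv ℝ (cutoff N n) x = ((n : ℝ) + 1)⁻¹ • fderiv ℝ θ (((n : ℝ) + 1)⁻¹ • x) := by
    change fderiv ℝ (fun x => θ (((n : ℝ) + 1)⁻¹ • x)) x = _
    exact fderiv_comp_smul _
  rw [e, norm_smul, Real.norm_of_nonneg hn.le]
  constructor
  · refine le_max_of_le_left ((mul_le_mul_of_nonneg_left (hM₁ _) hn.le).trans ?_)
    exact mul_le_of_le_one_left hM1 hn1
  · refine le_max_of_le_right ?_
    have := hM₂ (((n : ℝ) + 1)⁻¹ • x)
    rw [Pi.smul_apply', norm_smul, norm_norm, norm_smul, Real.norm_of_nonneg hn.le] at this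
    linarith

/-! ### The diagonal is a null set -/

lemma ae_fst_ne_snd (hN : 1 ≤ N) :
    ∀ᵐ z : Space N × Space N ∂(volume.prod volume), z.1 ≠ z.2 := by
  have : Nontrivial (Space N) := by
    apply Module.nontrivial_of_finrank_pos (R := ℝ)
    simp
    omega
  rw [ae_iff]
  have hm : MeasurableSet {z : Space N × Space N | ¬z.1 ≠ z.2} := by
    simp only [not_not]
    exact measurableSet_eq_fun measurable_fst measurable_snd
  rw [Measure.measure_prod_null hm]
  refine Eventually.of_forall fun x => ?_
  simp

end ChoquardPoisson

namespace ChoquardPoisson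

open Filter Topology Metric Set Function

variable {N : ℕ}

/-! ### The dilation identity for nonlocal energies -/

/-- The symmetrised first variation of the kernel under the vector field `θ(x) x`. -/
def kernVar (μ ε : ℝ) (θ : Space N → ℝ) (x y : Space N) : ℝ :=
  kern μ ε (x - y) * (N * θ x + fderiv ℝ θ x x + (N * θ y + fderiv ℝ θ y y))
    - μ * (kern (μ + 2) ε (x - y) * inner ℝ (x - y) (θ x • x - θ y • y))

/-- This is the gain from symmetrising: the inner product with the difference of the field is at
most L|x-y|², which restores the two powers lost by differentiating the kernel. The bound is uniform
in ε and, for fixed M and L, in θ. -/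
lemma abs_kernVar_le {μ : ℝ} (hμ : 0 < μ) (ε : ℝ) {θ : Space N → ℝ} {M L : ℝ}
    (hM : ∀ x, |θ x| ≤ M) (hM' : ∀ x, |fderiv ℝ θ x x| ≤ M) (hL0 : 0 ≤ L)
    (hL : ∀ x y, ‖θ x • x - θ y • y‖ ≤ L * ‖x - y‖) {x y : Space N} (h : x ≠ y) :
    |kernVar μ ε θ x y| ≤ (2 * (N + 1) * M + μ * L) * kern μ 0 (x - y) := by
  have hz : x - y ≠ 0 := sub_ne_zero.2 h
  have hk := kern_le_kern_zero hμ.le ε hz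
  have hk0 := kern_nonneg μ ε (x - y)
  have hM0 : 0 ≤ M := (abs_nonneg _).trans (hM x)
  have e1 : |N * θ x + fderiv ℝ θ x x + (N * θ y + fderiv ℝ θ y y)| ≤ 2 * (N + 1) * M := by
    have h1 : ∀ w, |N * θ w + fderiv ℝ θ w w| ≤ (N + 1) * M := fun w => by
      refine (abs_add_le _ _).trans ?_
      rw [abs_mul, Nat.abs_cast]
      nlinarith [hM w, hM' w, mul_le_mul_of_nonneg_left (hM w) (Nat.cast_nonneg (α := ℝ) N)]
    refine (abs_add_le _ _).trans ?_
    linarith [h1 x, h1 y]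
  have e2 : |kern (μ + 2) ε (x - y) * inner ℝ (x - y) (θ x • x - θ y • y)|
      ≤ L * kern μ ε (x - y) := by
    rw [abs_mul, abs_of_nonneg (kern_nonneg _ _ _)]
    calc _ ≤ kern (μ + 2) ε (x - y) * (‖x - y‖ * (L * ‖x - y‖)) := by
          refine mul_le_mul_of_nonneg_left ((abs_real_inner_le_norm _ _).trans ?_)
            (kern_nonneg _ _ _)
          exact mul_le_mul_of_nonneg_left (hL x y) (norm_nonneg _)
      _ = L * (kern (μ + 2) ε (x - y) * ‖x - y‖ ^ 2) := by ring
      _ ≤ _ := mul_le_mul_of_nonneg_left (kern_add_two_mul_norm_sq_le ε hz) hL0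
  unfold kernVar
  calc _ ≤ |kern μ ε (x - y) * (N * θ x + fderiv ℝ θ x x + (N * θ y + fderiv ℝ θ y y))|
        + |μ * (kern (μ + 2) ε (x - y) * inner ℝ (x - y) (θ x • x - θ y • y))| := abs_sub _ _
    _ ≤ kern μ ε (x - y) * (2 * (N + 1) * M) + μ * (L * kern μ ε (x - y)) := by
        rw [abs_mul, abs_mul, abs_of_nonneg hk0, abs_of_pos hμ]
        gcongr
    _ = (2 * (N + 1) * M + μ * L) * kern μ ε (x - y) := by ring
    _ ≤ _ := by gcongr

lemma tendsto_kernVar_eps {μ : ℝ} (θ : Space N → ℝ) {x y : Space N} (h : x ≠ y)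
    {e : ℕ → ℝ} (he : Tendsto e atTop (𝓝 0)) :
    Tendsto (fun n => kernVar μ (e n) θ x y) atTop (𝓝 (kernVar μ 0 θ x y)) := by
  have hz : x - y ≠ 0 := sub_ne_zero.2 h
  exact ((tendsto_kern hz he).mul_const _).sub (((tendsto_kern hz he).mul_const _).const_mul _)

/-- In the limit the field is x ↦ x. Its divergence, counted once in each variable, contributes 2N,
and homogeneity of the kernel contributes -μ. -/
lemma tendsto_kernVar_cutoff {μ : ℝ} {x y : Space N} (h : x ≠ y) :
    Tendsto (fun n => kernVar μ 0 (cutoff N n) x y) atTop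
      (𝓝 ((2 * N - μ) * kern μ 0 (x - y))) := by
  have hz : 0 < ‖x - y‖ := norm_pos_iff.2 (sub_ne_zero.2 h)
  refine tendsto_const_nhds.congr' ?_
  filter_upwards [eventually_cutoff_eq_one x, eventually_cutoff_eq_one y,
    eventually_fderiv_cutoff x, eventually_fderiv_cutoff y] with n h1 h2 h3 h4
  unfold kernVar
  rw [h1, h2, h3, h4, one_smul, one_smul, real_inner_self_eq_norm_sq]
  have := kern_add_two_mul (μ := μ) (ε := 0) (z := x - y) (by positivity)
  rw [zero_pow two_ne_zero, add_zero] at this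
  rw [this]
  simp
  ring

lemma measurable_kern_sub (μ ε : ℝ) :
    Measurable fun z : Space N × Space N => kern μ ε (z.1 - z.2) :=
  (measurable_kern μ ε).comp (measurable_fst.sub measurable_snd)

lemma IsTest.continuous_fderiv_self {θ : Space N → ℝ} (hθ : IsTest θ) :
    Continuous fun x => fderiv ℝ θ x x :=
  hθ.continuous_fderiv.clm_apply continuous_id

lemma IsTest.exists_bound_fderiv_self {θ : Space N → ℝ} (hθ : IsTest θ) :
    ∃ M : ℝ, 0 ≤ M ∧ (∀ x, |θ x| ≤ M) ∧ (∀ x, |fderiv ℝ θ x x| ≤ M) ∧ ∀ x, |θ x| * ‖x‖ ≤ M := by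
  obtain ⟨M₁, h₁, hM₁⟩ := hθ.exists_bound
  have hc : HasCompactSupport fun x => fderiv ℝ θ x x :=
    (hθ.compact.fderiv ℝ).mono fun x hx => by
      rw [mem_support] at hx ⊢
      intro h
      simp [h] at hx
  obtain ⟨M₂, hM₂⟩ := hc.exists_bound_of_continuous hθ.continuous_fderiv_self
  have hc3 : HasCompactSupport fun x => θ x * ‖x‖ := hθ.compact.mul_right
  obtain ⟨M₃, hM₃⟩ := hc3.exists_bound_of_continuous (hθ.continuous.mul continuous_norm)
  refine ⟨max M₁ (max M₂ M₃), le_max_of_le_left h₁, fun x => le_max_of_le_left (hM₁ x),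
    fun x => le_max_of_le_right (le_max_of_le_left (hM₂ x)),
    fun x => le_max_of_le_right (le_max_of_le_right ?_)⟩
  simpa using hM₃ x

lemma measurable_kernVar (μ ε : ℝ) {θ : Space N → ℝ} (hθ : IsTest θ) :
    Measurable fun z : Space N × Space N => kernVar μ ε θ z.1 z.2 := by
  unfold kernVar
  have h1 := hθ.continuous
  have h2 := hθ.continuous_fderiv_self
  refine ((measurable_kern_sub μ ε).mul ?_).sub (((measurable_kern_sub _ ε).mul ?_).const_mul _)
  · refine Continuous.measurable ?_
    exact ((continuous_const.mul (h1.comp continuous_fst)).add (h2.comp continuous_fst)).add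
      ((continuous_const.mul (h1.comp continuous_snd)).add (h2.comp continuous_snd))
  · refine Continuous.measurable ?_
    exact (continuous_fst.sub continuous_snd).inner
      (((h1.comp continuous_fst).smul continuous_fst).sub
        ((h1.comp continuous_snd).smul continuous_snd))

lemma fderiv_kern_sub_mul {μ ε : ℝ} (hε : 0 < ε) {θ : Space N → ℝ} (hθ : IsTest θ)
    (x y v : Space N) :
    fderiv ℝ (fun x => kern μ ε (x - y) * θ x) x v
      = kern μ ε (x - y) * fderiv ℝ θ x v
        - μ * kern (μ + 2) ε (x - y) * inner ℝ (x - y) v * θ x := by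
  have h0 : HasFDerivAt (kern μ ε) (fderiv ℝ (kern μ ε) (x - y)) (x - y) :=
    ((contDiff_kern μ hε).differentiable (by simp) _).hasFDerivAt
  have h1 : HasFDerivAt (fun x => kern μ ε (x - y)) (fderiv ℝ (kern μ ε) (x - y)) x := by
    exact h0.comp x ((hasFDerivAt_id x).sub_const y)
  rw [HasFDerivAt.fderiv (f := fun x => kern μ ε (x - y) * θ x)
    (h1.mul (hθ.differentiable x).hasFDerivAt)]
  simp only [FunLike.coe_add, Pi.add_apply, FunLike.coe_smul, Pi.smul_apply, smul_eq_mul,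
    fderiv_kern μ hε]
  ring

lemma isTest_kern_sub_mul (μ : ℝ) {ε : ℝ} (hε : 0 < ε) {θ : Space N → ℝ} (hθ : IsTest θ)
    (y : Space N) : IsTest fun x => kern μ ε (x - y) * θ x :=
  hθ.mul_left ((contDiff_kern μ hε).comp (contDiff_id.sub contDiff_const))

section Dilation

variable {μ : ℝ} {F : Space N → ℝ} {Γ : Space N → Space N} {θ : Space N → ℝ}

/-- The dilation identity for the regularised kernel. -/
lemma integral_kern_eps_dilation (hN : 1 ≤ N) (hμ : 0 < μ) (hF : HasWeakGradient F Γ)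
    (hFF : Integrable (fun z : Space N × Space N => kern μ 0 (z.1 - z.2) * (F z.1 * F z.2))
      (volume.prod volume))
    (hθ : IsTest θ)
    (hΓ : Integrable (fun z : Space N × Space N =>
      kern μ 0 (z.1 - z.2) * (F z.2 * (θ z.1 * inner ℝ (Γ z.1) z.1))) (volume.prod volume))
    {ε : ℝ} (hε : 0 < ε) :
    2 * ∫ z : Space N × Space N,
        kern μ ε (z.1 - z.2) * (F z.2 * (θ z.1 * inner ℝ (Γ z.1) z.1)) ∂(volume.prod volume)
      = -∫ z : Space N × Space N, F z.1 * F z.2 * kernVar μ ε θ z.1 z.2 ∂(volume.prod volume) := by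
  obtain ⟨M, hM0, hM1, hM2, hM3⟩ := hθ.exists_bound_fderiv_self
  have mF : AEStronglyMeasurable F := hF.locInt.aestronglyMeasurable
  have mG : AEStronglyMeasurable Γ := hF.locInt_grad.aestronglyMeasurable
  have mFF : AEStronglyMeasurable (fun z : Space N × Space N => F z.1 * F z.2)
      (volume.prod volume) := mF.comp_fst.mul mF.comp_snd
  have hL : Integrable (fun z : Space N × Space N =>
      kern μ ε (z.1 - z.2) * (F z.2 * (θ z.1 * inner ℝ (Γ z.1) z.1))) (volume.prod volume) := by
    refine hΓ.mono ((measurable_kern_sub μ ε).aestronglyMeasurable.mul (mF.comp_snd.mul ?_)) ?_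
    · exact (hθ.continuous.aestronglyMeasurable.mul
        (mG.inner continuous_id.aestronglyMeasurable)).comp_fst
    · filter_upwards [ae_fst_ne_snd hN] with z hz
      rw [norm_mul, norm_mul (kern μ 0 _), Real.norm_of_nonneg (kern_nonneg _ _ _),
        Real.norm_of_nonneg (kern_nonneg _ _ _)]
      exact mul_le_mul_of_nonneg_right (kern_le_kern_zero hμ.le ε (sub_ne_zero.2 hz))
        (norm_nonneg _)
  -- The integrand before symmetrisation, obtained by integrating by parts in the first variable
  -- only.
  set J : Space N × Space N → ℝ := fun z => F z.1 * F z.2 *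
    (kern μ ε (z.1 - z.2) * (N * θ z.1 + fderiv ℝ θ z.1 z.1)
      - μ * kern (μ + 2) ε (z.1 - z.2) * inner ℝ (z.1 - z.2) z.1 * θ z.1) with hJ
  have hJi : Integrable J (volume.prod volume) := by
    refine Integrable.mono' (hFF.abs.const_mul ((N + 1) * M + μ * (ε⁻¹ * M)))
      (mFF.mul (Measurable.aestronglyMeasurable ?_)) ?_
    · refine ((measurable_kern_sub μ ε).mul (Continuous.measurable ?_)).sub
        ((((measurable_kern_sub _ ε).const_mul _).mul (Continuous.measurable ?_)).mul
          (Continuous.measurable ?_))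
      · exact (continuous_const.mul (hθ.continuous.comp continuous_fst)).add
          (hθ.continuous_fderiv_self.comp continuous_fst)
      · exact (continuous_fst.sub continuous_snd).inner continuous_fst
      · exact hθ.continuous.comp continuous_fst
    · filter_upwards [ae_fst_ne_snd hN] with z hz
      have hk := kern_le_kern_zero hμ.le ε (sub_ne_zero.2 hz)
      have hk0 := kern_nonneg μ ε (z.1 - z.2)
      have b1 : |kern μ ε (z.1 - z.2) * (N * θ z.1 + fderiv ℝ θ z.1 z.1)|
          ≤ kern μ ε (z.1 - z.2) * ((N + 1) * M) := by
        rw [abs_mul, abs_of_nonneg hk0]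
        refine mul_le_mul_of_nonneg_left ((abs_add_le _ _).trans ?_) hk0
        rw [abs_mul, Nat.abs_cast]
        nlinarith [hM2 z.1, mul_le_mul_of_nonneg_left (hM1 z.1) (Nat.cast_nonneg (α := ℝ) N)]
      have b2 : |μ * kern (μ + 2) ε (z.1 - z.2) * inner ℝ (z.1 - z.2) z.1 * θ z.1|
          ≤ μ * (ε⁻¹ * M) * kern μ ε (z.1 - z.2) := by
        rw [abs_mul, abs_mul, abs_mul, abs_of_pos hμ, abs_of_nonneg (kern_nonneg _ _ _)]
        calc _ ≤ μ * kern (μ + 2) ε (z.1 - z.2) * (‖z.1 - z.2‖ * ‖z.1‖) * |θ z.1| := by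
              have := kern_nonneg (μ + 2) ε (z.1 - z.2)
              gcongr
              exact abs_real_inner_le_norm _ _
          _ = μ * (kern (μ + 2) ε (z.1 - z.2) * ‖z.1 - z.2‖) * (|θ z.1| * ‖z.1‖) := by ring
          _ ≤ μ * (ε⁻¹ * kern μ ε (z.1 - z.2)) * M := by
              have h1 := mul_le_mul_of_nonneg_left
                (kern_add_two_mul_norm_le (μ := μ) hε (z.1 - z.2)) hμ.le
              have h2 : 0 ≤ ε⁻¹ := by positivity
              exact mul_le_mul h1 (hM3 _) (by positivity) (by positivity)
          _ = _ := by ring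
      simp only [hJ]
      rw [Real.norm_eq_abs, abs_mul, abs_mul (kern μ 0 _),
        abs_of_nonneg (kern_nonneg μ 0 _)]
      calc _ ≤ |F z.1 * F z.2| * (((N + 1) * M + μ * (ε⁻¹ * M)) * kern μ ε (z.1 - z.2)) := by
            refine mul_le_mul_of_nonneg_left ((abs_sub _ _).trans ?_) (abs_nonneg _)
            linarith
        _ ≤ |F z.1 * F z.2| * (((N + 1) * M + μ * (ε⁻¹ * M)) * kern μ 0 (z.1 - z.2)) := by
            gcongr
        _ = _ := by ring
  have key : ∫ z : Space N × Space N,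
      kern μ ε (z.1 - z.2) * (F z.2 * (θ z.1 * inner ℝ (Γ z.1) z.1)) ∂(volume.prod volume)
      = -∫ z, J z ∂(volume.prod volume) := by
    rw [integral_prod_symm _ hL, integral_prod_symm _ hJi, ← integral_neg]
    refine integral_congr_ae (Eventually.of_forall fun y => ?_)
    -- For frozen y the product of kernel and cutoff is a genuine test function, because ε > 0; the
    -- base point of the Euler field is the origin.
    have e := hF.integral_euler (isTest_kern_sub_mul μ hε hθ y) 0
    simp only [sub_zero, fderiv_kern_sub_mul hε hθ] at e
    simp only [hJ]
    have e1 : ∫ x, kern μ ε (x - y) * (F y * (θ x * inner ℝ (Γ x) x))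
        = F y * ∫ x, kern μ ε (x - y) * θ x * inner ℝ (Γ x) x := by
      rw [← integral_const_mul]
      exact integral_congr_ae (Eventually.of_forall fun x => by ring)
    rw [e1, ← neg_eq_iff_eq_neg.2 e, ← integral_neg, ← integral_const_mul, ← integral_neg]
    refine integral_congr_ae (Eventually.of_forall fun x => ?_)
    simp only
    ring
  -- Adding `J` to its reflection across the diagonal yields `kernVar`, because x - y changes sign
  -- under the reflection.
  have hsw : ∫ z, J z ∂(volume.prod volume) = ∫ z : Space N × Space N, J z.swap
      ∂(volume.prod volume) := (integral_prod_swap J).symm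
  have hsum : ∫ z : Space N × Space N, F z.1 * F z.2 * kernVar μ ε θ z.1 z.2 ∂(volume.prod volume)
      = 2 * ∫ z, J z ∂(volume.prod volume) := by
    rw [two_mul]
    nth_rewrite 2 [hsw]
    have hJs : Integrable (fun z : Space N × Space N => J z.swap) (volume.prod volume) := hJi.swap
    rw [← integral_add hJi hJs]
    refine integral_congr_ae (Eventually.of_forall fun z => ?_)
    simp only [hJ, kernVar, Prod.fst_swap, Prod.snd_swap]
    rw [kern_sub_comm μ ε z.2 z.1, kern_sub_comm (μ + 2) ε z.2 z.1, inner_sub_right,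
      inner_smul_right, inner_smul_right, ← neg_sub z.1 z.2, inner_neg_left]
    ring
  rw [key, hsum]
  ring

/-- The dilation identity for the Riesz kernel. -/
lemma integral_kern_dilation (hN : 1 ≤ N) (hμ : 0 < μ) (hF : HasWeakGradient F Γ)
    (hFF : Integrable (fun z : Space N × Space N => kern μ 0 (z.1 - z.2) * (F z.1 * F z.2))
      (volume.prod volume))
    (hθ : IsTest θ)
    (hΓ : Integrable (fun z : Space N × Space N =>
      kern μ 0 (z.1 - z.2) * (F z.2 * (θ z.1 * inner ℝ (Γ z.1) z.1))) (volume.prod volume)) :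
    2 * ∫ z : Space N × Space N,
        kern μ 0 (z.1 - z.2) * (F z.2 * (θ z.1 * inner ℝ (Γ z.1) z.1)) ∂(volume.prod volume)
      = -∫ z : Space N × Space N, F z.1 * F z.2 * kernVar μ 0 θ z.1 z.2 ∂(volume.prod volume) := by
  obtain ⟨M, hM0, hM1, hM2, hM3⟩ := hθ.exists_bound_fderiv_self
  obtain ⟨L, hL0, hL⟩ := hθ.exists_lipschitz
  have mF : AEStronglyMeasurable F := hF.locInt.aestronglyMeasurable
  have mG : AEStronglyMeasurable Γ := hF.locInt_grad.aestronglyMeasurable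
  have mFF : AEStronglyMeasurable (fun z : Space N × Space N => F z.1 * F z.2)
      (volume.prod volume) := mF.comp_fst.mul mF.comp_snd
  have he : Tendsto (fun n : ℕ => 1 / ((n : ℝ) + 1)) atTop (𝓝 0) :=
    tendsto_one_div_add_atTop_nhds_zero_nat
  have lim1 : Tendsto (fun n : ℕ => ∫ z : Space N × Space N,
      kern μ (1 / ((n : ℝ) + 1)) (z.1 - z.2) * (F z.2 * (θ z.1 * inner ℝ (Γ z.1) z.1))
        ∂(volume.prod volume)) atTop (𝓝 (∫ z : Space N × Space N,
      kern μ 0 (z.1 - z.2) * (F z.2 * (θ z.1 * inner ℝ (Γ z.1) z.1)) ∂(volume.prod volume))) := by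
    refine tendsto_integral_of_dominated_convergence _ (fun n => ?_) hΓ.norm (fun n => ?_) ?_
    · refine (measurable_kern_sub μ _).aestronglyMeasurable.mul (mF.comp_snd.mul ?_)
      exact (hθ.continuous.aestronglyMeasurable.mul
        (mG.inner continuous_id.aestronglyMeasurable)).comp_fst
    · filter_upwards [ae_fst_ne_snd hN] with z hz
      rw [norm_mul, norm_mul (kern μ 0 _), Real.norm_of_nonneg (kern_nonneg _ _ _),
        Real.norm_of_nonneg (kern_nonneg _ _ _)]
      exact mul_le_mul_of_nonneg_right (kern_le_kern_zero hμ.le _ (sub_ne_zero.2 hz))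
        (norm_nonneg _)
    · filter_upwards [ae_fst_ne_snd hN] with z hz
      exact (tendsto_kern (sub_ne_zero.2 hz) he).mul_const _
  have lim2 : Tendsto (fun n : ℕ => ∫ z : Space N × Space N,
      F z.1 * F z.2 * kernVar μ (1 / ((n : ℝ) + 1)) θ z.1 z.2 ∂(volume.prod volume)) atTop
      (𝓝 (∫ z : Space N × Space N,
        F z.1 * F z.2 * kernVar μ 0 θ z.1 z.2 ∂(volume.prod volume))) := by
    refine tendsto_integral_of_dominated_convergence _ (fun n => ?_)
      (hFF.norm.const_mul (2 * (N + 1) * M + μ * L)) (fun n => ?_) ?_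
    · exact mFF.mul (measurable_kernVar μ _ hθ).aestronglyMeasurable
    · filter_upwards [ae_fst_ne_snd hN] with z hz
      have := abs_kernVar_le hμ (1 / ((n : ℝ) + 1)) hM1 hM2 hL0 hL hz
      rw [norm_mul, norm_mul (kern μ 0 _), Real.norm_of_nonneg (kern_nonneg μ 0 _), ← mul_assoc,
        mul_comm]
      exact mul_le_mul_of_nonneg_right this (norm_nonneg _)
    · filter_upwards [ae_fst_ne_snd hN] with z hz
      exact (tendsto_kernVar_eps θ hz he).const_mul _
  refine tendsto_nhds_unique (lim1.const_mul 2) ?_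
  have := fun n : ℕ => integral_kern_eps_dilation hN hμ hF hFF hθ hΓ
    (ε := 1 / ((n : ℝ) + 1)) (by positivity)
  simp only [this]
  exact lim2.neg

/-- The Pohozaev identity for nonlocal energies. -/
theorem tendsto_integral_kern_dilation (hN : 1 ≤ N) (hμ : 0 < μ) (hF : HasWeakGradient F Γ)
    (hFF : Integrable (fun z : Space N × Space N => kern μ 0 (z.1 - z.2) * (F z.1 * F z.2))
      (volume.prod volume))
    (hΓ : ∀ n, Integrable (fun z : Space N × Space N =>
      kern μ 0 (z.1 - z.2) * (F z.2 * (cutoff N n z.1 * inner ℝ (Γ z.1) z.1)))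
      (volume.prod volume)) :
    Tendsto (fun n => ∫ z : Space N × Space N,
        kern μ 0 (z.1 - z.2) * (F z.2 * (cutoff N n z.1 * inner ℝ (Γ z.1) z.1))
          ∂(volume.prod volume)) atTop
      (𝓝 (-(N - μ / 2) * ∫ z : Space N × Space N, kern μ 0 (z.1 - z.2) * (F z.1 * F z.2)
        ∂(volume.prod volume))) := by
  obtain ⟨M, hM0, hM⟩ := exists_fderiv_cutoff_bound N
  obtain ⟨L, hL0, hL⟩ := exists_cutoff_lipschitz N
  have mF : AEStronglyMeasurable F := hF.locInt.aestronglyMeasurable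
  have mFF : AEStronglyMeasurable (fun z : Space N × Space N => F z.1 * F z.2)
      (volume.prod volume) := mF.comp_fst.mul mF.comp_snd
  have lim : Tendsto (fun n : ℕ => ∫ z : Space N × Space N,
      F z.1 * F z.2 * kernVar μ 0 (cutoff N n) z.1 z.2 ∂(volume.prod volume)) atTop
      (𝓝 (∫ z : Space N × Space N, F z.1 * F z.2 * ((2 * N - μ) * kern μ 0 (z.1 - z.2))
        ∂(volume.prod volume))) := by
    refine tendsto_integral_of_dominated_convergence _ (fun n => ?_)
      (hFF.norm.const_mul (2 * (N + 1) * max 1 M + μ * L)) (fun n => ?_) ?_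
    · exact mFF.mul (measurable_kernVar μ _ (isTest_cutoff n)).aestronglyMeasurable
    · filter_upwards [ae_fst_ne_snd hN] with z hz
      have := abs_kernVar_le hμ 0 (θ := cutoff N n) (M := max 1 M)
        (fun x => by
          rw [abs_of_nonneg (cutoff_nonneg n x)]
          exact le_max_of_le_left (cutoff_le_one n x))
        (fun x => le_max_of_le_right (((fderiv ℝ (cutoff N n) x).le_opNorm x).trans (hM n x).2))
        hL0 (hL n) hz
      rw [norm_mul, norm_mul (kern μ 0 _), Real.norm_of_nonneg (kern_nonneg μ 0 _), ← mul_assoc,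
        mul_comm]
      exact mul_le_mul_of_nonneg_right this (norm_nonneg _)
    · filter_upwards [ae_fst_ne_snd hN] with z hz
      exact (tendsto_kernVar_cutoff hz).const_mul _
  have e : ∀ n, ∫ z : Space N × Space N,
      kern μ 0 (z.1 - z.2) * (F z.2 * (cutoff N n z.1 * inner ℝ (Γ z.1) z.1))
        ∂(volume.prod volume)
      = -(1 / 2) * ∫ z : Space N × Space N,
        F z.1 * F z.2 * kernVar μ 0 (cutoff N n) z.1 z.2 ∂(volume.prod volume) := by
    intro n
    have := integral_kern_dilation hN hμ hF hFF (isTest_cutoff n) (hΓ n)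
    linarith
  simp only [e]
  have e2 : ∫ z : Space N × Space N, F z.1 * F z.2 * ((2 * N - μ) * kern μ 0 (z.1 - z.2))
        ∂(volume.prod volume) = (2 * N - μ) * ∫ z : Space N × Space N,
          kern μ 0 (z.1 - z.2) * (F z.1 * F z.2) ∂(volume.prod volume) := by
    rw [← integral_const_mul]
    exact integral_congr_ae (Eventually.of_forall fun z => by ring)
  rw [e2] at lim
  convert! lim.const_mul (-(1 / 2)) using 2
  ring

end Dilation

end ChoquardPoisson

namespace ChoquardPoisson

open Filter Topology Metric Set Function

variable {N : ℕ}

/-! ### Decay of the regularised kernels -/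

lemma kern_mul_kern (μ ν : ℝ) {ε : ℝ} (hε : 0 < ε) (z : Space N) :
    kern μ ε z * kern ν ε z = kern (μ + ν) ε z := by
  unfold kern
  rw [← Real.rpow_add (by positivity)]
  congr 1
  ring

lemma integrable_kern_one {ν : ℝ} (h : (N : ℝ) < ν) : Integrable (kern ν 1 : Space N → ℝ) := by
  have := integrable_rpow_neg_one_add_norm_sq (E := Space N) (μ := volume) (r := ν) (by simpa using h)
  refine this.congr (Eventually.of_forall fun x => ?_)
  simp [kern, add_comm]

lemma memLp_kern_one {ν t : ℝ} (ht : 0 < t) (h : (N : ℝ) < ν * t) :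
    MemLp (kern ν 1 : Space N → ℝ) (ENNReal.ofReal t) := by
  rw [← integrable_norm_rpow_iff (measurable_kern ν 1).aestronglyMeasurable (by simpa using ht)
    ENNReal.ofReal_ne_top, ENNReal.toReal_ofReal ht.le]
  refine (integrable_kern_one h).congr (Eventually.of_forall fun x => ?_)
  simp only [Real.norm_of_nonneg (kern_nonneg _ _ _)]
  unfold kern
  rw [← Real.rpow_mul (by positivity)]
  congr 1
  ring

lemma memLp_two_kern_one {ν : ℝ} (h : (N : ℝ) < 2 * ν) : MemLp (kern ν 1 : Space N → ℝ) 2 := by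
  have := memLp_kern_one (N := N) (ν := ν) (t := 2) two_pos (by linarith)
  simpa using this

lemma kern_le_of_le {ν ε D : ℝ} (hν : 0 ≤ ν) (hD : 0 < D) {z x : Space N}
    (h : 1 + ‖x‖ ^ 2 ≤ D * (‖z‖ ^ 2 + ε ^ 2)) : kern ν ε z ≤ D ^ (ν / 2) * kern ν 1 x := by
  have h1 : 0 < 1 + ‖x‖ ^ 2 := by positivity
  have h0 : 0 < ‖z‖ ^ 2 + ε ^ 2 := by
    by_contra hc
    nlinarith
  unfold kern
  have e : D ^ (ν / 2) = D⁻¹ ^ (-ν / 2) := by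
    rw [Real.inv_rpow hD.le, ← Real.rpow_neg hD.le]
    congr 1
    ring
  rw [e, ← Real.mul_rpow (by positivity) (by positivity)]
  refine Real.rpow_le_rpow_of_nonpos (by positivity) ?_ (by linarith)
  rw [inv_mul_le_iff₀ hD]
  linarith

lemma exists_kern_sub_le {ν ε : ℝ} (hν : 0 ≤ ν) (hε : 0 < ε) (R : ℝ) :
    ∃ C : ℝ, 0 ≤ C ∧ ∀ x y : Space N, ‖y‖ ≤ R → kern ν ε (x - y) ≤ C * kern ν 1 x := by
  -- Since ‖x‖² ≤ 2‖x-y‖² + 2R², the summand 2 handles ‖x-y‖², while the other one, multiplied by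
  -- ε², gives 1 + 2R².
  refine ⟨(2 + (1 + 2 * R ^ 2) / ε ^ 2) ^ (ν / 2), by positivity, fun x y hy => ?_⟩
  refine kern_le_of_le hν (by positivity) ?_
  have h1 : ‖x‖ ≤ ‖x - y‖ + ‖y‖ := by
    simpa using norm_add_le (x - y) y
  have h2 : ‖x‖ ^ 2 ≤ 2 * ‖x - y‖ ^ 2 + 2 * R ^ 2 := by
    nlinarith [sq_nonneg (‖x - y‖ - ‖y‖), norm_nonneg x, norm_nonneg y, norm_nonneg (x - y)]
  have h3 : (1 + 2 * R ^ 2) / ε ^ 2 * ε ^ 2 = 1 + 2 * R ^ 2 := by field_simp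
  have h4 : 0 ≤ (1 + 2 * R ^ 2) / ε ^ 2 * ‖x - y‖ ^ 2 := by positivity
  nlinarith [sq_nonneg ε]

lemma kern_smul_self (ν : ℝ) {ε : ℝ} (hε : 0 < ε) (z : Space N) :
    kern ν ε (ε • z) = ε ^ (-ν) * kern ν 1 z := by
  unfold kern
  rw [norm_smul, Real.norm_of_nonneg hε.le, mul_pow,
    show ε ^ 2 * ‖z‖ ^ 2 + ε ^ 2 = ε ^ 2 * (‖z‖ ^ 2 + 1 ^ 2) by ring,
    Real.mul_rpow (by positivity) (by positivity), ← Real.rpow_natCast ε 2, ← Real.rpow_mul hε.le]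
  congr 2
  push_cast
  ring

/-- The mollification by the kernel `ε² kern (N + 2) ε`, after rescaling. -/
lemma integral_mul_kern_eq {ε : ℝ} (hε : 0 < ε) (ψ : Space N → ℝ) (x : Space N) :
    ∫ y, ψ y * (ε ^ 2 * kern (N + 2) ε (x - y)) = ∫ z, ψ (x - ε • z) * kern (N + 2) 1 z := by
  have h1 := Measure.integral_comp_smul volume
    (fun z : Space N => ψ (x - z) * (ε ^ 2 * kern (N + 2) ε z)) ε
  have h2 : ∫ y, ψ y * (ε ^ 2 * kern (N + 2) ε (x - y))
      = ∫ z : Space N, ψ (x - z) * (ε ^ 2 * kern (N + 2) ε z) := by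
    rw [← integral_sub_left_eq_self _ volume x]
    simp
  rw [h2]
  have hp : (0 : ℝ) < ε ^ N := by positivity
  rw [finrank_euclideanSpace, Fintype.card_fin, abs_of_pos (by positivity), smul_eq_mul,
    eq_inv_mul_iff_mul_eq₀ hp.ne', ← integral_const_mul] at h1
  rw [← h1]
  refine integral_congr_ae (Eventually.of_forall fun z => ?_)
  simp only [kern_smul_self _ hε]
  have : ε ^ N * (ε ^ 2 * ε ^ (-((N : ℝ) + 2))) = 1 := by
    rw [Real.rpow_neg hε.le, Real.rpow_add hε, Real.rpow_natCast, Real.rpow_two]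
    field_simp
  linear_combination (ψ (x - ε • z) * kern (N + 2) 1 z) * this

lemma IsTest.exists_radius {ψ : Space N → ℝ} (hψ : IsTest ψ) :
    ∃ R : ℝ, 1 ≤ R ∧ ∀ y, ψ y ≠ 0 → ‖y‖ ≤ R := by
  obtain ⟨R, hR⟩ := hψ.compact.isCompact.isBounded.subset_closedBall (0 : Space N)
  refine ⟨max 1 R, le_max_left _ _, fun y hy => le_max_of_le_right ?_⟩
  simpa using hR (subset_tsupport ψ hy)

/-- A majorant uniform in ε, needed for dominated convergence against an L² function, because the
mollifying kernel has polynomial tails. Near the support of ψ the smoothed function is bounded by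
sup |ψ| times the mass of the kernel; away from it |x-y| ≥ |x|/2 lets the kernel itself be compared
with its value at x. -/
lemma exists_mollification_bound {ψ : Space N → ℝ} (hψ : IsTest ψ) :
    ∃ C : ℝ, 0 ≤ C ∧ ∀ ε : ℝ, 0 < ε → ε ≤ 1 → ∀ x,
      |∫ y, ψ y * (ε ^ 2 * kern (N + 2) ε (x - y))| ≤ C * kern (N + 2) 1 x := by
  obtain ⟨R, hR1, hR⟩ := hψ.exists_radius
  obtain ⟨M, hM0, hM⟩ := hψ.exists_bound
  have hν : (0 : ℝ) ≤ N + 2 := by positivity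
  have hki : Integrable (kern (N + 2) 1 : Space N → ℝ) := integrable_kern_one (by linarith)
  obtain ⟨κ, hκe⟩ : ∃ κ, κ = ∫ z : Space N, kern (N + 2) 1 z := ⟨_, rfl⟩
  have hκ : 0 ≤ κ := hκe ▸ integral_nonneg fun z => kern_nonneg _ _ _
  obtain ⟨C₁, hC₁⟩ : ∃ c, c = M * κ * (1 + 4 * R ^ 2) ^ (((N : ℝ) + 2) / 2) := ⟨_, rfl⟩
  obtain ⟨I, hI⟩ : ∃ I, I = ∫ y, |ψ y| := ⟨_, rfl⟩
  have hI0 : 0 ≤ I := hI ▸ integral_nonneg fun _ => abs_nonneg _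
  -- In the far region ‖x‖ ≥ 1, so 1 + ‖x‖² ≤ 2‖x‖² ≤ 8‖x-y‖².
  obtain ⟨C₂, hC₂⟩ : ∃ c, c = 8 ^ (((N : ℝ) + 2) / 2) * I := ⟨_, rfl⟩
  have hC₁0 : 0 ≤ C₁ := by rw [hC₁]; positivity
  have hC₂0 : 0 ≤ C₂ := by rw [hC₂]; positivity
  refine ⟨C₁ + C₂, by positivity, fun ε hε hε1 x => ?_⟩
  have hk0 := kern_nonneg (N + 2) 1 x
  rcases le_or_gt ‖x‖ (2 * R) with hx | hx
  · have b1 : |∫ y, ψ y * (ε ^ 2 * kern (N + 2) ε (x - y))| ≤ M * κ := by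
      rw [integral_mul_kern_eq hε, hκe, ← integral_const_mul, ← Real.norm_eq_abs]
      refine norm_integral_le_of_norm_le (hki.const_mul M) (Eventually.of_forall fun z => ?_)
      rw [norm_mul, Real.norm_of_nonneg (kern_nonneg _ _ _)]
      exact mul_le_mul_of_nonneg_right (hM _) (kern_nonneg _ _ _)
    have hx2 : ‖x‖ ^ 2 ≤ 4 * R ^ 2 := by
      have := pow_le_pow_left₀ (norm_nonneg x) hx 2
      linarith
    have b2 : 1 ≤ (1 + 4 * R ^ 2) ^ (((N : ℝ) + 2) / 2) * kern (N + 2) 1 x := by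
      have := kern_le_of_le (N := N) (ν := N + 2) (ε := 1) (D := 1 + 4 * R ^ 2) (z := 0) (x := x) hν
        (by positivity) (by rw [norm_zero]; linarith)
      have h0 : kern ((N : ℝ) + 2) 1 (0 : Space N) = 1 := by simp [kern]
      rwa [h0] at this
    calc _ ≤ M * κ := b1
      _ ≤ M * κ * ((1 + 4 * R ^ 2) ^ (((N : ℝ) + 2) / 2) * kern (N + 2) 1 x) :=
          le_mul_of_one_le_right (mul_nonneg hM0 hκ) b2
      _ = C₁ * kern (N + 2) 1 x := by rw [hC₁]; ring
      _ ≤ _ := mul_le_mul_of_nonneg_right (by linarith) hk0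
  · have b1 : |∫ y, ψ y * (ε ^ 2 * kern (N + 2) ε (x - y))|
        ≤ ∫ y, |ψ y| * (8 ^ (((N : ℝ) + 2) / 2) * kern (N + 2) 1 x) := by
      rw [← Real.norm_eq_abs]
      refine norm_integral_le_of_norm_le (hψ.integrable.abs.mul_const _)
        (Eventually.of_forall fun y => ?_)
      rw [norm_mul, Real.norm_eq_abs]
      rcases eq_or_ne (ψ y) 0 with h0 | h0
      · simp [h0]
      · refine mul_le_mul_of_nonneg_left ?_ (abs_nonneg _)
        rw [Real.norm_of_nonneg (mul_nonneg (by positivity) (kern_nonneg _ _ _))]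
        have hy := hR y h0
        have h1 : ‖x‖ ≤ ‖x - y‖ + ‖y‖ := by simpa using norm_add_le (x - y) y
        have h2 : ‖x‖ / 2 ≤ ‖x - y‖ := by linarith
        have h3 : kern (N + 2) ε (x - y) ≤ 8 ^ (((N : ℝ) + 2) / 2) * kern (N + 2) 1 x := by
          refine kern_le_of_le hν (by norm_num) ?_
          have h4 : (‖x‖ / 2) ^ 2 ≤ ‖x - y‖ ^ 2 := pow_le_pow_left₀ (by positivity) h2 2
          have h5 : 1 ≤ ‖x‖ ^ 2 := one_le_pow₀ (by linarith)
          linarith [sq_nonneg ε]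
        calc ε ^ 2 * kern (N + 2) ε (x - y) ≤ 1 * kern (N + 2) ε (x - y) := by
              exact mul_le_mul_of_nonneg_right (pow_le_one₀ hε.le hε1) (kern_nonneg _ _ _)
          _ ≤ _ := by rw [one_mul]; exact h3
    rw [integral_mul_const, ← hI] at b1
    calc _ ≤ _ := b1
      _ = C₂ * kern (N + 2) 1 x := by rw [hC₂]; ring
      _ ≤ _ := mul_le_mul_of_nonneg_right (by linarith) hk0

lemma tendsto_mollification {ψ : Space N → ℝ} (hψ : IsTest ψ) {e : ℕ → ℝ} (he0 : ∀ n, 0 < e n)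
    (he : Tendsto e atTop (𝓝 0)) (x : Space N) :
    Tendsto (fun n => ∫ y, ψ y * (e n ^ 2 * kern (N + 2) (e n) (x - y))) atTop
      (𝓝 (ψ x * ∫ z : Space N, kern (N + 2) 1 z)) := by
  obtain ⟨M, hM0, hM⟩ := hψ.exists_bound
  simp only [fun n => integral_mul_kern_eq (he0 n) ψ x]
  rw [← integral_const_mul]
  have hki : Integrable (kern (N + 2) 1 : Space N → ℝ) := integrable_kern_one (by linarith)
  refine tendsto_integral_of_dominated_convergence (fun z => M * kern (N + 2) 1 z) (fun n => ?_)
    (hki.const_mul M) (fun n => Eventually.of_forall fun z => ?_)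
    (Eventually.of_forall fun z => ?_)
  · refine Continuous.aestronglyMeasurable ?_ |>.mul (measurable_kern _ _).aestronglyMeasurable
    exact hψ.continuous.comp (continuous_const.sub (continuous_const_smul _))
  · rw [norm_mul, Real.norm_of_nonneg (kern_nonneg _ _ _)]
    exact mul_le_mul_of_nonneg_right (hM _) (kern_nonneg _ _ _)
  · have h1 : Tendsto (fun n => x - e n • z) atTop (𝓝 x) := by
      simpa using (he.smul_const z).const_sub x
    exact ((hψ.continuous.tendsto x).comp h1).mul_const _

end ChoquardPoisson

namespace ChoquardPoisson

open Filter Topology Metric Set Function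

variable {N : ℕ}

/-! ### Representation of solutions of the Poisson equation -/

lemma isTest_kern_sub_mul' (μ : ℝ) {ε : ℝ} (hε : 0 < ε) (n : ℕ) (y : Space N) :
    IsTest fun x => kern μ ε (x - y) * cutoff N n x :=
  isTest_kern_sub_mul μ hε (isTest_cutoff n) y

lemma IsTest.aestronglyMeasurable_fderiv_apply {θ : Space N → ℝ} (hθ : IsTest θ)
    {G : Space N → Space N} (hG : AEStronglyMeasurable G) :
    AEStronglyMeasurable fun x => fderiv ℝ θ x (G x) := by
  simp only [← inner_gradient]
  exact hG.inner hθ.continuous_gradient.aestronglyMeasurable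

lemma IsTest.integrable_fderiv_apply {θ : Space N → ℝ} (hθ : IsTest θ) {G : Space N → Space N}
    (hG : LocallyIntegrable G) {g : Space N → ℝ} (hg : Continuous g) :
    Integrable fun x => g x * fderiv ℝ θ x (G x) := by
  have hc : HasCompactSupport fun x => |g x| * ‖fderiv ℝ θ x‖ :=
    (hθ.compact.fderiv ℝ).norm.mul_left
  have hcont : Continuous fun x => |g x| * ‖fderiv ℝ θ x‖ :=
    hg.abs.mul hθ.continuous_fderiv.norm
  have hGn : LocallyIntegrable fun x => ‖G x‖ :=
    locallyIntegrable_iff.2 fun K hK => (locallyIntegrable_iff.1 hG K hK).norm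
  refine Integrable.mono' (hGn.integrable_smul_left_of_hasCompactSupport hcont hc)
    (hg.aestronglyMeasurable.mul (hθ.aestronglyMeasurable_fderiv_apply hG.aestronglyMeasurable))
    (Eventually.of_forall fun x => ?_)
  rw [norm_mul, smul_eq_mul, mul_assoc, Real.norm_eq_abs]
  exact mul_le_mul_of_nonneg_left ((fderiv ℝ θ x).le_opNorm _) (abs_nonneg _)

/-- The Poisson equation tested with a truncated kernel. -/
lemma integral_poisson_truncated {μ : ℝ} (hμN : (N : ℝ) = μ + 2) {φ S : Space N → ℝ}
    {H : Space N → Space N}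
    (hH : HasWeakGradient φ H)
    (heq : ∀ ψ : Space N → ℝ, IsTest ψ → ∫ x, inner ℝ (H x) (∇ ψ x) = ∫ x, S x * ψ x)
    {ε : ℝ} (hε : 0 < ε) (y : Space N) (n : ℕ) :
    ∫ x, S x * (kern μ ε (x - y) * cutoff N n x)
      = (∫ x, kern μ ε (x - y) * fderiv ℝ (cutoff N n) x (H x))
        + μ * ∫ x, φ x * ((μ + 2) * (ε ^ 2 * kern (N + 2) ε (x - y)) * cutoff N n x
          + kern N ε (x - y) * fderiv ℝ (cutoff N n) x (x - y)) := by
  have hT := isTest_kern_sub_mul' (N := N) μ hε n y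
  have hT2 := isTest_kern_sub_mul' (N := N) (μ + 2) hε n y
  have hθ := isTest_cutoff (N := N) n
  have e := heq _ hT
  simp only [inner_gradient, fderiv_kern_sub_mul hε hθ] at e
  -- The gradient of the kernel of exponent μ is radial, so the derivative can be moved from φ onto
  -- the kernel of exponent μ + 2 through the Euler field at y.
  have e2 := hH.integral_euler hT2 y
  simp only [fderiv_kern_sub_mul hε hθ] at e2
  have hkc : ∀ ν, Continuous fun x : Space N => kern ν ε (x - y) := fun ν =>
    (contDiff_kern ν hε).continuous.comp (continuous_id.sub continuous_const)
  have i1 : Integrable fun x => kern μ ε (x - y) * fderiv ℝ (cutoff N n) x (H x) :=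
    hθ.integrable_fderiv_apply hH.locInt_grad (hkc μ)
  have i2 : Integrable fun x => (kern (μ + 2) ε (x - y) * cutoff N n x) * inner ℝ (H x) (x - y) := by
    have h1 : LocallyIntegrable fun x => inner ℝ (H x) (x - y) := by
      rw [locallyIntegrable_iff]
      intro K hK
      have hcont : Continuous fun x : Space N => x - y := by fun_prop
      obtain ⟨C, hC⟩ := hK.exists_bound_of_continuousOn hcont.continuousOn
      refine Integrable.mono' ((hH.locInt_grad.integrableOn_isCompact hK).norm.const_mul C)
        (hH.locInt_grad.aestronglyMeasurable.inner hcont.aestronglyMeasurable).restrict ?_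
      refine (ae_restrict_iff' hK.measurableSet).2 (Eventually.of_forall fun x hx => ?_)
      refine (norm_inner_le_norm _ _).trans ?_
      rw [mul_comm]
      exact mul_le_mul_of_nonneg_right (hC x hx) (norm_nonneg _)
    simpa only [mul_comm] using hT2.integrable_mul h1
  rw [← e]
  have e3 : ∫ x, (kern μ ε (x - y) * fderiv ℝ (cutoff N n) x (H x)
      - μ * kern (μ + 2) ε (x - y) * inner ℝ (x - y) (H x) * cutoff N n x)
      = (∫ x, kern μ ε (x - y) * fderiv ℝ (cutoff N n) x (H x))
        - μ * ∫ x, (kern (μ + 2) ε (x - y) * cutoff N n x) * inner ℝ (H x) (x - y) := by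
    rw [← integral_const_mul, ← integral_sub i1 (i2.const_mul μ)]
    refine integral_congr_ae (Eventually.of_forall fun x => ?_)
    simp only
    rw [real_inner_comm (H x)]
    ring
  rw [e3, ← neg_eq_iff_eq_neg.2 e2]
  -- As N = μ + 2, the divergence of the Newtonian field collapses to (μ+2)ε² times the kernel of
  -- exponent N + 2: an approximate identity, up to a constant, in place of a Dirac mass.
  have e4 : ∀ x : Space N, φ x * (N * (kern (μ + 2) ε (x - y) * cutoff N n x) +
      (kern (μ + 2) ε (x - y) * fderiv ℝ (cutoff N n) x (x - y)
        - (μ + 2) * kern (μ + 2 + 2) ε (x - y) * inner ℝ (x - y) (x - y) * cutoff N n x))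
      = φ x * ((μ + 2) * (ε ^ 2 * kern (N + 2) ε (x - y)) * cutoff N n x
          + kern N ε (x - y) * fderiv ℝ (cutoff N n) x (x - y)) := by
    intro x
    have := kern_add_two_mul (μ := μ + 2) (ε := ε) (z := x - y) (by positivity)
    rw [real_inner_self_eq_norm_sq, hμN, ← this]
    ring
  simp only [e4]
  ring

/-- The Poisson equation tested with a regularised kernel. -/
lemma integral_poisson_kern (hN : 3 ≤ N) {φ S : Space N → ℝ} {H : Space N → Space N}
    (hφ : MemLp φ 2) (hH : HasWeakGradient φ H) (hH2 : MemLp H 2)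
    (hS : MemLp S (ENNReal.ofReal (2 * N / (N + 2))))
    (heq : ∀ ψ : Space N → ℝ, IsTest ψ → ∫ x, inner ℝ (H x) (∇ ψ x) = ∫ x, S x * ψ x)
    {ε : ℝ} (hε : 0 < ε) (y : Space N) :
    ∫ x, S x * kern (N - 2) ε (x - y)
      = (N - 2) * N * ∫ x, φ x * (ε ^ 2 * kern (N + 2) ε (x - y)) := by
  have hN' : (3 : ℝ) ≤ N := by exact_mod_cast hN
  obtain ⟨M, hM0, hM⟩ := exists_fderiv_cutoff_bound N
  obtain ⟨C₁, hC₁0, hC₁⟩ := exists_kern_sub_le (N := N) (ν := N - 2) (by linarith) hε ‖y‖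
  obtain ⟨C₂, hC₂0, hC₂⟩ := exists_kern_sub_le (N := N) (ν := N) (by linarith) hε ‖y‖
  obtain ⟨C₃, hC₃0, hC₃⟩ := exists_kern_sub_le (N := N) (ν := N + 2) (by linarith) hε ‖y‖
  have mk : ∀ ν, AEStronglyMeasurable fun x : Space N => kern ν ε (x - y) := fun ν =>
    ((measurable_kern ν ε).comp (measurable_id.sub_const y)).aestronglyMeasurable
  have mθ : ∀ n, AEStronglyMeasurable (cutoff N n) := fun n =>
    (isTest_cutoff n).continuous.aestronglyMeasurable
  have hpair : ∀ {ν : ℝ}, (N : ℝ) < 2 * ν → ∀ {g : Space N → ℝ}, MemLp g 2 →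
      Integrable fun x => |g x| * kern ν 1 x := fun hν g hg =>
    hg.abs.integrable_mul (memLp_two_kern_one hν)
  -- Hölder with the conjugate exponent 2N/(N-2), for which the kernel to that power decays like
  -- |x|^(-2N).
  have hSi : Integrable fun x => |S x| * kern (N - 2) 1 x := by
    have hp : (1 : ℝ) < 2 * N / (N + 2) := by
      rw [lt_div_iff₀ (by positivity)]
      linarith
    have hconj : (2 * N / (N + 2) : ℝ).HolderConjugate (2 * N / (N - 2)) := by
      rw [Real.holderConjugate_iff]
      refine ⟨hp, ?_⟩
      have : (N : ℝ) - 2 ≠ 0 := by linarith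
      field_simp
      ring
    have := hconj.ennrealOfReal
    refine hS.abs.integrable_mul (q := ENNReal.ofReal (2 * N / (N - 2))) ?_
    refine memLp_kern_one (by apply div_pos <;> linarith) ?_
    have : (N : ℝ) - 2 ≠ 0 := by linarith
    field_simp
    linarith
  have limL : Tendsto (fun n => ∫ x, S x * (kern (N - 2) ε (x - y) * cutoff N n x)) atTop
      (𝓝 (∫ x, S x * kern (N - 2) ε (x - y))) := by
    refine tendsto_integral_of_dominated_convergence (fun x => C₁ * (|S x| * kern (N - 2) 1 x))
      (fun n => hS.1.mul ((mk _).mul (mθ n))) (hSi.const_mul _)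
      (fun n => Eventually.of_forall fun x => ?_) (Eventually.of_forall fun x => ?_)
    · rw [norm_mul, norm_mul, Real.norm_of_nonneg (kern_nonneg _ _ _),
        Real.norm_of_nonneg (cutoff_nonneg _ _), Real.norm_eq_abs]
      calc _ ≤ |S x| * ((C₁ * kern (N - 2) 1 x) * 1) := by
            have h0 := kern_nonneg (N - 2) ε (x - y)
            have h1 := kern_nonneg (N - 2) 1 x
            have h2 := cutoff_nonneg n x
            gcongr
            · exact hC₁ x y le_rfl
            · exact cutoff_le_one n x
        _ = _ := by ring
    · have := ((tendsto_cutoff x).const_mul (kern (N - 2) ε (x - y))).const_mul (S x)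
      simpa using this
  have lim1 : Tendsto (fun n => ∫ x, kern (N - 2) ε (x - y) * fderiv ℝ (cutoff N n) x (H x)) atTop
      (𝓝 0) := by
    have h0 : (0 : ℝ) = ∫ _x : Space N, (0 : ℝ) := by simp
    rw [h0]
    refine tendsto_integral_of_dominated_convergence
      (fun x => C₁ * (2 * M) * (|‖H x‖| * kern (N - 1) 1 x))
      (fun n => (mk _).mul ?_) ((hpair (by linarith) hH2.norm).const_mul _)
      (fun n => Eventually.of_forall fun x => ?_) (Eventually.of_forall fun x => ?_)
    · exact (isTest_cutoff n).aestronglyMeasurable_fderiv_apply hH2.1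
    · rw [norm_mul, Real.norm_of_nonneg (kern_nonneg _ _ _), abs_norm]
      -- The decay of the cutoff's gradient improves the kernel from exponent N - 2 to N - 1. The
      -- latter is square integrable for every N ≥ 3; the former is not when N is 3 or 4.
      have hd : ‖fderiv ℝ (cutoff N n) x‖ ≤ 2 * M * kern 1 1 x := by
        have h1 : ‖fderiv ℝ (cutoff N n) x‖ * (1 + ‖x‖) ≤ 2 * M := by
          have := hM n x
          linarith [this.1, this.2]
        have h2 : 1 ≤ (1 + ‖x‖) * kern 1 1 x := by
          have e1 : kern 1 1 x = (Real.sqrt (‖x‖ ^ 2 + 1 ^ 2))⁻¹ := by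
            rw [kern, Real.sqrt_eq_rpow, ← Real.rpow_neg (by positivity)]
            congr 1
            ring
          rw [e1, ← div_eq_mul_inv, one_le_div (by positivity)]
          rw [Real.sqrt_le_left (by positivity)]
          nlinarith [norm_nonneg x]
        calc ‖fderiv ℝ (cutoff N n) x‖ ≤ ‖fderiv ℝ (cutoff N n) x‖ * ((1 + ‖x‖) * kern 1 1 x) :=
              le_mul_of_one_le_right (norm_nonneg _) h2
          _ = ‖fderiv ℝ (cutoff N n) x‖ * (1 + ‖x‖) * kern 1 1 x := by ring
          _ ≤ _ := mul_le_mul_of_nonneg_right h1 (kern_nonneg _ _ _)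
      calc _ ≤ (C₁ * kern (N - 2) 1 x) * ((2 * M * kern 1 1 x) * ‖H x‖) := by
            refine mul_le_mul (hC₁ x y le_rfl) ?_ (norm_nonneg _)
              (mul_nonneg hC₁0 (kern_nonneg _ _ _))
            exact ((fderiv ℝ (cutoff N n) x).le_opNorm _).trans
              (mul_le_mul_of_nonneg_right hd (norm_nonneg _))
        _ = _ := by
            have e : kern ((N : ℝ) - 1) 1 x = kern (N - 2) 1 x * kern 1 1 x := by
              rw [kern_mul_kern _ _ one_pos]
              congr 1
              ring
            rw [e]
            ring
    · simpa using (tendsto_fderiv_cutoff x (H x)).const_mul (kern (N - 2) ε (x - y))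
  have lim2 : Tendsto (fun n => ∫ x, φ x * ((N - 2 + 2) * (ε ^ 2 * kern (N + 2) ε (x - y))
        * cutoff N n x + kern N ε (x - y) * fderiv ℝ (cutoff N n) x (x - y))) atTop
      (𝓝 (∫ x, φ x * (N * (ε ^ 2 * kern (N + 2) ε (x - y))))) := by
    have hcd : ∀ n, AEStronglyMeasurable fun x : Space N => fderiv ℝ (cutoff N n) x (x - y) :=
      fun n => ((isTest_cutoff n).continuous_fderiv.clm_apply
        (continuous_id.sub continuous_const)).aestronglyMeasurable
    refine tendsto_integral_of_dominated_convergence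
      (fun x => N * ε ^ 2 * C₃ * (|φ x| * kern (N + 2) 1 x)
        + C₂ * (M * (1 + ‖y‖)) * (|φ x| * kern N 1 x))
      (fun n => hφ.1.mul (((((mk _).const_mul _).const_mul _).mul (mθ n)).add ((mk _).mul (hcd n))))
      (((hpair (by linarith) hφ).const_mul _).add ((hpair (by linarith) hφ).const_mul _))
      (fun n => Eventually.of_forall fun x => ?_) (Eventually.of_forall fun x => ?_)
    · rw [norm_mul, Real.norm_eq_abs, Real.norm_eq_abs]
      have k1 := kern_nonneg (N + 2) ε (x - y)
      have k2 := kern_nonneg N ε (x - y)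
      have b1 : |((N : ℝ) - 2 + 2) * (ε ^ 2 * kern (N + 2) ε (x - y)) * cutoff N n x|
          ≤ N * ε ^ 2 * C₃ * kern (N + 2) 1 x := by
        rw [sub_add_cancel, abs_of_nonneg (mul_nonneg (by positivity) (cutoff_nonneg n x))]
        calc _ ≤ (N : ℝ) * (ε ^ 2 * kern (N + 2) ε (x - y)) * 1 := by
              gcongr
              exact cutoff_le_one n x
          _ ≤ (N : ℝ) * (ε ^ 2 * (C₃ * kern (N + 2) 1 x)) * 1 := by
              gcongr
              exact hC₃ x y le_rfl
          _ = _ := by ring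
      have b2 : |kern N ε (x - y) * fderiv ℝ (cutoff N n) x (x - y)|
          ≤ C₂ * (M * (1 + ‖y‖)) * kern N 1 x := by
        rw [abs_mul, abs_of_nonneg k2]
        calc _ ≤ (C₂ * kern N 1 x) * (M * (1 + ‖y‖)) := by
              refine mul_le_mul (hC₂ x y le_rfl) ?_ (abs_nonneg _)
                (mul_nonneg hC₂0 (kern_nonneg _ _ _))
              refine ((fderiv ℝ (cutoff N n) x).le_opNorm _).trans ?_
              have h1 := norm_sub_le x y
              have h2 := hM n x
              have h3 := mul_le_mul_of_nonneg_left h1 (norm_nonneg (fderiv ℝ (cutoff N n) x))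
              have h4 := mul_le_mul_of_nonneg_right h2.1 (norm_nonneg y)
              linarith [h2.2]
          _ = _ := by ring
      calc _ ≤ |φ x| * (N * ε ^ 2 * C₃ * kern (N + 2) 1 x
            + C₂ * (M * (1 + ‖y‖)) * kern N 1 x) :=
            mul_le_mul_of_nonneg_left ((abs_add_le _ _).trans (add_le_add b1 b2)) (abs_nonneg _)
        _ = _ := by ring
    · have h1 := (tendsto_cutoff x).const_mul
        (((N : ℝ) - 2 + 2) * (ε ^ 2 * kern (N + 2) ε (x - y)))
      have h2 := (tendsto_fderiv_cutoff x (x - y)).const_mul (kern N ε (x - y))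
      have h3 := (h1.add h2).const_mul (φ x)
      simpa using h3
  have e := fun n => integral_poisson_truncated (μ := N - 2) (by ring) hH heq hε y n
  simp only [e] at limL
  have := tendsto_nhds_unique limL (lim1.add (lim2.const_mul ((N : ℝ) - 2)))
  rw [this, zero_add, ← integral_const_mul, ← integral_const_mul]
  exact integral_congr_ae (Eventually.of_forall fun x => by simp only; ring)

/-- A finite energy solution of the Poisson equation is a multiple of the Newton potential. -/
theorem exists_eq_newton_potential (hN : 3 ≤ N) {φ S : Space N → ℝ} {H : Space N → Space N}
    (hφ : MemLp φ 2) (hH : HasWeakGradient φ H) (hH2 : MemLp H 2)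
    (hS : MemLp S (ENNReal.ofReal (2 * N / (N + 2))))
    (heq : ∀ ψ : Space N → ℝ, IsTest ψ → ∫ x, inner ℝ (H x) (∇ ψ x) = ∫ x, S x * ψ x) :
    ∃ c : ℝ, 0 < c ∧ ∀ᵐ y, φ y = c * ∫ x, kern (N - 2) 0 (x - y) * S x := by
  have hN' : (3 : ℝ) ≤ N := by exact_mod_cast hN
  have hN1 : 1 ≤ N := by omega
  have hHLS : ∀ g : Space N → ℝ, MemLp g (ENNReal.ofReal (2 * N / (N + 2))) →
      Integrable (fun z : Space N × Space N => kern (N - 2) 0 (z.1 - z.2) * (S z.1 * g z.2))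
        (volume.prod volume) := fun g hg =>
    integrable_kern_mul hN1 (by linarith) (by linarith)
      (by congr 1; ring) hS hg
  have hki : Integrable (kern (N + 2) 1 : Space N → ℝ) := integrable_kern_one (by linarith)
  set κ := ∫ z : Space N, kern (N + 2) 1 z with hκ
  have hκ0 : 0 < κ := by
    rw [hκ, integral_pos_iff_support_of_nonneg (fun z => kern_nonneg _ _ _) hki]
    have : support (kern (N + 2) 1 : Space N → ℝ) = univ := by
      ext z
      simp [(kern_pos (N + 2) one_pos z).ne']
    rw [this]
    exact Measure.measure_univ_pos.2 (NeZero.ne _)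
  set c' : ℝ := (N - 2) * N * κ with hc'
  have hc0 : 0 < c' := by
    have : (0 : ℝ) < N - 2 := by linarith
    have : (0 : ℝ) < N := by linarith
    positivity
  set W : Space N → ℝ := fun y => ∫ x, kern (N - 2) 0 (x - y) * S x with hW
  -- Hardy-Littlewood-Sobolev and Fubini let the potential be paired with any such g; indicators of
  -- compact sets then give its local integrability.
  have hWint : ∀ g : Space N → ℝ, MemLp g (ENNReal.ofReal (2 * N / (N + 2))) →
      Integrable fun y => W y * g y := by
    intro g hg
    refine (hHLS g hg).integral_prod_right.congr (Eventually.of_forall fun y => ?_)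
    simp only [hW]
    rw [← integral_mul_const]
    exact integral_congr_ae (Eventually.of_forall fun x => by simp only; ring)
  have hWloc : LocallyIntegrable W := by
    rw [locallyIntegrable_iff]
    intro K hK
    have h1 := hWint (K.indicator fun _ => 1) (memLp_indicator_const _ hK.measurableSet _
      (Or.inr hK.measure_lt_top.ne))
    rw [← integrable_indicator_iff hK.measurableSet]
    refine h1.congr (Eventually.of_forall fun y => ?_)
    by_cases hy : y ∈ K <;> simp [hy]
  -- The limit ε → 0 is taken after pairing with ψ. Fubini moves the approximate identity from φ
  -- onto ψ, where `exists_mollification_bound` gives a majorant.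
  have hpair : ∀ ψ : Space N → ℝ, IsTest ψ → ∫ y, ψ y * W y = c' * ∫ y, ψ y * φ y := by
    intro ψ hψ
    set e : ℕ → ℝ := fun n => 1 / ((n : ℝ) + 1) with he
    have he0 : ∀ n, 0 < e n := fun n => by simp only [he]; positivity
    have he1 : ∀ n, e n ≤ 1 := fun n => by
      simp only [he]
      rw [div_le_one (by positivity)]
      linarith [(n.cast_nonneg : (0 : ℝ) ≤ n)]
    have hel : Tendsto e atTop (𝓝 0) := tendsto_one_div_add_atTop_nhds_zero_nat
    have hI := hHLS ψ (hψ.memLp _)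
    have hIe : ∀ n, Integrable (fun z : Space N × Space N =>
        kern (N - 2) (e n) (z.1 - z.2) * (S z.1 * ψ z.2)) (volume.prod volume) := by
      intro n
      refine hI.mono ((measurable_kern_sub _ _).aestronglyMeasurable.mul
        (hS.1.comp_fst.mul hψ.continuous.aestronglyMeasurable.comp_snd)) ?_
      filter_upwards [ae_fst_ne_snd hN1] with z hz
      rw [norm_mul, norm_mul (kern _ 0 _), Real.norm_of_nonneg (kern_nonneg _ _ _),
        Real.norm_of_nonneg (kern_nonneg _ _ _)]
      exact mul_le_mul_of_nonneg_right (kern_le_kern_zero (by linarith) _ (sub_ne_zero.2 hz))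
        (norm_nonneg _)
    have limL : Tendsto (fun n => ∫ z : Space N × Space N,
        kern (N - 2) (e n) (z.1 - z.2) * (S z.1 * ψ z.2) ∂(volume.prod volume)) atTop
        (𝓝 (∫ z : Space N × Space N,
          kern (N - 2) 0 (z.1 - z.2) * (S z.1 * ψ z.2) ∂(volume.prod volume))) := by
      refine tendsto_integral_of_dominated_convergence _ (fun n => (hIe n).aestronglyMeasurable)
        hI.norm (fun n => ?_) ?_
      · filter_upwards [ae_fst_ne_snd hN1] with z hz
        rw [norm_mul, norm_mul (kern _ 0 _), Real.norm_of_nonneg (kern_nonneg _ _ _),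
          Real.norm_of_nonneg (kern_nonneg _ _ _)]
        exact mul_le_mul_of_nonneg_right (kern_le_kern_zero (by linarith) _ (sub_ne_zero.2 hz))
          (norm_nonneg _)
      · filter_upwards [ae_fst_ne_snd hN1] with z hz
        exact (tendsto_kern (sub_ne_zero.2 hz) hel).mul_const _
    have eL0 : ∫ z : Space N × Space N,
          kern (N - 2) 0 (z.1 - z.2) * (S z.1 * ψ z.2) ∂(volume.prod volume)
        = ∫ y, ψ y * W y := by
      rw [integral_prod_symm _ hI]
      refine integral_congr_ae (Eventually.of_forall fun y => ?_)
      simp only [hW]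
      rw [← integral_const_mul]
      exact integral_congr_ae (Eventually.of_forall fun x => by simp only; ring)
    obtain ⟨R, hR1, hR⟩ := hψ.exists_radius
    have hJ : ∀ n, Integrable (fun z : Space N × Space N =>
        φ z.1 * (ψ z.2 * (e n ^ 2 * kern (N + 2) (e n) (z.1 - z.2)))) (volume.prod volume) := by
      intro n
      obtain ⟨C, hC0, hC⟩ := exists_kern_sub_le (N := N) (ν := N + 2) (by linarith) (he0 n) R
      have hb : Integrable fun x => |φ x| * kern (N + 2) 1 x :=
        hφ.abs.integrable_mul (memLp_two_kern_one (by linarith))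
      refine Integrable.mono' ((hb.mul_prod hψ.integrable.abs).const_mul (e n ^ 2 * C))
        (hφ.1.comp_fst.mul (hψ.continuous.aestronglyMeasurable.comp_snd.mul
          ((measurable_kern_sub _ _).aestronglyMeasurable.const_mul _)))
        (Eventually.of_forall fun z => ?_)
      rw [norm_mul, norm_mul, norm_mul, Real.norm_of_nonneg (kern_nonneg _ _ _),
        Real.norm_of_nonneg (by positivity : 0 ≤ e n ^ 2), Real.norm_eq_abs, Real.norm_eq_abs]
      rcases eq_or_ne (ψ z.2) 0 with h0 | h0
      · simp [h0]
      · have := hC z.1 z.2 (hR _ h0)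
        calc _ ≤ |φ z.1| * (|ψ z.2| * (e n ^ 2 * (C * kern (N + 2) 1 z.1))) := by gcongr
          _ = _ := by ring
    have eq1 : ∀ n, ∫ z : Space N × Space N,
        kern (N - 2) (e n) (z.1 - z.2) * (S z.1 * ψ z.2) ∂(volume.prod volume)
        = (N - 2) * N * ∫ x, φ x * ∫ y, ψ y * (e n ^ 2 * kern (N + 2) (e n) (x - y)) := by
      intro n
      have h1 : ∫ x, φ x * ∫ y, ψ y * (e n ^ 2 * kern (N + 2) (e n) (x - y))
          = ∫ z : Space N × Space N,
            φ z.1 * (ψ z.2 * (e n ^ 2 * kern (N + 2) (e n) (z.1 - z.2))) ∂(volume.prod volume) := by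
        rw [integral_prod _ (hJ n)]
        refine integral_congr_ae (Eventually.of_forall fun x => ?_)
        simp only
        rw [← integral_const_mul]
      rw [h1, integral_prod_symm _ (hJ n), integral_prod_symm _ (hIe n), ← integral_const_mul]
      refine integral_congr_ae (Eventually.of_forall fun y => ?_)
      simp only
      have h2 := integral_poisson_kern hN hφ hH hH2 hS heq (he0 n) y
      have h3 : ∫ x, kern (N - 2) (e n) (x - y) * (S x * ψ y)
          = ψ y * ∫ x, S x * kern (N - 2) (e n) (x - y) := by
        rw [← integral_const_mul]
        exact integral_congr_ae (Eventually.of_forall fun x => by simp only; ring)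
      have h4 : ∫ x, φ x * (ψ y * (e n ^ 2 * kern (N + 2) (e n) (x - y)))
          = ψ y * ∫ x, φ x * (e n ^ 2 * kern (N + 2) (e n) (x - y)) := by
        rw [← integral_const_mul]
        exact integral_congr_ae (Eventually.of_forall fun x => by simp only; ring)
      rw [h3, h4, h2]
      ring
    obtain ⟨C, hC0, hC⟩ := exists_mollification_bound hψ
    have limR : Tendsto (fun n => ∫ x, φ x * ∫ y, ψ y * (e n ^ 2 * kern (N + 2) (e n) (x - y)))
        atTop (𝓝 (∫ x, φ x * (ψ x * κ))) := by
      have hb : Integrable fun x => |φ x| * kern (N + 2) 1 x :=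
        hφ.abs.integrable_mul (memLp_two_kern_one (by linarith))
      refine tendsto_integral_of_dominated_convergence
        (fun x => C * (|φ x| * kern (N + 2) 1 x)) (fun n => ?_) (hb.const_mul C)
        (fun n => Eventually.of_forall fun x => ?_) (Eventually.of_forall fun x => ?_)
      · refine (hJ n).integral_prod_left.aestronglyMeasurable.congr
          (Eventually.of_forall fun x => ?_)
        simp only
        rw [← integral_const_mul]
      · rw [norm_mul, Real.norm_eq_abs, Real.norm_eq_abs]
        calc _ ≤ |φ x| * (C * kern (N + 2) 1 x) :=
              mul_le_mul_of_nonneg_left (hC _ (he0 n) (he1 n) x) (abs_nonneg _)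
          _ = _ := by ring
      · exact (tendsto_mollification hψ he0 hel x).const_mul _
    simp only [eq1, eL0] at limL
    rw [tendsto_nhds_unique limL (limR.const_mul _), hc', ← integral_const_mul,
      ← integral_const_mul]
    exact integral_congr_ae (Eventually.of_forall fun x => by simp only; ring)
  refine ⟨c'⁻¹, by positivity, ?_⟩
  have hφc : LocallyIntegrable fun y => c' * φ y := (hφ.locallyIntegrable (by norm_num)).smul c'
  have := ae_eq_of_integral_contDiff_smul_eq hWloc hφc fun ψ h1 h2 => by
    have := hpair ψ ⟨h1, h2⟩
    simp only [smul_eq_mul]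
    rw [this, ← integral_const_mul]
    exact integral_congr_ae (Eventually.of_forall fun x => by simp only; ring)
  filter_upwards [this] with y hy
  change φ y = c'⁻¹ * W y
  rw [hy]
  field_simp

end ChoquardPoisson

namespace ChoquardPoisson

open Filter Topology Metric Set Function

variable {N : ℕ}

/-! ### Coordinates of weak gradients -/

/-- The standard basis vectors. -/
def basisVec (i : Fin N) : Space N := EuclideanSpace.single i 1

lemma inner_basisVec (w : Space N) (i : Fin N) : inner ℝ w (basisVec i) = w i := by
  simp [basisVec, EuclideanSpace.inner_single_right]

lemma sum_smul_basisVec (w : Space N) : ∑ i, w i • basisVec i = w := by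
  simpa [basisVec] using (EuclideanSpace.basisFun (Fin N) ℝ).sum_repr w

lemma inner_eq_sum (v w : Space N) : inner ℝ v w = ∑ i, v i * w i := by
  simp [PiLp.inner_apply, mul_comm]

lemma clm_eq_sum (L : Space N →L[ℝ] ℝ) (w : Space N) : L w = ∑ i, w i * L (basisVec i) := by
  nth_rewrite 1 [← sum_smul_basisVec w]
  simp

lemma contDiff_coord (i : Fin N) : ContDiff ℝ ∞ fun x : Space N => x i :=
  (EuclideanSpace.proj (𝕜 := ℝ) i : Space N →L[ℝ] ℝ).contDiff

lemma fderiv_mul_coord {θ : Space N → ℝ} (hθ : IsTest θ) (j : Fin N) (x v : Space N) :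
    fderiv ℝ (fun x => θ x * x j) x v = fderiv ℝ θ x v * x j + θ x * v j := by
  have h1 : HasFDerivAt (fun x : Space N => x j) (EuclideanSpace.proj j : Space N →L[ℝ] ℝ) x :=
    (EuclideanSpace.proj (𝕜 := ℝ) j).hasFDerivAt
  rw [HasFDerivAt.fderiv (f := fun x : Space N => θ x * x j)
    ((hθ.differentiable x).hasFDerivAt.mul h1)]
  simp
  ring

lemma basisVec_apply (i j : Fin N) : (basisVec i : Space N) j = if j = i then 1 else 0 := by
  simp [basisVec]

lemma HasWeakGradient.weakDeriv_coord {u : Space N → ℝ} {G : Space N → Space N}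
    (h : HasWeakGradient u G) (i : Fin N) : WeakDeriv (basisVec i) u fun x => G x i := by
  simpa only [inner_basisVec] using h.weakDeriv (basisVec i)

lemma hasWeakGradient_of_weakDeriv {u : Space N → ℝ} {G : Space N → Space N}
    (hu : LocallyIntegrable u) (hG : LocallyIntegrable G)
    (h : ∀ i, WeakDeriv (basisVec i) u fun x => G x i) : HasWeakGradient u G := by
  refine ⟨hu, hG, fun ψ hψ => ?_⟩
  have h1 : Integrable fun x => u x • ∇ ψ x :=
    hu.integrable_smul_right_of_hasCompactSupport hψ.continuous_gradient hψ.compact_gradient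
  have h2 : Integrable fun x => ψ x • G x :=
    hG.integrable_smul_left_of_hasCompactSupport hψ.continuous hψ.compact
  have e : ∀ i, inner ℝ (basisVec i) (∫ x, u x • ∇ ψ x)
      = inner ℝ (basisVec i) (-∫ x, ψ x • G x) := by
    intro i
    rw [inner_neg_right, ← integral_inner h1, ← integral_inner h2]
    have := (h i).integral_eq ψ hψ
    simp only [inner_smul_right, inner_gradient]
    rw [this]
    congr 1
    refine integral_congr_ae (Eventually.of_forall fun x => ?_)
    simp only
    rw [real_inner_comm, inner_basisVec, mul_comm]
  ext i
  have := e i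
  rwa [real_inner_comm, inner_basisVec, real_inner_comm, inner_basisVec] at this

lemma HasWeakGradient.ae_unique {u : Space N → ℝ} {G G' : Space N → Space N}
    (h : HasWeakGradient u G) (h' : HasWeakGradient u G') : G =ᵐ[volume] G' := by
  have : ∀ᵐ x, ∀ i, G x i = G' x i :=
    ae_all_iff.2 fun i => (h.weakDeriv_coord i).ae_unique (h'.weakDeriv_coord i)
  filter_upwards [this] with x hx
  ext i
  exact hx i

lemma MemLpLoc.coord {G : Space N → Space N} {r : ENNReal} (h : MemLpLoc G r) (i : Fin N) :
    MemLpLoc (fun x => G x i) r := fun S hS => by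
  have h1 := h S hS
  refine h1.mono ?_ (Eventually.of_forall fun x => PiLp.norm_apply_le (G x) i)
  exact (EuclideanSpace.proj (𝕜 := ℝ) i : Space N →L[ℝ] ℝ).continuous.comp_aestronglyMeasurable h1.1

lemma MemLpLoc.locallyIntegrable {f : Space N → ℝ} (h : MemLpLoc f 2) : LocallyIntegrable f := by
  rw [locallyIntegrable_iff]
  intro S hS
  have : IsFiniteMeasure (volume.restrict S) := ⟨by simpa using hS.measure_lt_top⟩
  exact (h S hS).integrable (by norm_num)

lemma memLpLoc_of_memLp {F : Type*} [NormedAddCommGroup F] {f : Space N → F} {r : ENNReal}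
    (h : MemLp f r) : MemLpLoc f r := fun _ _ => h.restrict _

lemma HasWeakGradient.sq {u : Space N → ℝ} {G : Space N → Space N} (h : HasWeakGradient u G)
    (hu : MemLpLoc u 2) (hG : MemLpLoc G 2) :
    HasWeakGradient (fun x => u x ^ 2) fun x => (2 * u x) • G x := by
  have hW : ∀ i, WeakDeriv (basisVec i) (fun x => u x ^ 2) fun x => ((2 * u x) • G x) i := by
    intro i
    simpa using (h.weakDeriv_coord i).sq hu (hG.coord i)
  refine hasWeakGradient_of_weakDeriv ?_ ?_ hW
  · simpa only [pow_two] using hu.locallyIntegrable_mul hu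
  · rw [locallyIntegrable_iff]
    intro S hS
    exact memLp_one_iff_integrable.1 ((hG S hS).smul ((hu S hS).const_mul 2))

lemma integrable_norm_sq {F : Type*} [NormedAddCommGroup F] {f : Space N → F} (h : MemLp f 2) :
    Integrable fun x => ‖f x‖ ^ 2 :=
  MemLp.integrable_norm_pow (p := 2) (by exact_mod_cast h) two_ne_zero

/-! ### Local identities for functions in `H²_loc` -/

/-- Weak second derivatives are symmetric. -/
lemma weakDeriv_symm {u : Space N → ℝ} {G : Space N → Space N} (hu : HasWeakGradient u G)
    {d : Fin N → Fin N → Space N → ℝ}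
    (hd : ∀ i j, WeakDeriv (basisVec j) (fun x => G x i) (d i j)) (i j : Fin N) :
    d i j =ᵐ[volume] d j i := by
  refine ae_eq_of_integral_contDiff_smul_eq (hd i j).locInt_deriv (hd j i).locInt_deriv
    fun ψ h1 h2 => ?_
  have hψ : IsTest ψ := ⟨h1, h2⟩
  -- Two integrations by parts put both derivatives on the smooth ψ, where they commute.
  have key : ∀ i j, ∫ x, d i j x * ψ x
      = ∫ x, u x * fderiv ℝ (fun y => fderiv ℝ ψ y (basisVec j)) x (basisVec i) := by
    intro i j
    have e1 := (hd i j).integral_eq ψ hψ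
    have e2 := (hu.weakDeriv_coord i).integral_eq _ (hψ.fderiv_apply (basisVec j))
    rw [e2, e1, neg_neg]
  simp only [smul_eq_mul, mul_comm (ψ _)]
  rw [key i j, key j i]
  refine integral_congr_ae (Eventually.of_forall fun x => ?_)
  simp only
  have hs : IsSymmSndFDerivAt ℝ ψ x :=
    (h1.contDiffAt (x := x)).isSymmSndFDerivAt (by
      rw [minSmoothness_of_isRCLikeNormedField]
      exact WithTop.coe_le_coe.2 le_top)
  have hdf : DifferentiableAt ℝ (fderiv ℝ ψ) x :=
    ((h1.fderiv_right (m := ∞) (by simp)).differentiable (by simp)) x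
  have e : ∀ v w, fderiv ℝ (fun y => fderiv ℝ ψ y v) x w = fderiv ℝ (fderiv ℝ ψ) x w v := by
    intro v w
    rw [fderiv_clm_apply hdf (differentiableAt_const v)]
    simp
  rw [e, e, hs.eq]

section Local

variable {u : Space N → ℝ} {G : Space N → Space N} {d : Fin N → Fin N → Space N → ℝ}

lemma integral_inner_gradient_eq (hG : ∀ i, LocallyIntegrable fun x => G x i)
    (hd : ∀ i j, WeakDeriv (basisVec j) (fun x => G x i) (d i j))
    {ψ : Space N → ℝ} (hψ : IsTest ψ) :
    ∫ x, inner ℝ (G x) (∇ ψ x) = -∫ x, (∑ i, d i i x) * ψ x := by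
  simp only [inner_gradient, fun x => clm_eq_sum (fderiv ℝ ψ x) (G x), Finset.sum_mul]
  rw [integral_finsetSum _ fun i _ => (hψ.fderiv_apply _).integrable_mul (hG i),
    integral_finsetSum _ fun i _ => hψ.integrable_mul (hd i i).locInt_deriv,
    ← Finset.sum_neg_distrib]
  exact Finset.sum_congr rfl fun i _ => (hd i i).integral_eq ψ hψ

lemma integral_laplacian_mul_self (hu : HasWeakGradient u G) (hu2 : MemLpLoc u 2)
    (hG : ∀ i, MemLpLoc (fun x => G x i) 2)
    (hd : ∀ i j, WeakDeriv (basisVec j) (fun x => G x i) (d i j))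
    (hd2 : ∀ i j, MemLpLoc (d i j) 2) {θ : Space N → ℝ} (hθ : IsTest θ) :
    ∫ x, (∑ i, d i i x) * (u x * θ x)
      = -((∫ x, u x * fderiv ℝ θ x (G x)) + ∫ x, ‖G x‖ ^ 2 * θ x) := by
  have e : ∀ i, ∫ x, d i i x * (u x * θ x)
      = -((∫ x, G x i * u x * fderiv ℝ θ x (basisVec i)) + ∫ x, G x i * G x i * θ x) := by
    intro i
    have hm := (hd i i).mul (hu.weakDeriv_coord i) (hG i) (hd2 i i) hu2 (hG i)
    have h := hm.integral_eq θ hθ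
    have i1 := hθ.integrable_mul ((hG i).locallyIntegrable_mul (hG i))
    have i2 := hθ.integrable_mul ((hd2 i i).locallyIntegrable_mul hu2)
    simp only [add_mul] at h
    rw [integral_add i1 i2] at h
    have e2 : ∫ x, d i i x * u x * θ x = ∫ x, d i i x * (u x * θ x) :=
      integral_congr_ae (Eventually.of_forall fun x => by ring)
    rw [e2] at h
    linarith
  have a1 : ∀ i, Integrable fun x => d i i x * (u x * θ x) := fun i =>
    (hθ.integrable_mul ((hd2 i i).locallyIntegrable_mul hu2)).congr
      (Eventually.of_forall fun x => by simp only; ring)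
  have a2 : ∀ i, Integrable fun x => G x i * u x * fderiv ℝ θ x (basisVec i) := fun i =>
    (hθ.fderiv_apply _).integrable_mul ((hG i).locallyIntegrable_mul hu2)
  have a3 : ∀ i, Integrable fun x => G x i * G x i * θ x := fun i =>
    hθ.integrable_mul ((hG i).locallyIntegrable_mul (hG i))
  have e1 : ∫ x, (∑ i, d i i x) * (u x * θ x) = ∑ i, ∫ x, d i i x * (u x * θ x) := by
    simp only [Finset.sum_mul]
    exact integral_finsetSum _ fun i _ => a1 i
  have e2 : ∫ x, u x * fderiv ℝ θ x (G x)
      = ∑ i, ∫ x, G x i * u x * fderiv ℝ θ x (basisVec i) := by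
    rw [← integral_finsetSum _ fun i _ => a2 i]
    refine integral_congr_ae (Eventually.of_forall fun x => ?_)
    simp only
    rw [clm_eq_sum (fderiv ℝ θ x) (G x), Finset.mul_sum]
    exact Finset.sum_congr rfl fun i _ => by ring
  have e3 : ∫ x, ‖G x‖ ^ 2 * θ x = ∑ i, ∫ x, G x i * G x i * θ x := by
    rw [← integral_finsetSum _ fun i _ => a3 i]
    refine integral_congr_ae (Eventually.of_forall fun x => ?_)
    simp only
    rw [← real_inner_self_eq_norm_sq, inner_eq_sum, Finset.sum_mul]
  rw [e1, e2, e3, ← Finset.sum_add_distrib, ← Finset.sum_neg_distrib]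
  exact Finset.sum_congr rfl fun i _ => e i

/-- The Rellich-Pohozaev identity for the field `θ(x) x`. -/
lemma integral_laplacian_mul_euler (hu : HasWeakGradient u G)
    (hG : ∀ i, MemLpLoc (fun x => G x i) 2)
    (hd : ∀ i j, WeakDeriv (basisVec j) (fun x => G x i) (d i j))
    (hd2 : ∀ i j, MemLpLoc (d i j) 2) {θ : Space N → ℝ} (hθ : IsTest θ) :
    ∫ x, (∑ i, d i i x) * (θ x * inner ℝ (G x) x)
      = -(∫ x, (fderiv ℝ θ x (G x) * inner ℝ (G x) x + θ x * ‖G x‖ ^ 2))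
        + 1 / 2 * ∫ x, ‖G x‖ ^ 2 * (N * θ x + fderiv ℝ θ x x) := by
  have hT : ∀ j, IsTest fun x => θ x * x j := fun j => hθ.mul_right (contDiff_coord j)
  have LI := fun i j => (hG i).locallyIntegrable_mul (hG j)
  have Ld := fun i j k => (hd2 i j).locallyIntegrable_mul (hG k)
  -- The i-th derivative is moved off `d i i`; symmetry of the weak Hessian then turns the new
  -- second-order term into `d i j * G i`.
  have e1 : ∀ i j, ∫ x, d i i x * G x j * (θ x * x j)
      = -(∫ x, G x i * G x j * fderiv ℝ (fun x => θ x * x j) x (basisVec i))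
        - ∫ x, d i j x * G x i * (θ x * x j) := by
    intro i j
    have hm := (hd i i).mul (hd j i) (hG i) (hd2 i i) (hG j) (hd2 j i)
    have h := hm.integral_eq _ (hT j)
    have i1 := (hT j).integrable_mul ((hG i).locallyIntegrable_mul (hd2 j i))
    have i2 := (hT j).integrable_mul (Ld i i j)
    simp only [add_mul] at h
    rw [integral_add i1 i2] at h
    have e2 : ∫ x, G x i * d j i x * (θ x * x j) = ∫ x, d i j x * G x i * (θ x * x j) := by
      refine integral_congr_ae ?_
      filter_upwards [weakDeriv_symm hu hd i j] with x hx
      rw [hx]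
      ring
    rw [e2] at h
    linarith
  -- Here `d i j * G i` is half the j-th derivative of the square of `G i`, so a second integration
  -- by parts leaves only first derivatives of u.
  have e2 : ∀ i j, ∫ x, d i j x * G x i * (θ x * x j)
      = -(1 / 2) * ∫ x, G x i * G x i * fderiv ℝ (fun x => θ x * x j) x (basisVec j) := by
    intro i j
    have hm := (hd i j).mul (hd i j) (hG i) (hd2 i j) (hG i) (hd2 i j)
    have h := hm.integral_eq _ (hT j)
    have e3 : ∫ x, (G x i * d i j x + d i j x * G x i) * (θ x * x j)
        = 2 * ∫ x, d i j x * G x i * (θ x * x j) := by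
      rw [← integral_const_mul]
      exact integral_congr_ae (Eventually.of_forall fun x => by simp only; ring)
    rw [e3] at h
    linarith
  have A0 : ∀ i j, Integrable fun x => d i i x * G x j * (θ x * x j) := fun i j =>
    (hT j).integrable_mul (Ld i i j)
  have A1 : ∀ i j, Integrable fun x =>
      G x i * G x j * fderiv ℝ (fun x => θ x * x j) x (basisVec i) := fun i j =>
    ((hT j).fderiv_apply _).integrable_mul (LI i j)
  have A2 : ∀ i j, Integrable fun x =>
      G x i * G x i * fderiv ℝ (fun x => θ x * x j) x (basisVec j) := fun i j =>
    ((hT j).fderiv_apply _).integrable_mul (LI i i)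
  have s0 : ∫ x, (∑ i, d i i x) * (θ x * inner ℝ (G x) x)
      = ∑ i, ∑ j, ∫ x, d i i x * G x j * (θ x * x j) := by
    rw [← Finset.sum_congr rfl fun i _ => integral_finsetSum _ fun j _ => A0 i j,
      ← integral_finsetSum _ fun i _ => integrable_finsetSum _ fun j _ => A0 i j]
    refine integral_congr_ae (Eventually.of_forall fun x => ?_)
    simp only
    rw [inner_eq_sum, Finset.sum_mul]
    refine Finset.sum_congr rfl fun i _ => ?_
    rw [Finset.mul_sum, Finset.mul_sum]
    exact Finset.sum_congr rfl fun j _ => by ring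
  have s1 : ∫ x, (fderiv ℝ θ x (G x) * inner ℝ (G x) x + θ x * ‖G x‖ ^ 2)
      = ∑ i, ∑ j, ∫ x, G x i * G x j * fderiv ℝ (fun x => θ x * x j) x (basisVec i) := by
    rw [← Finset.sum_congr rfl fun i _ => integral_finsetSum _ fun j _ => A1 i j,
      ← integral_finsetSum _ fun i _ => integrable_finsetSum _ fun j _ => A1 i j]
    refine integral_congr_ae (Eventually.of_forall fun x => ?_)
    simp only [fderiv_mul_coord hθ, basisVec_apply]
    rw [← real_inner_self_eq_norm_sq, inner_eq_sum, inner_eq_sum, clm_eq_sum (fderiv ℝ θ x) (G x),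
      Finset.sum_mul, Finset.mul_sum, ← Finset.sum_add_distrib]
    refine Finset.sum_congr rfl fun i _ => ?_
    simp only [mul_add, Finset.sum_add_distrib, Finset.mul_sum]
    congr 1
    · exact Finset.sum_congr rfl fun j _ => by ring
    · simp only [mul_ite, mul_one, mul_zero, Finset.sum_ite_eq', Finset.mem_univ, if_true]
      ring
  have s2 : ∫ x, ‖G x‖ ^ 2 * (N * θ x + fderiv ℝ θ x x)
      = ∑ i, ∑ j, ∫ x, G x i * G x i * fderiv ℝ (fun x => θ x * x j) x (basisVec j) := by
    rw [← Finset.sum_congr rfl fun i _ => integral_finsetSum _ fun j _ => A2 i j,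
      ← integral_finsetSum _ fun i _ => integrable_finsetSum _ fun j _ => A2 i j]
    refine integral_congr_ae (Eventually.of_forall fun x => ?_)
    simp only [fderiv_mul_coord hθ, basisVec_apply, if_true, mul_one]
    rw [← real_inner_self_eq_norm_sq, inner_eq_sum, clm_eq_sum (fderiv ℝ θ x) x, Finset.sum_mul]
    refine Finset.sum_congr rfl fun i _ => ?_
    rw [← Finset.mul_sum, Finset.sum_add_distrib, add_comm]
    congr 2
    · exact Finset.sum_congr rfl fun j _ => by ring
    · simp
  rw [s0, s1, s2]
  simp only [e1, e2, Finset.sum_sub_distrib, Finset.sum_neg_distrib, ← Finset.mul_sum]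
  ring

/-! ### Global identities obtained by removing the cutoff. -/

lemma norm_fderiv_apply_mul_inner_le {L : Space N →L[ℝ] ℝ} {w x : Space N} {M : ℝ}
    (h : ‖L‖ * ‖x‖ ≤ M) : |L w * inner ℝ w x| ≤ M * ‖w‖ ^ 2 := by
  rw [abs_mul]
  calc _ ≤ (‖L‖ * ‖w‖) * (‖w‖ * ‖x‖) :=
        mul_le_mul (L.le_opNorm w) (abs_real_inner_le_norm w x) (abs_nonneg _) (by positivity)
    _ = (‖L‖ * ‖x‖) * ‖w‖ ^ 2 := by ring
    _ ≤ _ := by gcongr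

lemma tendsto_integral_mul_cutoff {f : Space N → ℝ} (hf : Integrable f) :
    Tendsto (fun n => ∫ x, f x * cutoff N n x) atTop (𝓝 (∫ x, f x)) := by
  refine tendsto_integral_of_dominated_convergence (fun x => |f x|)
    (fun n => hf.1.mul (isTest_cutoff n).continuous.aestronglyMeasurable) hf.abs
    (fun n => Eventually.of_forall fun x => ?_) (Eventually.of_forall fun x => ?_)
  · rw [norm_mul, Real.norm_of_nonneg (cutoff_nonneg n x)]
    exact mul_le_of_le_one_right (norm_nonneg _) (cutoff_le_one n x)
  · simpa using (tendsto_cutoff x).const_mul (f x)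

lemma tendsto_integral_mul_div_cutoff {f : Space N → ℝ} (hf : Integrable f) :
    Tendsto (fun n => ∫ x, f x * (N * cutoff N n x + fderiv ℝ (cutoff N n) x x)) atTop
      (𝓝 (N * ∫ x, f x)) := by
  obtain ⟨M, hM0, hM⟩ := exists_fderiv_cutoff_bound N
  rw [← integral_const_mul]
  refine tendsto_integral_of_dominated_convergence (fun x => (N + M) * |f x|)
    (fun n => hf.1.mul (((isTest_cutoff n).continuous.const_mul _).add
      (isTest_cutoff n).continuous_fderiv_self).aestronglyMeasurable) (hf.abs.const_mul _)
    (fun n => Eventually.of_forall fun x => ?_) (Eventually.of_forall fun x => ?_)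
  · rw [norm_mul, mul_comm, Real.norm_eq_abs, Real.norm_eq_abs]
    refine mul_le_mul_of_nonneg_right ((abs_add_le _ _).trans (add_le_add ?_ ?_)) (abs_nonneg _)
    · rw [abs_mul, Nat.abs_cast, abs_of_nonneg (cutoff_nonneg n x)]
      exact mul_le_of_le_one_right (Nat.cast_nonneg _) (cutoff_le_one n x)
    · exact ((fderiv ℝ (cutoff N n) x).le_opNorm x).trans (hM n x).2
  · have := (((tendsto_cutoff x).const_mul (N : ℝ)).add (tendsto_fderiv_cutoff x x)).const_mul (f x)
    simpa [mul_comm] using this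

/-- The commutator with the cutoff vanishes: its gradient is uniformly bounded and tends to zero
pointwise, while u|∇u| is integrable. -/
lemma tendsto_integral_laplacian_mul_self (hu : HasWeakGradient u G) (hu2 : MemLp u 2)
    (hG2 : MemLp G 2)
    (hd : ∀ i j, WeakDeriv (basisVec j) (fun x => G x i) (d i j))
    (hd2 : ∀ i j, MemLpLoc (d i j) 2) :
    Tendsto (fun n => ∫ x, (∑ i, d i i x) * (u x * cutoff N n x)) atTop
      (𝓝 (-∫ x, ‖G x‖ ^ 2)) := by
  obtain ⟨M, hM0, hM⟩ := exists_fderiv_cutoff_bound N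
  have hG : ∀ i, MemLpLoc (fun x => G x i) 2 := (memLpLoc_of_memLp hG2).coord
  simp only [fun n => integral_laplacian_mul_self hu (memLpLoc_of_memLp hu2) hG hd hd2
    (isTest_cutoff n)]
  have h1 : Tendsto (fun n => ∫ x, u x * fderiv ℝ (cutoff N n) x (G x)) atTop (𝓝 0) := by
    have h0 : (0 : ℝ) = ∫ _x : Space N, (0 : ℝ) := by simp
    rw [h0]
    refine tendsto_integral_of_dominated_convergence (fun x => M * (|u x| * |‖G x‖|))
      (fun n => hu2.1.mul ((isTest_cutoff n).aestronglyMeasurable_fderiv_apply hG2.1))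
      ((hu2.abs.integrable_mul hG2.norm.abs).const_mul M)
      (fun n => Eventually.of_forall fun x => ?_) (Eventually.of_forall fun x => ?_)
    · rw [norm_mul, abs_norm, Real.norm_eq_abs (u x)]
      calc _ ≤ |u x| * (M * ‖G x‖) := by
            refine mul_le_mul_of_nonneg_left ?_ (abs_nonneg _)
            exact ((fderiv ℝ (cutoff N n) x).le_opNorm _).trans
              (mul_le_mul_of_nonneg_right (hM n x).1 (norm_nonneg _))
        _ = _ := by ring
    · simpa using (tendsto_fderiv_cutoff x (G x)).const_mul (u x)
  have h2 := tendsto_integral_mul_cutoff (N := N) (integrable_norm_sq hG2)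
  simpa using (h1.add h2).neg

/-- The field grows linearly, so what makes dominated convergence work is the uniform bound on |x|
times the gradient of the cutoff. The limit collects -1 from the derivative of the field and N/2
from its divergence. -/
lemma tendsto_integral_laplacian_mul_euler (hu : HasWeakGradient u G) (hG2 : MemLp G 2)
    (hd : ∀ i j, WeakDeriv (basisVec j) (fun x => G x i) (d i j))
    (hd2 : ∀ i j, MemLpLoc (d i j) 2) :
    Tendsto (fun n => ∫ x, (∑ i, d i i x) * (cutoff N n x * inner ℝ (G x) x)) atTop
      (𝓝 ((N / 2 - 1) * ∫ x, ‖G x‖ ^ 2)) := by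
  obtain ⟨M, hM0, hM⟩ := exists_fderiv_cutoff_bound N
  have hG : ∀ i, MemLpLoc (fun x => G x i) 2 := (memLpLoc_of_memLp hG2).coord
  have hGi : Integrable fun x => ‖G x‖ ^ 2 := integrable_norm_sq hG2
  simp only [fun n => integral_laplacian_mul_euler hu hG hd hd2 (isTest_cutoff n)]
  have h1 : Tendsto (fun n => ∫ x, (fderiv ℝ (cutoff N n) x (G x) * inner ℝ (G x) x
      + cutoff N n x * ‖G x‖ ^ 2)) atTop (𝓝 (∫ x, ‖G x‖ ^ 2)) := by
    refine tendsto_integral_of_dominated_convergence (fun x => (M + 1) * ‖G x‖ ^ 2)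
      (fun n => ?_) (hGi.const_mul _)
      (fun n => Eventually.of_forall fun x => ?_) (Eventually.of_forall fun x => ?_)
    · exact (((isTest_cutoff n).aestronglyMeasurable_fderiv_apply hG2.1).mul
        (hG2.1.inner continuous_id.aestronglyMeasurable)).add
        ((isTest_cutoff n).continuous.aestronglyMeasurable.mul hGi.1)
    · have b1 := norm_fderiv_apply_mul_inner_le (w := G x) (hM n x).2
      have b2 : |cutoff N n x * ‖G x‖ ^ 2| ≤ 1 * ‖G x‖ ^ 2 := by
        rw [abs_of_nonneg (mul_nonneg (cutoff_nonneg n x) (by positivity))]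
        exact mul_le_mul_of_nonneg_right (cutoff_le_one n x) (by positivity)
      rw [Real.norm_eq_abs]
      exact (abs_add_le _ _).trans (by linarith)
    · have := ((tendsto_fderiv_cutoff x (G x)).mul_const (inner ℝ (G x) x)).add
        ((tendsto_cutoff x).mul_const (‖G x‖ ^ 2))
      simpa using this
  have h2 := tendsto_integral_mul_div_cutoff (N := N) hGi
  convert! h1.neg.add (h2.const_mul (1 / 2)) using 2
  ring

/-- Since u∇u is half the gradient of u², this is the divergence of x, equal to N, integrated
against u²/2. It also shows that a square integrable u with zero gradient vanishes. -/
lemma tendsto_integral_mul_euler (hu : HasWeakGradient u G) (hu2 : MemLp u 2) (hG2 : MemLp G 2) :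
    Tendsto (fun n => ∫ x, u x * (cutoff N n x * inner ℝ (G x) x)) atTop
      (𝓝 (-(N / 2) * ∫ x, u x ^ 2)) := by
  have hsq := hu.sq (memLpLoc_of_memLp hu2) (memLpLoc_of_memLp hG2)
  have e : ∀ n, ∫ x, u x * (cutoff N n x * inner ℝ (G x) x)
      = -(1 / 2) * ∫ x, u x ^ 2 * (N * cutoff N n x + fderiv ℝ (cutoff N n) x x) := by
    intro n
    have h := hsq.integral_euler (isTest_cutoff n) 0
    simp only [sub_zero, inner_smul_left] at h
    rw [h, mul_neg, neg_mul, neg_neg, ← integral_const_mul]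
    refine integral_congr_ae (Eventually.of_forall fun x => ?_)
    simp
    ring
  simp only [e]
  have h2 := tendsto_integral_mul_div_cutoff (N := N) hu2.integrable_sq
  convert! h2.const_mul (-(1 / 2)) using 2
  ring

end Local

end ChoquardPoisson

namespace ChoquardPoisson

open Filter Topology Metric Set Function

variable {N : ℕ}

/-! ### Potentials -/

/-- The convolution of `F` with the Riesz kernel without its normalising constant. -/
def kernPot (μ : ℝ) (F : Space N → ℝ) (x : Space N) : ℝ := ∫ y, kern μ 0 (x - y) * F y

lemma kernPot_nonneg {μ : ℝ} {F : Space N → ℝ} (hF : ∀ x, 0 ≤ F x) (x : Space N) :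
    0 ≤ kernPot μ F x :=
  integral_nonneg fun y => mul_nonneg (kern_nonneg _ _ _) (hF y)

lemma exists_rieszKernel_eq {α : ℝ} (hα₀ : 0 < α) (hα₁ : α < N) :
    ∃ a : ℝ, 0 < a ∧ ∀ x : Space N, rieszKernel N α x = a * kern (N - α) 0 x := by
  have h1 := Real.Gamma_pos_of_pos (by linarith : 0 < ((N : ℝ) - α) / 2)
  have h2 := Real.Gamma_pos_of_pos (by linarith : 0 < α / 2)
  refine ⟨_, div_pos h1 (mul_pos (mul_pos h2 (Real.rpow_pos_of_pos Real.pi_pos ((N : ℝ) / 2)))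
    (Real.rpow_pos_of_pos two_pos α)), fun x => ?_⟩
  rw [rieszKernel, kern_zero, Real.rpow_neg (norm_nonneg _), div_eq_mul_inv _ (‖x‖ ^ _)]

lemma rieszPotential_eq {α a : ℝ} (h : ∀ x : Space N, rieszKernel N α x = a * kern (N - α) 0 x)
    (F : Space N → ℝ) (x : Space N) : rieszPotential α F x = a * kernPot (N - α) F x := by
  simp only [rieszPotential, kernPot, h, mul_assoc]
  rw [integral_const_mul]

lemma integral_kern_prod {μ : ℝ} {F m : Space N → ℝ}
    (h : Integrable (fun z : Space N × Space N => kern μ 0 (z.1 - z.2) * (F z.2 * m z.1))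
      (volume.prod volume)) :
    ∫ z : Space N × Space N, kern μ 0 (z.1 - z.2) * (F z.2 * m z.1) ∂(volume.prod volume)
      = ∫ x, kernPot μ F x * m x := by
  rw [integral_prod _ h]
  refine integral_congr_ae (Eventually.of_forall fun x => ?_)
  simp only [kernPot]
  rw [← integral_mul_const]
  exact integral_congr_ae (Eventually.of_forall fun y => by simp only; ring)

lemma integrable_kernPot_mul {μ : ℝ} {F m : Space N → ℝ}
    (h : Integrable (fun z : Space N × Space N => kern μ 0 (z.1 - z.2) * (F z.2 * m z.1))
      (volume.prod volume)) : Integrable fun x => kernPot μ F x * m x := by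
  refine h.integral_prod_left.congr (Eventually.of_forall fun x => ?_)
  simp only [kernPot]
  rw [← integral_mul_const]
  exact integral_congr_ae (Eventually.of_forall fun y => by simp only; ring)

/-- By Tonelli: F is nonnegative, so the inner integral of the absolute value is exactly the
potential times |m|. This covers a factor m, such as the Euler derivative of K|u|^q, for which only
the product with the potential is controlled. -/
lemma integrable_kern_prod_of_kernPot {μ : ℝ} {F m : Space N → ℝ} (hF0 : ∀ x, 0 ≤ F x)
    (mF : AEStronglyMeasurable F) (mm : AEStronglyMeasurable m)
    (hex : ∀ᵐ x, Integrable fun y => kern μ 0 (x - y) * F y)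
    (hi : Integrable fun x => kernPot μ F x * m x) :
    Integrable (fun z : Space N × Space N => kern μ 0 (z.1 - z.2) * (F z.2 * m z.1))
      (volume.prod volume) := by
  have hm : AEStronglyMeasurable
      (fun z : Space N × Space N => kern μ 0 (z.1 - z.2) * (F z.2 * m z.1))
      (volume.prod volume) :=
    (measurable_kern_sub μ 0).aestronglyMeasurable.mul (mF.comp_snd.mul mm.comp_fst)
  rw [integrable_prod_iff hm]
  constructor
  · filter_upwards [hex] with x hx
    refine (hx.mul_const (m x)).congr (Eventually.of_forall fun y => ?_)
    simp only
    ring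
  · refine hi.abs.congr (Eventually.of_forall fun x => ?_)
    simp only [kernPot]
    rw [abs_mul, abs_of_nonneg (integral_nonneg fun y => mul_nonneg (kern_nonneg _ _ _) (hF0 y)),
      ← integral_mul_const]
    refine integral_congr_ae (Eventually.of_forall fun y => ?_)
    simp only
    rw [norm_mul, norm_mul, Real.norm_of_nonneg (kern_nonneg _ _ _),
      Real.norm_of_nonneg (hF0 y), Real.norm_eq_abs]
    ring

/-- The potential of a nonzero density is locally bounded below. -/
lemma exists_kernPot_lower_bound {μ : ℝ} (hμ : 0 < μ) (hN : 1 ≤ N) {S : Space N → ℝ}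
    (hS0 : ∀ x, 0 ≤ S x) (hSl : LocallyIntegrable S)
    (hne : ¬ S =ᵐ[volume] 0) (hex : ∀ᵐ x, Integrable fun y => kern μ 0 (x - y) * S y) (R : ℝ) :
    ∃ δ : ℝ, 0 < δ ∧ ∀ᵐ x, ‖x‖ ≤ R → δ ≤ kernPot μ S x := by
  have : Nontrivial (Space N) := by
    apply Module.nontrivial_of_finrank_pos (R := ℝ)
    simp
    omega
  have hint : ∀ ρ : ℝ, IntegrableOn S (closedBall 0 ρ) := fun ρ =>
    hSl.integrableOn_isCompact (isCompact_closedBall _ _)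
  obtain ⟨n, hn⟩ : ∃ n : ℕ, 0 < ∫ x in closedBall (0 : Space N) n, S x := by
    by_contra! hc
    apply hne
    have h0 : ∀ n : ℕ, ∀ᵐ x, x ∈ closedBall (0 : Space N) n → S x = 0 := by
      intro n
      have h1 : ∫ x in closedBall (0 : Space N) n, S x = 0 :=
        le_antisymm (hc n) (integral_nonneg hS0)
      rw [integral_eq_zero_iff_of_nonneg hS0 (hint n)] at h1
      exact (ae_restrict_iff' measurableSet_closedBall).1 h1
    filter_upwards [ae_all_iff.2 h0] with x hx
    obtain ⟨n, hn⟩ := exists_nat_ge ‖x‖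
    exact hx n (by simpa using hn)
  -- The closed ball of radius n carries positive mass, and for ‖x‖ ≤ R its points lie within |R| +
  -- n of x.
  refine ⟨(|R| + n + 1) ^ (-μ) * ∫ x in closedBall (0 : Space N) n, S x, by positivity, ?_⟩
  filter_upwards [hex] with x hx hxR
  calc _ = ∫ y in closedBall (0 : Space N) n, (|R| + n + 1) ^ (-μ) * S y :=
        (integral_const_mul _ _).symm
    _ ≤ ∫ y in closedBall (0 : Space N) n, kern μ 0 (x - y) * S y := by
        refine integral_mono_ae ((hint n).const_mul _) hx.integrableOn ?_
        have hne' : ∀ᵐ y ∂(volume.restrict (closedBall (0 : Space N) n)), y ≠ x :=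
          ae_restrict_of_ae (Measure.ae_ne volume x)
        filter_upwards [hne', ae_restrict_mem measurableSet_closedBall] with y hy hy2
        refine mul_le_mul_of_nonneg_right ?_ (hS0 y)
        rw [kern_zero]
        have h1 : 0 < ‖x - y‖ := norm_pos_iff.2 (sub_ne_zero.2 hy.symm)
        refine Real.rpow_le_rpow_of_nonpos h1 ?_ (by linarith)
        have h2 : ‖y‖ ≤ n := by simpa using hy2
        linarith [norm_sub_le x y, le_abs_self R]
    _ ≤ ∫ y, kern μ 0 (x - y) * S y :=
        setIntegral_le_integral hx
          (Eventually.of_forall fun y => mul_nonneg (kern_nonneg _ _ _) (hS0 y))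

/-! ### Integrability of the nonlinear terms -/

lemma abs_rpow_sub_two_mul {t r : ℝ} (hr : 1 < r) : |(|t| ^ (r - 2) * t)| = |t| ^ (r - 1) := by
  rw [abs_mul, abs_of_nonneg (Real.rpow_nonneg (abs_nonneg _) _)]
  rcases eq_or_ne t 0 with rfl | ht
  · simp [Real.zero_rpow (by linarith : r - 1 ≠ 0)]
  · rw [← Real.rpow_add_one (abs_ne_zero.2 ht)]
    congr 1
    ring

lemma rpow_sub_two_mul_mul_self {t r : ℝ} (hr : 1 < r) : |t| ^ (r - 2) * t * t = |t| ^ r := by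
  rcases eq_or_ne t 0 with rfl | ht
  · simp [Real.zero_rpow (by linarith : r ≠ 0)]
  · rw [mul_assoc, ← pow_two, ← sq_abs, ← Real.rpow_natCast |t| 2,
      ← Real.rpow_add (abs_pos.2 ht)]
    congr 1
    push_cast
    ring

lemma aestronglyMeasurable_abs_rpow {ν : Measure (Space N)} {u : Space N → ℝ}
    (hu : AEStronglyMeasurable u ν) (r : ℝ) : AEStronglyMeasurable (fun x => |u x| ^ r) ν :=
  (hu.aemeasurable.abs.pow_const r).aestronglyMeasurable

lemma memLp_abs_rpow {ν : Measure (Space N)} {u : Space N → ℝ} {p s : ℝ} (hp : 0 < p) (hs : 0 < s)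
    (hu : MemLp u (ENNReal.ofReal (p * s)) ν) :
    MemLp (fun x => |u x| ^ p) (ENNReal.ofReal s) ν := by
  rw [← integrable_norm_rpow_iff (aestronglyMeasurable_abs_rpow hu.1 p) (by simpa using hs)
    ENNReal.ofReal_ne_top, ENNReal.toReal_ofReal hs.le]
  have h := hu.integrable_norm_rpow (by simpa using mul_pos hp hs) ENNReal.ofReal_ne_top
  rw [ENNReal.toReal_ofReal (mul_pos hp hs).le] at h
  refine h.congr (Eventually.of_forall fun x => ?_)
  simp only [Real.norm_eq_abs]
  rw [abs_of_nonneg (Real.rpow_nonneg (abs_nonneg _) _), ← Real.rpow_mul (abs_nonneg _)]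

/-- Pointwise |u|^(p-1)|w| ≤ |u|^p + |w|^p, according to which of |u| and |w| is larger. -/
lemma memLp_abs_rpow_mul {ν : Measure (Space N)} {u w : Space N → ℝ} {p s : ℝ} (hp : 1 < p)
    (hs : 0 < s) (hu : MemLp u (ENNReal.ofReal (p * s)) ν)
    (hw : MemLp w (ENNReal.ofReal (p * s)) ν) :
    MemLp (fun x => |u x| ^ (p - 2) * u x * w x) (ENNReal.ofReal s) ν := by
  refine ((memLp_abs_rpow (by linarith) hs hu).add (memLp_abs_rpow (by linarith) hs hw)).mono
    (((aestronglyMeasurable_abs_rpow hu.1 _).mul hu.1).mul hw.1) (Eventually.of_forall fun x => ?_)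
  rw [norm_mul, Real.norm_eq_abs (_ * u x), abs_rpow_sub_two_mul hp, Real.norm_eq_abs,
    Pi.add_apply, Real.norm_of_nonneg (by positivity)]
  have h0 : ∀ t : ℝ, 0 ≤ t → t ^ (p - 1) * t = t ^ p := fun t ht => by
    rw [← Real.rpow_add_one' ht (by linarith)]
    congr 1
    ring
  rcases le_total |u x| |w x| with h | h
  · calc _ ≤ |w x| ^ (p - 1) * |w x| := by gcongr
      _ = |w x| ^ p := h0 _ (abs_nonneg _)
      _ ≤ _ := le_add_of_nonneg_left (by positivity)
  · calc _ ≤ |u x| ^ (p - 1) * |u x| := by gcongr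
      _ = |u x| ^ p := h0 _ (abs_nonneg _)
      _ ≤ _ := le_add_of_nonneg_right (by positivity)

lemma locallyIntegrable_mul_inner {h : Space N → ℝ} {G : Space N → Space N}
    (mh : AEStronglyMeasurable h) (mG : AEStronglyMeasurable G)
    (hi : LocallyIntegrable fun x => h x * ‖G x‖) :
    LocallyIntegrable fun x => h x * inner ℝ (G x) x := by
  have h1 : LocallyIntegrable fun x => ‖x‖ * (h x * ‖G x‖) :=
    LocallyIntegrable.continuous_mul hi continuous_norm
  refine h1.mono (mh.mul (mG.inner continuous_id.aestronglyMeasurable))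
    (Eventually.of_forall fun x => ?_)
  simp only [norm_mul, norm_norm]
  calc _ ≤ ‖h x‖ * (‖G x‖ * ‖x‖) := by
        gcongr
        exact norm_inner_le_norm _ _
    _ = _ := by ring

lemma locallyIntegrable_smul {h : Space N → ℝ} {G : Space N → Space N}
    (mh : AEStronglyMeasurable h) (mG : AEStronglyMeasurable G)
    (hi : LocallyIntegrable fun x => h x * ‖G x‖) : LocallyIntegrable fun x => h x • G x := by
  refine hi.mono (mh.smul mG) (Eventually.of_forall fun x => ?_)
  rw [norm_smul, norm_mul, norm_norm]

/-! ### The Choquard term. -/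

section Choquard

variable {α p : ℝ} {u : Space N → ℝ} {G : Space N → Space N}

/-- For μ = N - α the Hardy-Littlewood-Sobolev exponent is 2N/(N+α), which is exactly the
integrability that the assumption on u gives to |u|^p. -/
lemma choquard_integrable (hN : 1 ≤ N) (hα₀ : 0 < α) (hα₁ : α < N) (hp : 1 < p)
    (hu : MemLp u (ENNReal.ofReal (2 * N * p / (N + α)))) :
    Integrable (fun z : Space N × Space N => kern (N - α) 0 (z.1 - z.2)
      * (|u z.1| ^ p * |u z.2| ^ p)) (volume.prod volume) := by
  have hN' : (1 : ℝ) ≤ N := by exact_mod_cast hN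
  rw [show 2 * N * p / (N + α) = p * (2 * N / (N + α)) by ring] at hu
  have h := memLp_abs_rpow (by linarith) (by positivity) hu
  exact integrable_kern_mul hN (by linarith) (by linarith) (by congr 1; ring) h h

lemma choquard_integrable_mul (hN : 1 ≤ N) (hα₀ : 0 < α) (hα₁ : α < N) (hp : 1 < p)
    (hu : MemLp u (ENNReal.ofReal (2 * N * p / (N + α)))) {w : Space N → ℝ}
    (hw : MemLp w (ENNReal.ofReal (2 * N * p / (N + α)))) :
    Integrable (fun z : Space N × Space N => kern (N - α) 0 (z.1 - z.2)
      * (|u z.2| ^ p * (|u z.1| ^ (p - 2) * u z.1 * w z.1))) (volume.prod volume) := by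
  have hN' : (1 : ℝ) ≤ N := by exact_mod_cast hN
  rw [show 2 * N * p / (N + α) = p * (2 * N / (N + α)) by ring] at hu hw
  have h := memLp_abs_rpow (by linarith) (by positivity) hu
  have h2 := memLp_abs_rpow_mul hp (by positivity) hu hw
  refine (integrable_kern_mul hN (μ := N - α) (by linarith) (by linarith) (by congr 1; ring)
    h2 h).congr (Eventually.of_forall fun z => ?_)
  simp only
  ring

lemma choquard_hasWeakGradient (hN : 1 ≤ N) (hα₀ : 0 < α) (hα₁ : α < N) (hp : 1 < p)
    (hu : MemLp u (ENNReal.ofReal (2 * N * p / (N + α)))) (hG : HasWeakGradient u G)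
    (hGp : MemLpLoc G (ENNReal.ofReal (2 * N * p / (N + α)))) :
    HasWeakGradient (fun x => |u x| ^ p) fun x => (p * |u x| ^ (p - 2) * u x) • G x := by
  have hN' : (1 : ℝ) ≤ N := by exact_mod_cast hN
  have hs1 : (1 : ENNReal) ≤ ENNReal.ofReal (2 * N / (N + α)) := by
    rw [ENNReal.one_le_ofReal, le_div_iff₀ (by positivity)]
    linarith
  rw [show 2 * N * p / (N + α) = p * (2 * N / (N + α)) by ring] at hu hGp
  have l1 : LocallyIntegrable fun x => |u x| ^ p :=
    (memLp_abs_rpow (by linarith) (by positivity) hu).locallyIntegrable hs1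
  have l2 : ∀ {w : Space N → ℝ}, MemLpLoc w (ENNReal.ofReal (p * (2 * N / (N + α)))) →
      LocallyIntegrable fun x => p * |u x| ^ (p - 2) * u x * w x := by
    intro w hw
    rw [locallyIntegrable_iff]
    intro S hS
    have : IsFiniteMeasure (volume.restrict S) := ⟨by simpa using hS.measure_lt_top⟩
    have h := memLp_abs_rpow_mul hp (by positivity) (hu.restrict S) (hw S hS)
    refine ((h.integrable hs1).const_mul p).congr (Eventually.of_forall fun x => ?_)
    simp only
    ring
  have mu := hu.1
  refine hasWeakGradient_of_weakDeriv l1 ?_ fun i => ?_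
  · refine locallyIntegrable_smul (((aestronglyMeasurable_abs_rpow mu _).const_mul p).mul mu)
      hG.locInt_grad.aestronglyMeasurable (l2 fun S hS => (hGp S hS).norm)
  · exact (hG.weakDeriv_coord i).abs_rpow hp l1 (l2 (hGp.coord i))

/-- The local bound on the gradient enters as a global one: its norm cut off by the indicator of a
compact set is an admissible factor in `choquard_integrable_mul`. -/
lemma choquard_locallyIntegrable (hN : 1 ≤ N) (hα₀ : 0 < α) (hα₁ : α < N) (hp : 1 < p)
    (hu : MemLp u (ENNReal.ofReal (2 * N * p / (N + α))))
    (hGp : MemLpLoc G (ENNReal.ofReal (2 * N * p / (N + α)))) :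
    LocallyIntegrable fun x =>
      kernPot (N - α) (fun y => |u y| ^ p) x * (|u x| ^ (p - 2) * u x) * ‖G x‖ := by
  rw [locallyIntegrable_iff]
  intro S hS
  have hw : MemLp (S.indicator fun x => ‖G x‖) (ENNReal.ofReal (2 * N * p / (N + α))) :=
    (memLp_indicator_iff_restrict hS.measurableSet).2 (hGp S hS).norm
  have h := integrable_kernPot_mul (μ := N - α) (F := fun y => |u y| ^ p)
    (m := fun x => |u x| ^ (p - 2) * u x * S.indicator (fun x => ‖G x‖) x)
    (choquard_integrable_mul hN hα₀ hα₁ hp hu hw)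
  refine (h.integrableOn (s := S)).congr ?_
  filter_upwards [ae_restrict_mem hS.measurableSet] with x hx
  simp only [indicator_of_mem hx]
  ring

lemma memLp_mul_inner_of_memLpLoc {r : ENNReal} (hG : MemLpLoc G r) (mG : AEStronglyMeasurable G)
    {θ : Space N → ℝ} (hθ : IsTest θ) : MemLp (fun x => θ x * inner ℝ (G x) x) r := by
  obtain ⟨M, hM0, -, -, hM⟩ := hθ.exists_bound_fderiv_self
  have h1 : MemLp ((tsupport θ).indicator fun x => ‖G x‖) r :=
    (memLp_indicator_iff_restrict hθ.compact.isCompact.measurableSet).2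
      (hG _ hθ.compact.isCompact).norm
  refine h1.of_le_mul (c := M) (hθ.continuous.aestronglyMeasurable.mul
    (mG.inner continuous_id.aestronglyMeasurable)) (Eventually.of_forall fun x => ?_)
  by_cases hx : x ∈ tsupport θ
  · rw [indicator_of_mem hx, norm_mul, norm_norm]
    calc _ ≤ ‖θ x‖ * (‖G x‖ * ‖x‖) := by
          gcongr
          exact norm_inner_le_norm _ _
      _ = (|θ x| * ‖x‖) * ‖G x‖ := by rw [Real.norm_eq_abs]; ring
      _ ≤ _ := by
          gcongr
          exact hM x
  · rw [image_eq_zero_of_notMem_tsupport hx]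
    simp [indicator_of_notMem hx]

/-- The dilation identity for the Choquard term. -/
lemma tendsto_choquard_euler (hN : 1 ≤ N) (hα₀ : 0 < α) (hα₁ : α < N) (hp : 1 < p)
    (hu : MemLp u (ENNReal.ofReal (2 * N * p / (N + α)))) (hG : HasWeakGradient u G)
    (hGp : MemLpLoc G (ENNReal.ofReal (2 * N * p / (N + α)))) :
    Tendsto (fun n => ∫ x, kernPot (N - α) (fun y => |u y| ^ p) x
        * (|u x| ^ (p - 2) * u x * (cutoff N n x * inner ℝ (G x) x))) atTop
      (𝓝 (-((N + α) / (2 * p)) * ∫ x, kernPot (N - α) (fun y => |u y| ^ p) x * |u x| ^ p)) := by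
  have hp0 : p ≠ 0 := by linarith
  have hI := fun n => choquard_integrable_mul hN hα₀ hα₁ hp hu
    (memLp_mul_inner_of_memLpLoc hGp hG.locInt_grad.aestronglyMeasurable (isTest_cutoff n))
  have hUU := choquard_integrable hN hα₀ hα₁ hp hu
  have hUU2 : Integrable (fun z : Space N × Space N => kern (N - α) 0 (z.1 - z.2)
      * (|u z.2| ^ p * |u z.1| ^ p)) (volume.prod volume) := by
    simpa only [mul_comm (|u (Prod.fst _)| ^ p)] using hUU
  have e0 : ∀ n (z : Space N × Space N), kern (N - α) 0 (z.1 - z.2) * (|u z.2| ^ p *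
      (cutoff N n z.1 * inner ℝ ((p * |u z.1| ^ (p - 2) * u z.1) • G z.1) z.1))
      = p * (kern (N - α) 0 (z.1 - z.2) * (|u z.2| ^ p * (|u z.1| ^ (p - 2) * u z.1 *
        (cutoff N n z.1 * inner ℝ (G z.1) z.1)))) := by
    intro n z
    rw [inner_smul_left]
    simp only [conj_trivial]
    ring
  have key := tendsto_integral_kern_dilation (μ := N - α) hN (by linarith)
    (choquard_hasWeakGradient hN hα₀ hα₁ hp hu hG hGp) hUU (fun n => by
      simp only [e0]
      exact (hI n).const_mul p)
  simp only [e0, integral_const_mul] at key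
  have eU : ∫ z : Space N × Space N, kern (N - α) 0 (z.1 - z.2)
      * (|u z.1| ^ p * |u z.2| ^ p) ∂(volume.prod volume)
      = ∫ x, kernPot (N - α) (fun y => |u y| ^ p) x * |u x| ^ p := by
    rw [← integral_kern_prod hUU2]
    exact integral_congr_ae (Eventually.of_forall fun z => by simp only; ring)
  rw [eU] at key
  have e1 := fun n => integral_kern_prod (F := fun y => |u y| ^ p)
    (m := fun x => |u x| ^ (p - 2) * u x * (cutoff N n x * inner ℝ (G x) x)) (hI n)
  simp only [e1] at key
  -- The gradient of |u|^p carries a factor p, which is divided out.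
  convert! key.const_mul p⁻¹ using 2
  · field_simp
  · field_simp
    ring

lemma choquard_integrable_energy (hN : 1 ≤ N) (hα₀ : 0 < α) (hα₁ : α < N) (hp : 1 < p)
    (hu : MemLp u (ENNReal.ofReal (2 * N * p / (N + α)))) :
    Integrable fun x => kernPot (N - α) (fun y => |u y| ^ p) x * |u x| ^ p := by
  refine integrable_kernPot_mul (F := fun y => |u y| ^ p) (m := fun x => |u x| ^ p) ?_
  simpa only [mul_comm (|u (Prod.fst _)| ^ p)] using choquard_integrable hN hα₀ hα₁ hp hu

end Choquard

end ChoquardPoisson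

/-! ### The pointwise equation and the coupling term. -/

namespace ChoquardPoisson

open Filter Topology Metric Set Function

variable {N : ℕ}

/-- Sections of the double integral are integrable only up to the value of the other factor at x.
Countably many cutoffs serve as that factor, and at each x one of them equals 1. -/
lemma ae_integrable_kern_mul (hN : 1 ≤ N) {μ : ℝ} (hμ₀ : 0 < μ) (hμ : μ < N) {S : Space N → ℝ}
    (hS : MemLp S (ENNReal.ofReal (2 * N / (2 * N - μ)))) :
    ∀ᵐ x, Integrable fun y => kern μ 0 (x - y) * S y := by
  have h : ∀ n : ℕ, ∀ᵐ x, Integrable fun y => kern μ 0 (x - y) * (cutoff N n x * S y) := fun n =>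
    (integrable_kern_mul hN hμ₀ hμ rfl ((isTest_cutoff n).memLp _) hS).prod_right_ae
  filter_upwards [ae_all_iff.2 h] with x hx
  obtain ⟨n, hn⟩ := (eventually_cutoff_eq_one x).exists
  simpa [hn] using hx n

/-- Since the gradient has weak derivatives, the equation holds almost everywhere. It can then be
multiplied by u or by x·∇u without enlarging the class of test functions. -/
lemma ae_equation {u g f : Space N → ℝ} {G : Space N → Space N} {d : Fin N → Fin N → Space N → ℝ}
    (hG : ∀ i, LocallyIntegrable fun x => G x i)
    (hd : ∀ i j, WeakDeriv (basisVec j) (fun x => G x i) (d i j))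
    (hu : LocallyIntegrable u) (hg : LocallyIntegrable g) (hf : LocallyIntegrable f)
    (heq : ∀ ψ : Space N → ℝ, IsTest ψ →
      (∫ x, inner ℝ (G x) (∇ ψ x)) + (∫ x, u x * ψ x) + (∫ x, g x * ψ x) = ∫ x, f x * ψ x) :
    ∀ᵐ x, -(∑ i, d i i x) + u x + g x = f x := by
  have hl : LocallyIntegrable fun x => ∑ i, d i i x :=
    locallyIntegrable_finsetSum _ fun i _ => (hd i i).locInt_deriv
  have hL : LocallyIntegrable fun x => -(∑ i, d i i x) + u x + g x := (hl.neg.add hu).add hg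
  refine ae_eq_of_integral_contDiff_smul_eq hL hf fun ψ hψ hc => ?_
  have ht : IsTest ψ := ⟨hψ, hc⟩
  have h := heq ψ ht
  have i1 : Integrable fun x => -((∑ i, d i i x) * ψ x) := (ht.integrable_mul hl).neg
  have i2 : Integrable fun x => -((∑ i, d i i x) * ψ x) + u x * ψ x :=
    i1.add (ht.integrable_mul hu)
  rw [integral_inner_gradient_eq hG hd ht, ← integral_neg,
    ← integral_add i1 (ht.integrable_mul hu), ← integral_add i2 (ht.integrable_mul hg)] at h
  simp only [smul_eq_mul]
  simp only [mul_comm (ψ _)]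
  rw [← h]
  exact integral_congr_ae (Eventually.of_forall fun x => by simp; ring)

section Coupling

variable {γ q c : ℝ} {u φ : Space N → ℝ} {G : Space N → Space N}

lemma locallyIntegrable_abs_rpow_of_source
    (hS : LocallyIntegrable fun x => kern γ 1 x * |u x| ^ q) :
    LocallyIntegrable fun x => |u x| ^ q := by
  have h := LocallyIntegrable.continuous_mul hS
    (contDiff_kern (N := N) (-γ) one_pos).continuous
  refine h.congr (Eventually.of_forall fun x => ?_)
  simp only
  rw [← mul_assoc, kern_mul_kern _ _ one_pos]
  simp [kern]

/-- On a compact set φ ≥ cδ > 0 by `exists_kernPot_lower_bound`, and the reciprocal of K is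
continuous. Both can therefore be divided out of the coupling term times |∇u|, which gives |u|^q a
weak gradient. -/
lemma locallyIntegrable_rpow_mul_norm (hq : 1 < q) (hN : 3 ≤ N) (hc : 0 < c)
    (mu : AEStronglyMeasurable u) (mG : AEStronglyMeasurable G)
    (hS : LocallyIntegrable fun x => kern γ 1 x * |u x| ^ q)
    (hSp : MemLp (fun x => kern γ 1 x * |u x| ^ q) (ENNReal.ofReal (2 * N / (N + 2))))
    (hne : ¬ (fun x => kern γ 1 x * |u x| ^ q) =ᵐ[volume] 0)
    (hφ : ∀ᵐ x, φ x = c * kernPot (N - 2) (fun y => kern γ 1 y * |u y| ^ q) x)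
    (hg : LocallyIntegrable fun x => kern γ 1 x * φ x * |u x| ^ (q - 2) * u x * ‖G x‖) :
    LocallyIntegrable fun x => q * |u x| ^ (q - 2) * u x * ‖G x‖ := by
  have hN' : (3 : ℝ) ≤ N := by exact_mod_cast hN
  have hex := ae_integrable_kern_mul (N := N) (μ := N - 2)
    (S := fun x => kern γ 1 x * |u x| ^ q) (by omega) (by linarith) (by linarith)
    (by convert hSp using 3; ring)
  have h2 := LocallyIntegrable.continuous_mul hg
    (contDiff_kern (N := N) (-γ) one_pos).continuous
  rw [locallyIntegrable_iff] at h2 ⊢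
  intro Q hQ
  obtain ⟨R, hR⟩ := hQ.isBounded.subset_closedBall (0 : Space N)
  obtain ⟨δ, hδ, hb⟩ := exists_kernPot_lower_bound (μ := N - 2) (by linarith) (by omega)
    (fun x => mul_nonneg (kern_nonneg γ 1 x) (Real.rpow_nonneg (abs_nonneg (u x)) q)) hS hne hex R
  refine ((h2 Q hQ).norm.const_mul (q * (c * δ)⁻¹)).mono'
    ((((aestronglyMeasurable_abs_rpow mu _).const_mul q).mul mu).mul mG.norm).restrict ?_
  filter_upwards [ae_restrict_mem hQ.measurableSet, ae_restrict_of_ae hb,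
    ae_restrict_of_ae hφ] with x hxQ hx hφx
  have hx' := hx (by simpa using hR hxQ)
  have e1 : kern (-γ) 1 x * (kern γ 1 x * φ x * |u x| ^ (q - 2) * u x * ‖G x‖)
      = φ x * (|u x| ^ (q - 2) * u x * ‖G x‖) := by
    have : kern (-γ) 1 x * kern γ 1 x = 1 := by
      rw [kern_mul_kern _ _ one_pos]; simp [kern]
    linear_combination φ x * (|u x| ^ (q - 2) * u x * ‖G x‖) * this
  rw [e1, norm_mul (φ x)]
  have hφ0 : c * δ ≤ ‖φ x‖ := by
    rw [hφx]
    exact (mul_le_mul_of_nonneg_left hx' hc.le).trans (le_abs_self _)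
  have e2 : q * |u x| ^ (q - 2) * u x * ‖G x‖ = q * (|u x| ^ (q - 2) * u x * ‖G x‖) := by ring
  rw [e2, norm_mul, Real.norm_of_nonneg (by linarith : 0 ≤ q), mul_assoc q]
  gcongr
  rw [← mul_assoc]
  refine le_mul_of_one_le_left (norm_nonneg _) ?_
  rw [inv_mul_eq_div, le_div_iff₀ (by positivity)]
  linarith

/-- Product rule: the second summand comes from ∇K, the kernel of exponent γ + 2 times -γx. -/
lemma source_hasWeakGradient (hq : 1 < q) (hG : HasWeakGradient u G)
    (hl : LocallyIntegrable fun x => |u x| ^ q)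
    (hl' : LocallyIntegrable fun x => q * |u x| ^ (q - 2) * u x * ‖G x‖) :
    HasWeakGradient (fun x => kern γ 1 x * |u x| ^ q) fun x =>
      (kern γ 1 x * (q * |u x| ^ (q - 2) * u x)) • G x
        + (-γ * kern (γ + 2) 1 x * |u x| ^ q) • x := by
  have mu := hG.locInt.aestronglyMeasurable
  have mG := hG.locInt_grad.aestronglyMeasurable
  have mh : AEStronglyMeasurable fun x => q * |u x| ^ (q - 2) * u x :=
    ((aestronglyMeasurable_abs_rpow mu _).const_mul q).mul mu
  have ck : ∀ ν : ℝ, Continuous (kern ν 1 : Space N → ℝ) := fun ν =>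
    (contDiff_kern ν one_pos).continuous
  refine hasWeakGradient_of_weakDeriv (LocallyIntegrable.continuous_mul hl (ck γ)) ?_ fun i => ?_
  · refine (locallyIntegrable_smul ((ck γ).aestronglyMeasurable.mul mh) mG ?_).add
      (locallyIntegrable_smul (G := fun x => x)
        (((ck (γ + 2)).aestronglyMeasurable.const_mul (-γ)).mul
          (aestronglyMeasurable_abs_rpow mu _)) continuous_id.aestronglyMeasurable ?_)
    · refine (LocallyIntegrable.continuous_mul hl' (ck γ)).congr (Eventually.of_forall fun x => ?_)
      simp only [Pi.mul_apply]
      ring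
    · refine (LocallyIntegrable.continuous_mul hl (η := fun x => -γ * kern (γ + 2) 1 x * ‖x‖)
        (((ck (γ + 2)).const_mul (-γ)).mul continuous_norm)).congr
          (Eventually.of_forall fun x => ?_)
      simp only
      ring
  · have l2 : LocallyIntegrable fun x => q * |u x| ^ (q - 2) * u x * G x i := by
      refine hl'.mono (mh.mul (hG.weakDeriv_coord i).locInt_deriv.aestronglyMeasurable)
        (Eventually.of_forall fun x => ?_)
      rw [norm_mul _ (G x i), norm_mul _ ‖G x‖, norm_norm]
      gcongr
      exact PiLp.norm_apply_le (G x) i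
    refine (((hG.weakDeriv_coord i).abs_rpow hq hl l2).mul_smooth
      (contDiff_kern γ one_pos)).congr_right (Eventually.of_forall fun x => ?_)
    simp only [fderiv_kern γ one_pos, inner_basisVec, PiLp.add_apply, PiLp.smul_apply, smul_eq_mul]
    ring

/-- The dilation identity for the coupling term. -/
lemma tendsto_coupling_euler (hN : 3 ≤ N) (hq : 1 < q) (hc : 0 < c) (hG : HasWeakGradient u G)
    (hS : LocallyIntegrable fun x => kern γ 1 x * |u x| ^ q)
    (hSp : MemLp (fun x => kern γ 1 x * |u x| ^ q) (ENNReal.ofReal (2 * N / (N + 2))))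
    (hne : ¬ (fun x => kern γ 1 x * |u x| ^ q) =ᵐ[volume] 0)
    (hφ : ∀ᵐ x, φ x = c * kernPot (N - 2) (fun y => kern γ 1 y * |u y| ^ q) x)
    (mφ : AEStronglyMeasurable φ)
    (hφS : Integrable fun x => φ x * (kern γ 1 x * |u x| ^ q))
    (hg : LocallyIntegrable fun x => kern γ 1 x * φ x * |u x| ^ (q - 2) * u x * ‖G x‖) :
    Tendsto (fun n => ∫ x, kern γ 1 x * φ x * |u x| ^ (q - 2) * u x
        * (cutoff N n x * inner ℝ (G x) x)) atTop
      (𝓝 (q⁻¹ * (-((N + 2) / 2) * (∫ x, φ x * (kern γ 1 x * |u x| ^ q))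
        + γ * ∫ x, φ x * (kern γ 1 x * |u x| ^ q) * (kern 2 1 x * ‖x‖ ^ 2)))) := by
  have hN' : (3 : ℝ) ≤ N := by exact_mod_cast hN
  have hq0 : q ≠ 0 := by linarith
  have mu := hG.locInt.aestronglyMeasurable
  have mG := hG.locInt_grad.aestronglyMeasurable
  have hwg := source_hasWeakGradient (γ := γ) hq hG (locallyIntegrable_abs_rpow_of_source hS)
    (locallyIntegrable_rpow_mul_norm hq hN hc mu mG hS hSp hne hφ hg)
  set S : Space N → ℝ := fun x => kern γ 1 x * |u x| ^ q with hSdef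
  set Γ : Space N → Space N := fun x => (kern γ 1 x * (q * |u x| ^ (q - 2) * u x)) • G x
        + (-γ * kern (γ + 2) 1 x * |u x| ^ q) • x with hΓdef
  have hex := ae_integrable_kern_mul (μ := N - 2) (S := S) (by omega) (by linarith) (by linarith)
    (by convert hSp using 3; ring)
  have hSS : Integrable (fun z : Space N × Space N => kern (N - 2) 0 (z.1 - z.2)
      * (S z.1 * S z.2)) (volume.prod volume) :=
    integrable_kern_mul (by omega) (by linarith) (by linarith) (by congr 1; ring) hSp hSp
  have he : Integrable fun x => φ x * S x * (kern 2 1 x * ‖x‖ ^ 2) := by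
    refine hφS.mul_bdd (c := 1) (((contDiff_kern 2 one_pos).continuous.mul
      (continuous_norm.pow 2)).aestronglyMeasurable) (Eventually.of_forall fun x => ?_)
    rw [Real.norm_of_nonneg (mul_nonneg (kern_nonneg _ _ _) (by positivity))]
    have h1 := kern_add_two_mul (μ := 0) (ε := 1) (z := x) (by positivity)
    have h2 := kern_nonneg 2 1 x
    simp only [zero_add, kern] at h1 h2 ⊢
    norm_num at h1 h2 ⊢
    nlinarith
  have hgi : LocallyIntegrable fun x => kern γ 1 x * φ x * |u x| ^ (q - 2) * u x
      * inner ℝ (G x) x := by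
    refine locallyIntegrable_mul_inner ?_ mG hg
    exact ((((contDiff_kern γ one_pos).continuous.aestronglyMeasurable.mul mφ).mul
      (aestronglyMeasurable_abs_rpow mu _)).mul mu)
  have hg1 : ∀ n, Integrable fun x => kern γ 1 x * φ x * |u x| ^ (q - 2) * u x
      * (cutoff N n x * inner ℝ (G x) x) := fun n =>
    ((isTest_cutoff n).integrable_mul hgi).congr (Eventually.of_forall fun x => by
      simp only; ring)
  have he1 : ∀ n, Integrable fun x => φ x * S x * (kern 2 1 x * ‖x‖ ^ 2) * cutoff N n x :=
    fun n => (isTest_cutoff n).integrable_mul he.locallyIntegrable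
  -- The Euler derivative of the density splits into the term to be computed and the derivative of
  -- the weight, the source of the factor |x|²/(1+|x|²).
  have ept : ∀ n x, φ x * (cutoff N n x * inner ℝ (Γ x) x)
      = q * (kern γ 1 x * φ x * |u x| ^ (q - 2) * u x * (cutoff N n x * inner ℝ (G x) x))
        - γ * (φ x * S x * (kern 2 1 x * ‖x‖ ^ 2) * cutoff N n x) := by
    intro n x
    simp only [hΓdef, hSdef, inner_add_left, inner_smul_left, conj_trivial,
      real_inner_self_eq_norm_sq, ← kern_mul_kern γ 2 one_pos]
    ring
  have hφΓ : ∀ n, Integrable fun x => φ x * (cutoff N n x * inner ℝ (Γ x) x) := fun n => by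
    simp only [ept]
    exact ((hg1 n).const_mul q).sub ((he1 n).const_mul γ)
  have eφ : ∀ m : Space N → ℝ, (fun x => φ x * m x) =ᵐ[volume]
      fun x => c * (kernPot (N - 2) S x * m x) := fun m => by
    filter_upwards [hφ] with x hx
    rw [hx]
    ring
  -- Hardy-Littlewood-Sobolev is not available here, as `Γ` is known only to be locally integrable;
  -- integrability on the product comes from that of φ times the Euler derivative.
  have hkΓ : ∀ n, Integrable (fun z : Space N × Space N => kern (N - 2) 0 (z.1 - z.2)
      * (S z.2 * (cutoff N n z.1 * inner ℝ (Γ z.1) z.1))) (volume.prod volume) := fun n => by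
    refine integrable_kern_prod_of_kernPot (F := S)
      (m := fun x => cutoff N n x * inner ℝ (Γ x) x)
      (fun x => mul_nonneg (kern_nonneg γ 1 x) (Real.rpow_nonneg (abs_nonneg (u x)) q))
      hSp.1 ((isTest_cutoff n).continuous.aestronglyMeasurable.mul
        (hwg.locInt_grad.aestronglyMeasurable.inner continuous_id.aestronglyMeasurable)) hex ?_
    refine (((hφΓ n).congr (eφ _)).const_mul c⁻¹).congr (Eventually.of_forall fun x => ?_)
    simp only
    field_simp
  have key := tendsto_integral_kern_dilation (μ := N - 2) (by omega) (by linarith) hwg hSS hkΓ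
  have hSS2 : Integrable (fun z : Space N × Space N => kern (N - 2) 0 (z.1 - z.2)
      * (S z.2 * S z.1)) (volume.prod volume) := by
    simpa only [mul_comm (S (Prod.fst _))] using hSS
  have eS : ∫ z : Space N × Space N, kern (N - 2) 0 (z.1 - z.2) * (S z.1 * S z.2)
      ∂(volume.prod volume) = ∫ x, kernPot (N - 2) S x * S x := by
    rw [← integral_kern_prod hSS2]
    exact integral_congr_ae (Eventually.of_forall fun z => by simp only; ring)
  rw [eS] at key
  simp only [fun n => integral_kern_prod (F := S)
    (m := fun x => cutoff N n x * inner ℝ (Γ x) x) (hkΓ n)] at key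
  have key2 := ((key.const_mul c).add ((tendsto_integral_mul_cutoff he).const_mul γ)).const_mul q⁻¹
  have e3 : ∫ x, φ x * S x = c * ∫ x, kernPot (N - 2) S x * S x := by
    rw [integral_congr_ae (eφ S), integral_const_mul]
  convert! key2 using 2
  · rename_i n
    rw [← integral_const_mul c, ← integral_congr_ae (eφ _)]
    simp only [ept]
    rw [integral_sub ((hg1 n).const_mul q) ((he1 n).const_mul γ), integral_const_mul,
      integral_const_mul]
    field_simp
    ring
  · rw [e3]
    ring

end Coupling

end ChoquardPoisson

namespace ChoquardPoisson

open Filter Topology Metric Set Function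

variable {N : ℕ}

/-! ### The Pohozaev identity and the sign argument. -/

section Pohozaev

variable {α p q γ : ℝ} {u φ : Space N → ℝ}

lemma IsWeakSolution.exists_eq_kernPot (hN : 3 ≤ N)
    (hs : IsWeakSolution α p q (kern γ 1) u φ) (hr : IsRegular α p q (kern γ 1) u φ) :
    ∃ c : ℝ, 0 < c ∧ ∀ᵐ x, φ x = c * kernPot (N - 2) (fun y => kern γ 1 y * |u y| ^ q) x := by
  obtain ⟨hφ2, H', hH', hH2⟩ := hr.phi_H1
  obtain ⟨H, hH, heq⟩ := hs.second_eq
  obtain ⟨c, hc, h⟩ := exists_eq_newton_potential hN hφ2 hH (hH2.ae_eq (hH'.ae_unique hH))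
    hr.source_Lp heq
  refine ⟨c, hc, ?_⟩
  simpa only [kernPot, kern_sub_comm] using h

lemma integrable_kernPot_mul_self (hN : 3 ≤ N) {S : Space N → ℝ}
    (hS : MemLp S (ENNReal.ofReal (2 * N / (N + 2)))) :
    Integrable fun x => kernPot (N - 2) S x * S x := by
  have hN' : (3 : ℝ) ≤ N := by exact_mod_cast hN
  have h := integrable_kern_mul (N := N) (μ := N - 2) (by omega) (by linarith) (by linarith)
    (by congr 1; ring) hS hS
  exact integrable_kernPot_mul (by simpa only [mul_comm (S (Prod.fst _))] using h)

/-- The Pohozaev identity, combined with the identity obtained by testing with the solution. -/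
lemma pohozaev_identity (hN : 3 ≤ N) (hα₀ : 0 < α) (hα₁ : α < N) (hp : 1 < p) (hq : 1 < q)
    (hs : IsWeakSolution α p q (kern γ 1) u φ) (hr : IsRegular α p q (kern γ 1) u φ)
    (hne : ¬ (fun x => kern γ 1 x * |u x| ^ q) =ᵐ[volume] 0) :
    ∃ G : Space N → Space N, HasWeakGradient u G ∧ MemLp G 2 ∧ ∃ C E : ℝ, 0 ≤ E ∧ E ≤ C ∧
      (2 - N + (N + α) / p) * (∫ x, ‖G x‖ ^ 2) + ((N + α) / p - N) * (∫ x, u x ^ 2)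
        + ((N + α) / p - (N + 2) / q) * C + 2 * γ / q * E = 0 := by
  have hN' : (3 : ℝ) ≤ N := by exact_mod_cast hN
  have hN1 : 1 ≤ N := by omega
  obtain ⟨c, hc, hφ⟩ := hs.exists_eq_kernPot hN hr
  obtain ⟨a, ha, hker⟩ := exists_rieszKernel_eq (N := N) hα₀ hα₁
  obtain ⟨hu2, G₁, hG₁, hG₁2⟩ := hr.u_H1
  obtain ⟨G₂, hG₂, heq⟩ := hs.first_eq
  obtain ⟨G, hG, hGi, hGp⟩ := hr.grad_u
  have hG2 : MemLp G 2 := hG₁2.ae_eq (hG₁.ae_unique hG)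
  choose hGi2 D hD hD2 using hGi
  have hd : ∀ i j, WeakDeriv (basisVec j) (fun x => G x i) (fun x => D i x j) := fun i j =>
    (hD i).weakDeriv_coord j
  have hd2 : ∀ i j, MemLpLoc (fun x => D i x j) 2 := fun i j => (hD2 i).coord j
  have mu := hG.locInt.aestronglyMeasurable
  have mG := hG.locInt_grad.aestronglyMeasurable
  have hE : ∀ᵐ x, -(∑ i, D i x i) + u x + kern γ 1 x * φ x * |u x| ^ (q - 2) * u x
      = rieszPotential α (fun y => |u y| ^ p) x * |u x| ^ (p - 2) * u x := by
    refine ae_equation (fun i => (hGi2 i).locallyIntegrable) hd hG.locInt hs.locInt_coupling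
      hs.locInt_choquard fun ψ hψ => ?_
    rw [← heq ψ hψ]
    congr 2
    refine integral_congr_ae ?_
    filter_upwards [hG.ae_unique hG₂] with x hx
    rw [hx]
  simp only [rieszPotential_eq hker] at hE
  have hl2 : MemLpLoc (fun x => ∑ i, D i x i) 2 := fun Q hQ =>
    memLp_finsetSum _ fun i _ => hd2 i i Q hQ
  have hGn : MemLpLoc (fun x => ‖G x‖) 2 := memLpLoc_of_memLp hG2.norm
  have hlG := hl2.locallyIntegrable_mul hGn
  have huG := (memLpLoc_of_memLp hu2).locallyIntegrable_mul hGn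
  have hfG := choquard_locallyIntegrable hN1 hα₀ hα₁ hp hr.u_Lp hGp
  have hfG' : LocallyIntegrable fun x =>
      a * (kernPot (N - α) (fun y => |u y| ^ p) x * (|u x| ^ (p - 2) * u x) * ‖G x‖) :=
    hfG.smul a
  -- The equation expresses the coupling term through the Choquard term, the Laplacian and u, whose
  -- products with |∇u| are all locally integrable.
  have hgG : LocallyIntegrable fun x => kern γ 1 x * φ x * |u x| ^ (q - 2) * u x * ‖G x‖ := by
    refine ((hfG'.add hlG).sub huG).congr ?_
    filter_upwards [hE] with x hx
    simp only [Pi.add_apply, Pi.sub_apply]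
    linear_combination -‖G x‖ * hx
  set S : Space N → ℝ := fun x => kern γ 1 x * |u x| ^ q with hSdef
  have hS0 : ∀ x, 0 ≤ S x := fun x => mul_nonneg (kern_nonneg γ 1 x) (by positivity)
  have hφS : Integrable fun x => φ x * S x := by
    refine ((integrable_kernPot_mul_self hN hr.source_Lp).const_mul c).congr ?_
    filter_upwards [hφ] with x hx
    rw [hx]
    ring
  have hφS0 : ∀ᵐ x, 0 ≤ φ x * S x := by
    filter_upwards [hφ] with x hx
    rw [hx]
    exact mul_nonneg (mul_nonneg hc.le (kernPot_nonneg hS0 x)) (hS0 x)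
  have he0 : ∀ x : Space N, 0 ≤ kern 2 1 x * ‖x‖ ^ 2 := fun x =>
    mul_nonneg (kern_nonneg _ _ _) (by positivity)
  have he1 : ∀ x : Space N, kern 2 1 x * ‖x‖ ^ 2 ≤ 1 := fun x => by
    have h1 := kern_add_two_mul (μ := 0) (ε := 1) (z := x) (by positivity)
    have h2 := kern_nonneg 2 1 x
    have h3 : kern 0 1 x = 1 := by simp [kern]
    rw [h3, zero_add] at h1
    nlinarith
  -- The second energy differs from the first by the factor |x|²/(1+|x|²), which lies between 0 and
  -- 1.
  refine ⟨G, hG, hG2, ∫ x, φ x * S x, ∫ x, φ x * S x * (kern 2 1 x * ‖x‖ ^ 2), ?_, ?_, ?_⟩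
  · refine integral_nonneg_of_ae ?_
    filter_upwards [hφS0] with x hx
    exact mul_nonneg hx (he0 x)
  · refine integral_mono_of_nonneg ?_ hφS ?_
    · filter_upwards [hφS0] with x hx
      exact mul_nonneg hx (he0 x)
    · filter_upwards [hφS0] with x hx
      exact mul_le_of_le_one_right hx (he1 x)
  have hUu := choquard_integrable_energy hN1 hα₀ hα₁ hp hr.u_Lp
  have t1 := tendsto_integral_laplacian_mul_self hG hu2 hG2 hd hd2
  have t2 := tendsto_integral_laplacian_mul_euler hG hG2 hd hd2
  have t3 := tendsto_integral_mul_cutoff (N := N) hu2.integrable_sq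
  have t4 := tendsto_integral_mul_euler hG hu2 hG2
  have t5 := tendsto_integral_mul_cutoff (N := N) hφS
  have t6 := tendsto_coupling_euler hN hq hc hG hs.locInt_source hr.source_Lp hne hφ
    hr.phi_H1.1.1 hφS hgG
  have t7 := tendsto_integral_mul_cutoff (N := N) hUu
  have t8 := tendsto_choquard_euler hN1 hα₀ hα₁ hp hr.u_Lp hG hGp
  have eq1 : ∀ n, -(∫ x, (∑ i, D i x i) * (u x * cutoff N n x)) + (∫ x, u x ^ 2 * cutoff N n x)
      + (∫ x, φ x * S x * cutoff N n x)
      = a * ∫ x, kernPot (N - α) (fun y => |u y| ^ p) x * |u x| ^ p * cutoff N n x := by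
    intro n
    have ht := isTest_cutoff (N := N) n
    have i1 : Integrable fun x => -((∑ i, D i x i) * (u x * cutoff N n x)) :=
      ((ht.integrable_mul (hl2.locallyIntegrable_mul (memLpLoc_of_memLp hu2))).congr
        (Eventually.of_forall fun x => by simp only; ring)).neg
    have i2 := ht.integrable_mul hu2.integrable_sq.locallyIntegrable
    have i3 := ht.integrable_mul hφS.locallyIntegrable
    have i12 : Integrable fun x => -((∑ i, D i x i) * (u x * cutoff N n x))
        + u x ^ 2 * cutoff N n x := i1.add i2
    rw [← integral_neg, ← integral_add i1 i2, ← integral_add i12 i3, ← integral_const_mul]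
    refine integral_congr_ae ?_
    filter_upwards [hE] with x hx
    have h1 := rpow_sub_two_mul_mul_self (t := u x) hp
    have h2 := rpow_sub_two_mul_mul_self (t := u x) hq
    simp only [hSdef]
    rw [← h1, ← h2]
    linear_combination u x * cutoff N n x * hx
  have eq2 : ∀ n, -(∫ x, (∑ i, D i x i) * (cutoff N n x * inner ℝ (G x) x))
      + (∫ x, u x * (cutoff N n x * inner ℝ (G x) x))
      + (∫ x, kern γ 1 x * φ x * |u x| ^ (q - 2) * u x * (cutoff N n x * inner ℝ (G x) x))
      = a * ∫ x, kernPot (N - α) (fun y => |u y| ^ p) x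
        * (|u x| ^ (p - 2) * u x * (cutoff N n x * inner ℝ (G x) x)) := by
    intro n
    have ht := isTest_cutoff (N := N) n
    have hi : ∀ {h : Space N → ℝ}, AEStronglyMeasurable h →
        LocallyIntegrable (fun x => h x * ‖G x‖) →
        Integrable fun x => h x * (cutoff N n x * inner ℝ (G x) x) := fun mh hh =>
      (ht.integrable_mul (locallyIntegrable_mul_inner mh mG hh)).congr
        (Eventually.of_forall fun x => by simp only; ring)
    have ml : LocallyIntegrable fun x => ∑ i, D i x i := hl2.locallyIntegrable
    have i1 : Integrable fun x => -((∑ i, D i x i) * (cutoff N n x * inner ℝ (G x) x)) :=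
      (hi ml.aestronglyMeasurable hlG).neg
    have i2 := hi mu huG
    have i3 := hi hs.locInt_coupling.aestronglyMeasurable hgG
    have i12 : Integrable fun x => -((∑ i, D i x i) * (cutoff N n x * inner ℝ (G x) x))
        + u x * (cutoff N n x * inner ℝ (G x) x) := i1.add i2
    rw [← integral_neg, ← integral_add i1 i2, ← integral_add i12 i3, ← integral_const_mul]
    refine integral_congr_ae ?_
    filter_upwards [hE] with x hx
    linear_combination cutoff N n x * inner ℝ (G x) x * hx
  have l1 := tendsto_nhds_unique (((t1.neg.add t3).add t5).congr eq1) (t7.const_mul a)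
  have l2 := tendsto_nhds_unique (((t2.neg.add t4).add t6).congr eq2) (t8.const_mul a)
  have hp0 : p ≠ 0 := by linarith
  have hq0 : q ≠ 0 := by linarith
  -- These weights cancel the Choquard energy: its coefficient is 1 in the first identity and
  -- -(N+α)/(2p) in the second.
  linear_combination (N + α) / p * l1 + 2 * l2

lemma ae_eq_zero_of_source (hq : 1 < q) (h : (fun x => kern γ 1 x * |u x| ^ q) =ᵐ[volume] 0) :
    u =ᵐ[volume] 0 := by
  filter_upwards [h] with x hx
  have h1 : |u x| ^ q = 0 := (mul_eq_zero.1 hx).resolve_left (kern_pos γ one_pos x).ne'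
  simpa using (Real.rpow_eq_zero (abs_nonneg _) (by linarith)).1 h1

lemma source_ae_eq_zero (hq : 1 < q) (h : u =ᵐ[volume] 0) :
    (fun x => kern γ 1 x * |u x| ^ q) =ᵐ[volume] 0 := by
  filter_upwards [h] with x hx
  simp [hx, Real.zero_rpow (by linarith : q ≠ 0)]

lemma ae_eq_zero_of_integral_sq {v : Space N → ℝ} (hv : MemLp v 2) (h : ∫ x, v x ^ 2 ≤ 0) :
    v =ᵐ[volume] 0 := by
  have h0 := (integral_eq_zero_iff_of_nonneg (fun x => sq_nonneg (v x)) hv.integrable_sq).1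
    (le_antisymm h (integral_nonneg fun x => sq_nonneg (v x)))
  filter_upwards [h0] with x hx
  simpa using hx

theorem IsWeakSolution.ae_eq_zero (hN : 3 ≤ N) (hα₀ : 0 < α) (hα₁ : α < N)
    (hp : 1 < p) (hq : 1 < q)
    (h : ((0 ≤ γ ∧ γ < ((N : ℝ) + 2) / 2) ∧
            (((N : ℝ) + α) / ((N : ℝ) - 2) ≤ p ∧
              ((N : ℝ) + α) / p ≤ ((N : ℝ) + 2 - 2 * γ) / q)) ∨
         (γ ≤ 0 ∧
            (p ≤ ((N : ℝ) + α) / (N : ℝ) ∧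
              ((N : ℝ) + 2 - 2 * γ) / q ≤ ((N : ℝ) + α) / p)))
    (hs : IsWeakSolution α p q (kern γ 1) u φ) (hr : IsRegular α p q (kern γ 1) u φ) :
    u =ᵐ[volume] 0 ∧ φ =ᵐ[volume] 0 := by
  have hN' : (3 : ℝ) ≤ N := by exact_mod_cast hN
  -- If the source vanishes then so do u, since K > 0, and φ, its potential. Otherwise φ is locally
  -- bounded below, the Pohozaev identity is available, and it forces u = 0, a contradiction.
  by_cases hne : (fun x => kern γ 1 x * |u x| ^ q) =ᵐ[volume] 0
  · refine ⟨ae_eq_zero_of_source hq hne, ?_⟩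
    obtain ⟨c, -, hφ⟩ := hs.exists_eq_kernPot hN hr
    filter_upwards [hφ] with x hx
    rw [hx, kernPot, integral_eq_zero_of_ae]
    · simp
    · filter_upwards [hne] with y hy
      simp only [Pi.zero_apply] at hy ⊢
      rw [hy, mul_zero]
  · exfalso
    obtain ⟨G, hG, hG2, C, E, hE0, hEC, key⟩ := pohozaev_identity hN hα₀ hα₁ hp hq hs hr hne
    have hu2 := hr.u_H1.1
    refine hne (source_ae_eq_zero hq (ae_eq_zero_of_integral_sq hu2 ?_))
    have hA : 0 ≤ ∫ x, ‖G x‖ ^ 2 := integral_nonneg fun x => by positivity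
    have hB : 0 ≤ ∫ x, u x ^ 2 := integral_nonneg fun x => by positivity
    have hq0 : 0 < q := by linarith
    have hsplit : ((N : ℝ) + 2 - 2 * γ) / q = (N + 2) / q - 2 * γ / q := by ring
    rcases h with ⟨⟨hγ, -⟩, h1, h2⟩ | ⟨hγ, h1, h2⟩
    · have hb : ((N : ℝ) + α) / p ≤ N - 2 := by
        rw [div_le_iff₀ (by linarith)] at h1 ⊢
        linarith
      -- Replacing E by C merges both coupling terms into ((N+α)/p - (N+2-2γ)/q) C ≤ 0. What remains
      -- bounds B from above, its coefficient being at most -2.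
      have hγE : 2 * γ / q * E ≤ 2 * γ / q * C := by gcongr
      have k1 := mul_nonneg (sub_nonneg.2 h2) (hE0.trans hEC)
      have k2 := mul_nonneg (sub_nonneg.2 hb) hA
      have k3 := mul_nonneg (sub_nonneg.2 hb) hB
      rw [hsplit] at k1
      nlinarith
    · have hb : (N : ℝ) ≤ (N + α) / p := by
        rw [le_div_iff₀ (by linarith)] at h1 ⊢
        linarith
      -- With γ ≤ 0 the comparison of E with C reverses, and the merged coupling term is
      -- nonnegative. The coefficient of B may vanish here, so the conclusion is drawn from A, whose
      -- coefficient is at least 2.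
      have hγE : 2 * γ / q * C ≤ 2 * γ / q * E :=
        mul_le_mul_of_nonpos_left hEC (div_nonpos_of_nonpos_of_nonneg (by linarith) hq0.le)
      have k1 := mul_nonneg (sub_nonneg.2 h2) (hE0.trans hEC)
      have k2 := mul_nonneg (sub_nonneg.2 hb) hA
      have k3 := mul_nonneg (sub_nonneg.2 hb) hB
      rw [hsplit] at k1
      have hA0 : ∫ x, ‖G x‖ ^ 2 = 0 := by nlinarith
      rw [integral_eq_zero_iff_of_nonneg (fun x => by positivity) (integrable_norm_sq hG2)] at hA0
      -- With zero gradient, the Euler identity for u² gives -(N/2)∫u² = 0.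
      have e : ∀ n, ∫ x, u x * (cutoff N n x * inner ℝ (G x) x) = 0 := fun n => by
        refine integral_eq_zero_of_ae ?_
        filter_upwards [hA0] with x hx
        have : G x = 0 := by simpa using hx
        simp [this]
      have t := tendsto_integral_mul_euler hG hu2 hG2
      simp only [e] at t
      have := tendsto_nhds_unique tendsto_const_nhds t
      nlinarith

end Pohozaev

/-! ### The trivial pair is a regular weak solution. -/

section Trivial

variable {α p q : ℝ} {K u φ : Space N → ℝ}

lemma hasWeakGradient_zero (hu : u =ᵐ[volume] 0) : HasWeakGradient u 0 := by
  refine ⟨(locallyIntegrable_zero).congr hu.symm, locallyIntegrable_zero, fun ψ _ => ?_⟩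
  rw [integral_eq_zero_of_ae]
  · simp
  · filter_upwards [hu] with x hx
    simp [hx]

lemma isWeakSolution_of_ae_eq_zero (hp : 1 < p) (hq : 1 < q) (hu : u =ᵐ[volume] 0)
    (hφ : φ =ᵐ[volume] 0) : IsWeakSolution α p q K u φ := by
  have hz : ∀ {r : ℝ}, 1 < r → (0 : ℝ) ^ r = 0 := fun hr => Real.zero_rpow (by linarith)
  have e1 : (fun x => rieszPotential α (fun y => |u y| ^ p) x * |u x| ^ (p - 2) * u x)
      =ᵐ[volume] 0 := by
    filter_upwards [hu] with x hx
    simp [hx]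
  have e2 : (fun x => K x * φ x * |u x| ^ (q - 2) * u x) =ᵐ[volume] 0 := by
    filter_upwards [hu] with x hx
    simp [hx]
  have e3 : (fun x => K x * |u x| ^ q) =ᵐ[volume] 0 := by
    filter_upwards [hu] with x hx
    simp [hx, hz hq]
  have hmul : ∀ {f : Space N → ℝ}, f =ᵐ[volume] 0 → ∀ ψ : Space N → ℝ,
      ∫ x, f x * ψ x = 0 := fun hf ψ => integral_eq_zero_of_ae (by
    filter_upwards [hf] with x hx
    simp [hx])
  refine ⟨Eventually.of_forall fun x => (integrable_zero _ _ _).congr ?_,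
    locallyIntegrable_zero.congr e1.symm, locallyIntegrable_zero.congr e2.symm,
    locallyIntegrable_zero.congr e3.symm, ⟨0, hasWeakGradient_zero hu, fun ψ _ => ?_⟩,
    ⟨0, hasWeakGradient_zero hφ, fun ψ _ => ?_⟩⟩
  · filter_upwards [hu] with y hy
    simp [hy, hz hp]
  · rw [hmul hu, hmul e1, hmul e2]
    simp
  · rw [hmul e3]
    simp

lemma isRegular_of_ae_eq_zero (hq : 1 < q) (hu : u =ᵐ[volume] 0) (hφ : φ =ᵐ[volume] 0) :
    IsRegular α p q K u φ := by
  have hL : ∀ {f : Space N → ℝ} {r : ENNReal}, f =ᵐ[volume] 0 → MemLp f r := fun hf =>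
    (memLp_congr_ae hf).2 MemLp.zero
  refine ⟨⟨hL hu, 0, hasWeakGradient_zero hu, MemLp.zero⟩, hL hu,
    ⟨hL hφ, 0, hasWeakGradient_zero hφ, MemLp.zero⟩, hL ?_,
    0, hasWeakGradient_zero hu, fun i => ⟨fun Q _ => ?_, 0, ?_, fun Q _ => MemLp.zero⟩,
    fun Q _ => MemLp.zero⟩
  · filter_upwards [hu] with x hx
    simp [hx, Real.zero_rpow (by linarith : q ≠ 0)]
  · simp
  · exact hasWeakGradient_zero (Eventually.of_forall fun x => rfl)

end Trivial

end ChoquardPoisson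

end

theorem corollary2p4 (N : ℕ) (hN : 3 ≤ N) (α p q γ : ℝ) (hα₀ : 0 < α) (hα₁ : α < N)
    (hp : 1 < p) (hq : 1 < q)
    (h : ((0 ≤ γ ∧ γ < ((N : ℝ) + 2) / 2) ∧
            (((N : ℝ) + α) / ((N : ℝ) - 2) ≤ p ∧
              ((N : ℝ) + α) / p ≤ ((N : ℝ) + 2 - 2 * γ) / q)) ∨
         (γ ≤ 0 ∧
            (p ≤ ((N : ℝ) + α) / (N : ℝ) ∧
              ((N : ℝ) + 2 - 2 * γ) / q ≤ ((N : ℝ) + α) / p)))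
    (u φ : EuclideanSpace ℝ (Fin N) → ℝ) :
    (ChoquardPoisson.IsWeakSolution α p q (ChoquardPoisson.weight γ) u φ ∧
        ChoquardPoisson.IsRegular α p q (ChoquardPoisson.weight γ) u φ) ↔
      (u =ᵐ[MeasureTheory.volume] 0 ∧ φ =ᵐ[MeasureTheory.volume] 0) := by
  rw [ChoquardPoisson.weight_eq_kern]
  exact ⟨fun ⟨hs, hr⟩ => hs.ae_eq_zero hN hα₀ hα₁ hp hq h hr, fun ⟨hu, hφ⟩ =>
    ⟨ChoquardPoisson.isWeakSolution_of_ae_eq_zero hp hq hu hφ,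
      ChoquardPoisson.isRegular_of_ae_eq_zero hq hu hφ⟩⟩
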